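/- Let $d\ge 1$ and $n=2^d$, and let $\Bbbk$ be a field whose characteristic does not divide $2n$. Let $R=\Bbbk_{-1}[x_1,\dots,x_n]$ be the $(-1)$-skew polynomial ring, i.e. the $\Bbbk$-algebra generated by $x_1,\dots,x_n$ subject to $x_ix_j=-x_jx_i$ for all $i\neq j$, graded by $\deg x_i=1$. Let $W$ be the group of algebra automorphisms of $R$ generated by $\sigma$, where $\sigma(x_i)=x_{i+1}$ for $1\le i\le n-1$ and $\sigma(x_n)=x_1$. Let $H=\Bbbk W$ be its group algebra, $\int=\frac{1}{|W|}\sum_{g\in W}g$, $R\#H$ the smash product (skew group algebra, with $H$ in degree $0$), and $R^H=R^W$ the invariant ring. The pertinency of the action is $$\mathsf p(R,H)=\operatorname{GKdim}R-\operatorname{GKdim}\bigl((R\#H)/I\bigr),$$ where $I$ is the two-sided ideal generated by $1\#\int$ and $\operatorname{GKdim}$ is the Gelfand–Kirillov dimension. For an $\mathbb N$-graded algebra $B$, let $\operatorname{gr}B$ be the category of finitely generated $\mathbb Z$-graded right $B$-modules with degree-preserving $B$-linear maps, $\operatorname{gr}_0B$ the full subcategory of modules of GK-dimension at most $0$, and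 $\operatorname{qgr}_0B=\operatorname{gr}B/\operatorname{gr}_0B$ the quotient category. Then: 1. $\mathsf p(R,H)=\operatorname{GKdim}R=n\ge 2$. 2. There is an equivalence of categories $\operatorname{qgr}_0(R\#H)\simeq\operatorname{qgr}_0(R^H)$. 3. $R^H$ is a graded isolated singularity; that is, $R^H$ is a (left and right) noetherian connected graded $\Bbbk$-algebra and the abelian category $\operatorname{qgr}_0(R^H)$ has finite global dimension: there is an integer $m$ such that $\operatorname{Ext}^i(X,Y)=0$ for all $i>m$ and all objects $X,Y$. -/

import Mathlib

open CategoryTheory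

universe u v w

namespace Pertinency

noncomputable section

/-! ### Gelfand-Kirillov dimension -/

section GK

variable (k : Type u) [Field k]

/-- The Gelfand-Kirillov dimension of a `k`-algebra `B`: the supremum, over the finite dimensional
subspaces `V` of `B`, of `limsup_n log_n (dim V ^ n)`. It is `-∞` for the zero algebra, because
`ENNReal.log 0 = ⊥`. -/
def GKdim (B : Type v) [Ring B] [Algebra k B] : EReal :=
  ⨆ (V : Submodule k B) (_ : V.FG),
    Filter.limsup
      (fun m : ℕ =>
        ENNReal.log (Module.finrank k ↥(V ^ m) : ENNReal) / ((Real.log (m : ℝ) : ℝ) : EReal))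
      Filter.atTop

/-- The Gelfand-Kirillov dimension of a left `A`-module `M`: the supremum, over the finite
dimensional subspaces `V` of `A` and `W` of `M`, of `limsup_n log_n (dim V ^ n W)`.
Right `B`-modules are left modules over `A = Bᵐᵒᵖ`, and then `V ^ n • W` is the span of the
products `w b₁ ⋯ bₙ`. It is `-∞` for the zero module. -/
def moduleGKdim (A : Type v) (M : Type w) [Ring A] [Algebra k A] [AddCommGroup M] [Module k M]
    [Module A M] [IsScalarTower k A M] : EReal :=
  ⨆ (V : Submodule k A) (_ : V.FG) (W : Submodule k M) (_ : W.FG),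
    Filter.limsup
      (fun m : ℕ =>
        ENNReal.log (Module.finrank k ↥(V ^ m • W) : ENNReal) / ((Real.log (m : ℝ) : ℝ) : EReal))
      Filter.atTop

end GK

/-! ### Graded modules and their quotient categories -/

section Graded

variable (k : Type u) [Field k] {B : Type u} [Ring B] [Algebra k B]

/-- A finitely generated `ℤ`-graded right module over the `ℕ`-graded `k`-algebra `B` whose
component of degree `i` is `ℬ i`. Right `B`-modules are modules over `Bᵐᵒᵖ`. -/
structure GrMod (ℬ : ℕ → Submodule k B) where
  carrier : Type u
  [addCommGroup : AddCommGroup carrier]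
  [moduleBase : Module k carrier]
  [module : Module Bᵐᵒᵖ carrier]
  [isScalarTower : IsScalarTower k Bᵐᵒᵖ carrier]
  deg : ℤ → Submodule k carrier
  isInternal : DirectSum.IsInternal deg
  smul_mem : ∀ (i : ℕ) (j : ℤ) (b : B) (m : carrier), b ∈ ℬ i → m ∈ deg j →
    MulOpposite.op b • m ∈ deg (j + i)
  finite : Module.Finite Bᵐᵒᵖ carrier

attribute [instance] GrMod.addCommGroup GrMod.moduleBase GrMod.module GrMod.isScalarTower

variable {k}

namespace GrMod

variable {ℬ : ℕ → Submodule k B}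

/-- Homomorphisms of graded right modules: `B`-linear maps that preserve degrees. -/
@[ext]
structure Hom (M N : GrMod k ℬ) where
  toLinearMap : M.carrier →ₗ[Bᵐᵒᵖ] N.carrier
  map_mem : ∀ (i : ℤ) (m : M.carrier), m ∈ M.deg i → toLinearMap m ∈ N.deg i

/-- The category `gr B`. -/
instance : Category (GrMod k ℬ) where
  Hom M N := Hom M N
  id M := ⟨LinearMap.id, fun _ _ h => h⟩
  comp f g := ⟨g.toLinearMap ∘ₗ f.toLinearMap, fun i m h => g.map_mem i _ (f.map_mem i m h)⟩

end GrMod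

/-- The morphisms of `gr B` whose kernel and cokernel have GK-dimension at most `n`, that is,
lie in `gr_n B`. -/
def isoModGKdimLE (ℬ : ℕ → Submodule k B) (n : ℤ) : MorphismProperty (GrMod k ℬ) :=
  fun _ N f =>
    moduleGKdim k Bᵐᵒᵖ ↥(LinearMap.ker (GrMod.Hom.toLinearMap f)) ≤ ((n : ℝ) : EReal) ∧
    moduleGKdim k Bᵐᵒᵖ (N.carrier ⧸ LinearMap.range (GrMod.Hom.toLinearMap f)) ≤
      ((n : ℝ) : EReal)

variable (k B)

/-- The quotient category `qgr_n B = gr B / gr_n B`: the quotient of `gr B` by the Serre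
subcategory `gr_n B` is the localization of `gr B` at the morphisms whose kernel and cokernel lie
in `gr_n B`. -/
abbrev qgr (ℬ : ℕ → Submodule k B) (n : ℤ) : Type (u + 1) :=
  (isoModGKdimLE ℬ n).Localization

/-- `C` is an abelian category of finite global dimension: `Ext^i(X, Y) = 0` for all objects
`X`, `Y` and all `i` above some bound independent of `X` and `Y`. (That `C` is abelian is a
property: the additive structure of an abelian category is determined by the category.) -/
def HasFiniteGlobalDimension (C : Type v) [Category.{w} C] : Prop :=
  ∃ (_ : Abelian C) (d : ℕ), ∀ X : C, HasProjectiveDimensionLE X d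

/-- `B`, with homogeneous components `ℬ i`, is a connected `ℕ`-graded `k`-algebra. -/
structure IsConnectedGraded (ℬ : ℕ → Submodule k B) : Prop where
  nontrivial : Nontrivial B
  gradedMonoid : SetLike.GradedMonoid ℬ
  isInternal : DirectSum.IsInternal ℬ
  zero_eq : ℬ 0 = 1

/-- A graded isolated singularity: a (left and right) noetherian connected graded algebra `B`
such that the category `tails B = qgr_0 B` has finite global dimension. -/
structure IsGradedIsolatedSingularity (ℬ : ℕ → Submodule k B) : Prop where
  connected : IsConnectedGraded k B ℬ
  noetherian_left : IsNoetherianRing B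
  noetherian_right : IsNoetherianRing Bᵐᵒᵖ
  finite_gldim : HasFiniteGlobalDimension (qgr k B ℬ 0)

end Graded

/-! ### Group actions: smash product, invariants, pertinency -/

section Action

variable (k : Type u) [Field k] (R : Type v) [Ring R] [Algebra k R]
  (G : Type w) [Group G] [MulSemiringAction G R] [SMulCommClass G k R]

/-- The smash product `R # kG` with the group algebra of `G`: the elements are the sums
`∑ r_g # g`, and `(r # g) (s # h) = r (g • s) # gh`. -/
abbrev Smash : Type (max v w) := SkewMonoidAlgebra R G

/-- The element `1 # ∫` of `R # kG`, where `∫ = |G|⁻¹ ∑ g` is the integral of the group algebra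
`kG` with `ε(∫) = 1`. -/
def smashIntegral [Fintype G] : Smash R G :=
  ((Fintype.card G : k)⁻¹) • ∑ g : G, SkewMonoidAlgebra.single g (1 : R)

/-- The two-sided ideal of `R # kG` generated by `1 # ∫`. -/
def integralIdeal [Fintype G] : TwoSidedIdeal (Smash R G) :=
  TwoSidedIdeal.span {smashIntegral k R G}

/-- The pertinency `p(R, kG) = GKdim R - GKdim ((R # kG) / I)`, with `I` the two-sided ideal
generated by `1 # ∫`. -/
def pertinency [Fintype G] : EReal :=
  GKdim k R - GKdim k (integralIdeal k R G).ringCon.Quotient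

/-- The invariant ring `R^G`. -/
abbrev Invariants : Type v := ↥(FixedPoints.subalgebra k R G)

variable {k R}

/-- The grading of `R # kG` induced by a grading of `R`, with `kG` in degree `0`. -/
def smashGrading (ℛ : ℕ → Submodule k R) (m : ℕ) : Submodule k (Smash R G) where
  carrier := {f | ∀ g : G, f.coeff g ∈ ℛ m}
  add_mem' := by
    intro a b ha hb g
    simpa using (ℛ m).add_mem (ha g) (hb g)
  zero_mem' := by
    intro g
    simp
  smul_mem' := by
    intro c a ha g
    simpa using (ℛ m).smul_mem c (ha g)

/-- The grading of the invariant ring `R^G` induced by a grading of `R`. -/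
def invariantGrading (ℛ : ℕ → Submodule k R) (m : ℕ) :
    Submodule k (Invariants k R G) :=
  (ℛ m).comap (FixedPoints.subalgebra k R G).val.toLinearMap

end Action

/-! ### The `(-1)`-skew polynomial ring and the cyclic permutation -/

section Skew

variable (k : Type u) [Field k] (n : ℕ)

/-- The relations `x_i x_j = - x_j x_i` for `i ≠ j`. -/
inductive SkewRel : FreeAlgebra k (Fin n) → FreeAlgebra k (Fin n) → Prop
  | anticomm (i j : Fin n) (h : i ≠ j) :
      SkewRel (FreeAlgebra.ι k i * FreeAlgebra.ι k j) (-(FreeAlgebra.ι k j * FreeAlgebra.ι k i))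

/-- The `(-1)`-skew polynomial ring `k_{-1}[x_1, …, x_n]`. -/
abbrev SkewPoly : Type u := RingQuot (SkewRel k n)

namespace SkewPoly

/-- The generators; `X k n i` is `x_{i+1}`, since `Fin n` starts at `0`. -/
def X (i : Fin n) : SkewPoly k n := RingQuot.mkAlgHom k (SkewRel k n) (FreeAlgebra.ι k i)

/-- The component of degree `m`, spanned by the monomials of length `m` in the generators. -/
def grading (m : ℕ) : Submodule k (SkewPoly k n) :=
  Submodule.span k (Set.range (X k n)) ^ m

variable {k n}

lemma X_mul_X {i j : Fin n} (h : i ≠ j) : X k n i * X k n j = -(X k n j * X k n i) := by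
  have := RingQuot.mkAlgHom_rel k (SkewRel.anticomm (k := k) i j h)
  simpa [X] using this

lemma algHom_ext {A : Type*} [Semiring A] [Algebra k A] {f g : SkewPoly k n →ₐ[k] A}
    (h : ∀ i, f (X k n i) = g (X k n i)) : f = g := by
  apply RingQuot.ringQuot_ext'
  apply FreeAlgebra.hom_ext
  funext i
  exact h i

/-- The endomorphism `x_i ↦ x_{π i}`. -/
def permHom (π : Equiv.Perm (Fin n)) : SkewPoly k n →ₐ[k] SkewPoly k n :=
  RingQuot.liftAlgHom k ⟨FreeAlgebra.lift k fun i => X k n (π i), by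
    rintro _ _ ⟨i, j, h⟩
    simpa using X_mul_X (fun e => h (π.injective e))⟩

@[simp]
lemma permHom_X (π : Equiv.Perm (Fin n)) (i : Fin n) :
    permHom (k := k) π (X k n i) = X k n (π i) := by
  simp [permHom, X]

variable (k n)

/-- The action of permutations on `k_{-1}[x_1, …, x_n]` by the algebra automorphisms
`x_i ↦ x_{π i}`. -/
def permAut : Equiv.Perm (Fin n) →* (SkewPoly k n ≃ₐ[k] SkewPoly k n) where
  toFun π := AlgEquiv.ofAlgHom (permHom π) (permHom π⁻¹)
    (algHom_ext fun i => by simp) (algHom_ext fun i => by simp)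
  map_one' := by
    apply AlgEquiv.coe_toAlgHom_injective
    exact algHom_ext fun i => by simp
  map_mul' π τ := by
    apply AlgEquiv.coe_toAlgHom_injective
    exact algHom_ext fun i => by simp

@[simp]
lemma permAut_X (π : Equiv.Perm (Fin n)) (i : Fin n) :
    permAut k n π (X k n i) = X k n (π i) :=
  permHom_X π i

/-- The group `W` generated by the automorphism `σ` with `x_i ↦ x_{i+1}` for `i < n` and
`x_n ↦ x_1`. -/
abbrev cyclicGroup : Subgroup (SkewPoly k n ≃ₐ[k] SkewPoly k n) :=
  Subgroup.zpowers (permAut k n (finRotate n))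

instance : Finite (cyclicGroup k n) := by
  have h : IsOfFinOrder (permAut k n (finRotate n)) :=
    (permAut k n).isOfFinOrder (isOfFinOrder_of_finite (finRotate n))
  exact h.finite_zpowers

instance : Fintype (cyclicGroup k n) := Fintype.ofFinite _

end SkewPoly

end Skew

end

end Pertinency

/-! ### Ext groups in a quotient by a Serre subcategory. -/

namespace Pertinency

section ExtLocalization

open Limits DerivedCategory HomologicalComplex Abelian

universe w' v' u'

variable {C : Type u} [Category.{v} C] [Abelian C]

/-! Let `A = R # kW` and `e = 1 # ∫`. Everything rests on one fact: `A / AeA` is finite dimensional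
and nonzero.

Finiteness. The squares `x_i²` are central in `R`, and `R` is finite over `P = k[X_1, …, X_n]`,
where `X_i` acts as `x_i²`. So it is enough to find a power of every `x_i²` in `AeA`
(`Smash.exists_pow_mem`). For a subgroup `H`, let `J_H ⊆ P` be the ideal of coefficients at `1` of
the elements of `AeA` that are supported on `H` and have coefficients from `P` (`Smash.coeffIdeal`).
Then `J_W = P`, because `∑ g` lies in `AeA`, while `J_1` maps into `AeA`. Let `Q` be a prime
containing `J_1`. In the chain from `1` up to `W = ⟨σ⟩` there is a step `⟨s²⟩ ⊂ ⟨s⟩` with `J_⟨s²⟩ ⊆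
Q` and `J_⟨s⟩ ⊄ Q`. Twisted commutators `X_a w - w X_{g⁻¹a}` remove the part of `w` outside `⟨s²⟩`,
and this forces the variables in each `s`-orbit to be congruent modulo `Q`. The alternating sum `v`
of the generators along an `s`-orbit satisfies `s v = -v`, and `v²` is the sum `N` of the squares,
by anticommutation. Hence `v w v + N w` also loses its part outside `⟨s²⟩`, and this forces `N ∈ Q`.
Now `N` is a sum of a power of two of congruent variables and `2` is invertible, so `X_i ∈ Q`.
Therefore `X_i` lies in the radical of `J_1`.

Pertinency. The character of `R` killing all `x_i` maps `AeA` to the multiples of `∑ g` in `kW`, so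
`1 ∉ AeA` (`Smash.one_notMem_integralIdeal`) and `A / AeA` has GK-dimension `0`. As `P` embeds in
`R` and `R` is finite over it, `GKdim R = n` (`SkewGenerators.gkdim_eq`).

Equivalence. The functor `M ↦ Me` from `gr A` to `gr R^W` has coinduction as a right adjoint with
invertible counit, so it is a localization. Because `A / AeA` is finite dimensional, `M` is finite
dimensional as soon as `Me` is (`finite_of_finite_fixedBy`). So both quotient categories are the
same localization of `gr A`. Finiteness conditions are checked over the symmetric polynomials in the
`x_i²`, a noetherian central subring shared by `A` and `R^W`.

Global dimension. Right `A`-modules have projective dimension at most `n`: `R` is an iterated Ore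
extension (`SkewRing.pdLE`) and `|W|` is invertible (`SkewGroup.pdLE`). The bound passes to `gr A`,
and then to its quotient, because Ext classes of the quotient lift to `gr A` after a truncation
(`exists_mapExactFunctor_eq`). -/

lemma epi_iCycles_comp_of_quasiIso {K : CochainComplex C ℤ} {X : C}
    (s : K ⟶ (CochainComplex.singleFunctor C 0).obj X) [QuasiIso s] :
    Epi (K.iCycles 0 ≫ s.f 0) := by
  let L := (CochainComplex.singleFunctor C 0).obj X
  have h1 : IsIso (L.homologyπ 0) := L.isIso_homologyπ (-1) 0 (by simp) ((isZero_single_obj_X _ _ _ _ (by simp)).eq_of_src _ _)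
  have h2 : IsIso (L.iCycles 0) := L.isIso_iCycles 0 1 (by simp) ((isZero_single_obj_X _ _ _ _ (by simp)).eq_of_tgt _ _)
  -- For the stalk complex, `0`-cycles, homology and the object agree, so up to isomorphism the map
  -- is the projection of the `0`-cycles of `K` to its homology.
  have h3 : Epi (cyclesMap s 0 ≫ L.homologyπ 0) := by
    rw [← homologyπ_naturality]
    have : IsIso (homologyMap s 0) := inferInstance
    exact epi_comp _ _
  have h4 : Epi (cyclesMap s 0) := by
    have := epi_comp (cyclesMap s 0 ≫ L.homologyπ 0) (inv (L.homologyπ 0))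
    simpa using this
  rw [← cyclesMap_i]
  exact epi_comp _ _

/-- Effaceability of positive Ext. The class is a right fraction `X ← K → Y[n+1]` whose left leg is
a quasi-isomorphism. The `0`-cycles of `K` map onto `X`, and pulled back to them the class becomes a
map between stalk complexes in different degrees. -/
lemma Ext.exists_epi_comp_eq_zero [HasExt.{w} C] {X Y : C} {n : ℕ} (x : Ext.{w} X Y (n + 1)) :
    ∃ (E : C) (p : E ⟶ X) (_ : Epi p), (Ext.mk₀ p).comp x (zero_add _) = 0 := by
  let := HasDerivedCategory.standard C
  let SX := (CochainComplex.singleFunctor C 0).obj X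
  -- `Y[n+1]` is modelled by the stalk complex in degree `-(n+1)`, which vanishes in degree `0`.
  let SY := (CochainComplex.singleFunctor C (-(n + 1 : ℕ) : ℤ)).obj Y
  let e := ((DerivedCategory.singleFunctors C).shiftIso ((n + 1 : ℕ) : ℤ) (-(n + 1 : ℕ) : ℤ) 0 (by simp)).app Y
  let f : Q.obj SX ⟶ Q.obj SY :=
    ((singleFunctorIsoCompQ C 0).inv.app X ≫ x.hom ≫ e.hom ≫ (singleFunctorIsoCompQ C _).hom.app Y)
  obtain ⟨K, s, hs, g, hf⟩ := right_fac f
  rw [isIso_Q_map_iff_quasiIso] at hs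
  have hs' : IsIso (Q.map s) := by rwa [isIso_Q_map_iff_quasiIso]
  let σ : SX.X 0 ≅ X := singleObjXSelf _ 0 X
  let p : K.cycles 0 ⟶ X := (K.iCycles 0 ≫ s.f 0) ≫ σ.hom
  have hp : Epi p := by
    have := epi_iCycles_comp_of_quasiIso s
    exact epi_comp _ _
  let t : (CochainComplex.singleFunctor C 0).obj (K.cycles 0) ⟶ K :=
    mkHomFromSingle (K.iCycles 0) (fun _ _ => by simp)
  have h1 : t ≫ s = (CochainComplex.singleFunctor C 0).map p := by
    apply from_single_hom_ext
    simp only [t, comp_f, mkHomFromSingle_f, CochainComplex.singleFunctor,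
      CochainComplex.singleFunctors, single_map_f_self, Category.assoc]
    congr 1
    simp only [p, Category.assoc]
    congr 1
    exact (Category.comp_id (s.f 0)).symm.trans (congrArg (s.f 0 ≫ ·) σ.hom_inv_id.symm)
  have h2 : t ≫ g = 0 := by
    apply from_single_hom_ext
    exact (isZero_single_obj_X _ _ _ _ (by simp; omega)).eq_of_tgt _ _
  have h3 : Q.map ((CochainComplex.singleFunctor C 0).map p) ≫ f = 0 := by
    rw [← h1, hf, Functor.map_comp, Category.assoc, IsIso.hom_inv_id_assoc, ← Functor.map_comp, h2,
      Functor.map_zero]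
  have h4 : (DerivedCategory.singleFunctor C 0).map p ≫ x.hom = 0 := by
    have h5 := (singleFunctorIsoCompQ C 0).hom.naturality p
    rw [← cancel_mono (e.hom ≫ (singleFunctorIsoCompQ C _).hom.app Y), zero_comp, Category.assoc,
      ← cancel_epi ((singleFunctorIsoCompQ C 0).inv.app _), comp_zero, ← h3]
    simpa [f] using! ((singleFunctorIsoCompQ C 0).inv.naturality_assoc p _).symm
  refine ⟨_, p, hp, ?_⟩
  ext
  rw [Ext.comp_hom, Ext.mk₀_hom, ShiftedHom.mk₀_comp, h4, Ext.zero_hom]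


variable {D : Type u'} [Category.{v'} D] [Abelian D] (P : ObjectProperty C) [P.IsSerreClass]

/-- Dimension shifting. A positive class dies on an epimorphism, so it is a connecting extension
times a class `y` of lower degree on a kernel. By induction `y` lifts only after restriction along
some `s` into that kernel. The hypothesis `hT` shrinks the middle term so that the new kernel
factors through `s`, and the extension over the shrunken term then carries the lift. -/
lemma exists_mapExactFunctor_eq
    (L : C ⥤ D) [L.IsLocalization P.isoModSerre] [L.Additive] [PreservesFiniteLimits L]
    [PreservesFiniteColimits L]
    [HasExt.{w} C] [HasExt.{w'} D]
    (hT : ∀ {E X K : C} (g : E ⟶ X) (s : K ⟶ kernel g), P.isoModSerre s →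
      ∃ (E' : C) (t : E' ⟶ E) (_ : P.isoModSerre t) (l : kernel (t ≫ g) ⟶ K),
        l ≫ s ≫ kernel.ι g = kernel.ι (t ≫ g) ≫ t)
    {X Y : C} {i : ℕ} (x : Ext (L.obj X) (L.obj Y) i) :
    ∃ (X' : C) (t : X' ⟶ X) (_ : P.isoModSerre t) (x' : Ext X' Y i),
      x'.mapExactFunctor L = (Ext.mk₀ (L.map t)).comp x (zero_add i) := by
  have := Localization.essSurj L P.isoModSerre
  have W {X Y : C} (f : X ⟶ Y) : IsIso (L.map f) ↔ P.isoModSerre f :=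
    ObjectProperty.SerreClassLocalization.isIso_map_iff L P f
  induction i generalizing X with
  | zero =>
    obtain ⟨f, rfl⟩ := (Ext.mk₀_bijective _ _).2 x
    obtain ⟨φ, hφ⟩ := Localization.exists_rightFraction L P.isoModSerre f
    refine ⟨φ.X', φ.s, φ.hs, Ext.mk₀ φ.f, ?_⟩
    rw [Ext.mapExactFunctor_mk₀, Ext.mk₀_comp_mk₀, hφ, MorphismProperty.RightFraction.map_s_comp_map]
  | succ i ih =>
    obtain ⟨E, p, hp, hpx⟩ := Ext.exists_epi_comp_eq_zero x
    -- The epimorphism lives in `D`. A fraction replaces it by `φ.f` in `C`, which need only be epi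
    -- after `L`, hence the passage to its image, whose inclusion `L` inverts.
    obtain ⟨φ, hφ⟩ := Localization.exists_rightFraction L P.isoModSerre
      ((L.objObjPreimageIso E).hom ≫ p)
    have hφs : IsIso (L.map φ.s) := (W _).2 φ.hs
    have hf : L.map φ.f = (L.map φ.s ≫ (L.objObjPreimageIso E).hom) ≫ p := by
      rw [Category.assoc, hφ, MorphismProperty.RightFraction.map_s_comp_map]
    let g := Abelian.factorThruImage φ.f
    let ι := Abelian.image.ι φ.f
    have hι : IsIso (L.map ι) := by
      have h1 : Epi (L.map g ≫ L.map ι) := by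
        rw [← L.map_comp, Abelian.image.fac, hf]
        exact epi_comp _ _
      have := epi_of_epi (L.map g) (L.map ι)
      exact isIso_of_mono_of_epi _
    let S₁ := ShortComplex.mk (kernel.ι g) g (kernel.condition g)
    have hS₁ : S₁.ShortExact := { exact := ShortComplex.exact_kernel g }
    obtain ⟨y, hy⟩ := Ext.contravariant_sequence_exact₃ (hS₁.map_of_exact L) (L.obj Y)
      ((Ext.mk₀ (L.map ι)).comp x (zero_add _)) (by
        change (Ext.mk₀ (L.map g)).comp _ _ = 0
        rw [Ext.mk₀_comp_mk₀_assoc, ← L.map_comp, Abelian.image.fac, hf, ← Ext.mk₀_comp_mk₀_assoc,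
          hpx, Ext.comp_zero]) (add_comm 1 i)
    obtain ⟨K, s, hs, y', hy'⟩ := ih y
    obtain ⟨E', t, ht, l, hl⟩ := hT g s hs
    let g' := Abelian.factorThruImage (t ≫ g)
    let j := Abelian.image.ι (t ≫ g)
    have hgj : g' ≫ j = t ≫ g := Abelian.image.fac _
    have hj : IsIso (L.map j) := by
      have h1 : Epi (L.map g' ≫ L.map j) := by
        have := (W _).2 ht
        rw [← L.map_comp, hgj, L.map_comp]
        exact epi_comp _ _
      have := epi_of_epi (L.map g') (L.map j)
      exact isIso_of_mono_of_epi _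
    let S₂ := ShortComplex.mk (kernel.ι g') g' (kernel.condition g')
    have hS₂ : S₂.ShortExact := { exact := ShortComplex.exact_kernel g' }
    let m : kernel g' ⟶ kernel (t ≫ g) := kernel.lift _ (kernel.ι g') (by
      exact (congrArg (kernel.ι g' ≫ ·) hgj).symm.trans (by simp))
    have hm : m ≫ kernel.ι (t ≫ g) = kernel.ι g' := kernel.lift_ι _ _ _
    let f : S₂ ⟶ S₁ := ⟨m ≫ l ≫ s, t, j, by
      change (m ≫ l ≫ s) ≫ kernel.ι g = kernel.ι g' ≫ t
      rw [Category.assoc, Category.assoc, hl, ← Category.assoc, hm], hgj.symm⟩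
    refine ⟨_, j ≫ ι, (W _).1 (by rw [L.map_comp]; infer_instance),
      hS₂.extClass.comp ((Ext.mk₀ (m ≫ l)).comp y' (zero_add _)) (add_comm 1 i), ?_⟩
    -- The morphism `f` of extensions identifies the image of the lifted product with the
    -- restriction of `x`.
    have key := ShortComplex.ShortExact.extClass_naturality (hS₂.map_of_exact L) (hS₁.map_of_exact L) (L.mapShortComplex.map f)
    have hz : ((Ext.mk₀ (m ≫ l)).comp y' (zero_add i)).mapExactFunctor L =
        (Ext.mk₀ (L.map (m ≫ l ≫ s))).comp y (zero_add i) := by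
      rw [Ext.mapExactFunctor_comp, Ext.mapExactFunctor_mk₀, hy']
      refine (Ext.mk₀_comp_mk₀_assoc (L.map (m ≫ l)) (L.map s) y).trans ?_
      rw [← L.map_comp, Category.assoc]
    have hR : (Ext.mk₀ (L.map (j ≫ ι))).comp x (zero_add _) =
        (Ext.mk₀ (L.map j)).comp ((hS₁.map_of_exact L).extClass.comp y (add_comm 1 i))
          (zero_add _) := by
      rw [L.map_comp, hy]
      exact (Ext.mk₀_comp_mk₀_assoc _ _ _).symm
    rw [Ext.mapExactFunctor_comp, hz, hR, Ext.mapExactFunctor_extClass]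
    have key' := congrArg (fun z => z.comp y (add_comm 1 i)) key
    rw [Ext.comp_assoc_of_second_deg_zero, Ext.comp_assoc _ _ _ _ _ (by omega)] at key'
    exact key'

/-- A class of degree above `n` lifts, after restriction along a map that `L` inverts, to an Ext
group of `C` that vanishes. -/
theorem hasProjectiveDimensionLE_of_isLocalization
    (L : C ⥤ D) [L.IsLocalization P.isoModSerre] [L.Additive] [PreservesFiniteLimits L]
    [PreservesFiniteColimits L]
    (hT : ∀ {E X K : C} (g : E ⟶ X) (s : K ⟶ kernel g), P.isoModSerre s →
      ∃ (E' : C) (t : E' ⟶ E) (_ : P.isoModSerre t) (l : kernel (t ≫ g) ⟶ K),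
        l ≫ s ≫ kernel.ι g = kernel.ι (t ≫ g) ≫ t)
    {n : ℕ} (hC : ∀ X : C, HasProjectiveDimensionLE X n) (Z : D) :
    HasProjectiveDimensionLE Z n := by
  have := Localization.essSurj L P.isoModSerre
  let := HasExt.standard C
  let := HasExt.standard D
  suffices HasProjectiveDimensionLE (L.obj (L.objPreimage Z)) n from
    hasProjectiveDimensionLT_of_iso (L.objObjPreimageIso Z) _
  refine HasProjectiveDimensionLT.mk fun i hi Y x => ?_
  suffices h : x.comp (Ext.mk₀ (L.objObjPreimageIso Y).inv) (add_zero i) = 0 by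
    have h2 := congrArg (fun z => z.comp (Ext.mk₀ (L.objObjPreimageIso Y).hom) (add_zero i)) h
    simpa using h2
  obtain ⟨X', t, ht, x', hx'⟩ := exists_mapExactFunctor_eq P L hT
    (x.comp (Ext.mk₀ (L.objObjPreimageIso Y).inv) (add_zero i))
  have := hC X'
  rw [x'.eq_zero_of_hasProjectiveDimensionLT (n + 1) hi, Ext.mapExactFunctor_zero] at hx'
  have := (ObjectProperty.SerreClassLocalization.isIso_map_iff L P t).2 ht
  have h2 := congrArg (fun z => (Ext.mk₀ (inv (L.map t))).comp z (zero_add i)) hx'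
  simpa using h2.symm

end ExtLocalization

end Pertinency
-- Graded modules: components, homogeneous submodules and quotients.
namespace Pertinency

section Internal

variable {k : Type*} [Field k] {V : Type*} [AddCommGroup V] [Module k V]
  {ι : Type*} [DecidableEq ι]

/-- The criterion by which most gradings below are verified: the operators `c i` recover the
summands, so only spanning is left to check. -/
lemma isInternal_of_projections (D : ι → Submodule k V) (c : ι → V →ₗ[k] V)
    (hc : ∀ i v, v ∈ D i → c i v = v) (hne : ∀ i j v, v ∈ D i → j ≠ i → c j v = 0)
    (htop : ∀ v, v ∈ ⨆ i, D i) : DirectSum.IsInternal D := by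
  refine ⟨?_, ?_⟩
  · have key : ∀ (x : DirectSum ι fun i => D i) (i : ι),
        c i (DirectSum.coeAddMonoidHom D x) = x i := by
      intro x i
      induction x using DirectSum.induction_on with
      | zero => simp
      | of j y =>
        rw [DirectSum.coeAddMonoidHom_of]
        by_cases h : i = j
        · subst h
          rw [hc i _ y.2, DirectSum.of_eq_same]
        · rw [hne j i _ y.2 h, DirectSum.of_eq_of_ne _ _ _ h]
          rfl
      | add x y hx hy => simp [hx, hy]
    intro x y hxy
    refine DFinsupp.ext fun i => Subtype.ext ?_
    rw [← key, ← key, hxy]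
  · intro v
    have := htop v
    induction this using Submodule.iSup_induction' with
    | mem i x hx => exact ⟨DirectSum.of (fun i => D i) i ⟨x, hx⟩, by simp⟩
    | zero => exact ⟨0, by simp⟩
    | add x y _ _ hx hy =>
      obtain ⟨a, rfl⟩ := hx
      obtain ⟨b, rfl⟩ := hy
      exact ⟨a + b, by simp⟩

end Internal

namespace GrMod

variable {k : Type u} [Field k] {B : Type u} [Ring B] [Algebra k B] {ℬ : ℕ → Submodule k B}

noncomputable section

/-- The `B`-linear map underlying a morphism of `gr B`. -/
abbrev lin {M N : GrMod k ℬ} (f : M ⟶ N) : M.carrier →ₗ[Bᵐᵒᵖ] N.carrier := Hom.toLinearMap f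

lemma lin_mem {M N : GrMod k ℬ} (f : M ⟶ N) {i : ℤ} {m : M.carrier} (h : m ∈ M.deg i) :
    lin f m ∈ N.deg i := Hom.map_mem f i m h

lemma hom_ext {M N : GrMod k ℬ} {f g : M ⟶ N} (h : ∀ m, lin f m = lin g m) : f = g :=
  Hom.ext (LinearMap.ext h)

@[simp] lemma lin_comp {M N P : GrMod k ℬ} (f : M ⟶ N) (g : N ⟶ P) :
    lin (f ≫ g) = lin g ∘ₗ lin f := rfl

variable (M : GrMod k ℬ)

instance decomposition : DirectSum.Decomposition M.deg := M.isInternal.chooseDecomposition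

/-- The component of degree `i` of an element of a graded module. -/
def comp (i : ℤ) : M.carrier →ₗ[k] M.carrier :=
  (M.deg i).subtype ∘ₗ DirectSum.component k ℤ _ i ∘ₗ
    (DirectSum.decomposeLinearEquiv M.deg).toLinearMap

lemma comp_apply (i : ℤ) (m : M.carrier) : M.comp i m = DirectSum.decompose M.deg m i := rfl

variable {M}

lemma comp_mem (i : ℤ) (m : M.carrier) : M.comp i m ∈ M.deg i := by
  rw [comp_apply]
  exact (DirectSum.decompose M.deg m i).2

lemma comp_same {i : ℤ} {m : M.carrier} (h : m ∈ M.deg i) : M.comp i m = m :=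
  DirectSum.decompose_of_mem_same _ h

lemma comp_ne {i j : ℤ} {m : M.carrier} (h : m ∈ M.deg i) (hij : j ≠ i) : M.comp j m = 0 :=
  DirectSum.decompose_of_mem_ne _ h hij.symm

lemma comp_of_mem {i : ℤ} (j : ℤ) {m : M.carrier} (h : m ∈ M.deg i) :
    M.comp j m = if j = i then m else 0 := by
  split_ifs with hij
  · subst hij
    exact comp_same h
  · exact comp_ne h hij

lemma exists_sum_comp (m : M.carrier) : ∃ s : Finset ℤ, ∀ t, s ⊆ t → ∑ i ∈ t, M.comp i m = m := by
  classical
  refine ⟨(DirectSum.decompose M.deg m).support, fun t ht => ?_⟩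
  rw [← Finset.sum_subset ht]
  · exact DirectSum.sum_support_decompose _ m
  · intro i _ hi
    rw [comp_apply]
    simpa using hi

lemma ext_comp {m m' : M.carrier} (h : ∀ i, M.comp i m = M.comp i m') : m = m' := by
  classical
  obtain ⟨s, hs⟩ := exists_sum_comp m
  obtain ⟨s', hs'⟩ := exists_sum_comp m'
  rw [← hs _ Finset.subset_union_left, ← hs' _ Finset.subset_union_right]
  exact Finset.sum_congr rfl fun i _ => h i

lemma induction_homogeneous {p : M.carrier → Prop} (h0 : p 0)
    (hh : ∀ (i : ℤ) (m : M.carrier), m ∈ M.deg i → p m)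
    (ha : ∀ m m' : M.carrier, p m → p m' → p (m + m')) (m : M.carrier) : p m := by
  obtain ⟨s, hs⟩ := exists_sum_comp m
  rw [← hs s subset_rfl]
  exact Finset.sum_induction _ p ha h0 fun i _ => hh i _ (comp_mem i m)

lemma lin_comp_apply {N : GrMod k ℬ} (f : M ⟶ N) (i : ℤ) (m : M.carrier) :
    lin f (M.comp i m) = N.comp i (lin f m) := by
  induction m using induction_homogeneous with
  | h0 => simp
  | hh j m hm =>
    rw [comp_of_mem i hm, comp_of_mem i (lin_mem f hm)]
    split_ifs <;> simp
  | ha m m' h h' => rw [map_add, map_add, map_add, map_add, h, h']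

lemma comp_smul (i : ℤ) (j : ℕ) {b : B} (hb : b ∈ ℬ j) (m : M.carrier) :
    M.comp i (MulOpposite.op b • m) = MulOpposite.op b • M.comp (i - j) m := by
  induction m using induction_homogeneous with
  | h0 => simp
  | hh l m hm =>
    rw [comp_of_mem i (M.smul_mem j l b m hb hm), comp_of_mem (i - j) hm]
    have : i = l + j ↔ i - j = l := by omega
    simp only [this]
    split_ifs <;> simp
  | ha m m' h h' => rw [smul_add, map_add, map_add, smul_add, h, h']

lemma lin_smul_base {N : GrMod k ℬ} (f : M ⟶ N) (c : k) (m : M.carrier) :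
    lin f (c • m) = c • lin f m :=
  (lin f).map_smul_of_tower c m

/-- Extensionality of the degrees: a linear map that commutes with all components is graded. -/
lemma mem_deg_iff {i : ℤ} {m : M.carrier} : m ∈ M.deg i ↔ M.comp i m = m :=
  ⟨comp_same, fun h => h ▸ comp_mem i m⟩

/-! ### Homogeneous submodules and their quotients -/

/-- A submodule that contains the components of its elements. -/
def IsHomogeneous (N : Submodule Bᵐᵒᵖ M.carrier) : Prop :=
  ∀ (i : ℤ) (m : M.carrier), m ∈ N → M.comp i m ∈ N

variable [IsNoetherianRing Bᵐᵒᵖ]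

instance : Module.Finite Bᵐᵒᵖ M.carrier := M.finite

instance : IsNoetherian Bᵐᵒᵖ M.carrier := isNoetherian_of_isNoetherianRing_of_finite _ _

variable (M)

/-- A homogeneous submodule, as an object of `gr B`. -/
def sub (N : Submodule Bᵐᵒᵖ M.carrier) (hN : IsHomogeneous N) : GrMod k ℬ where
  carrier := N
  deg i := (M.deg i).comap (N.subtype.restrictScalars k)
  isInternal := by
    refine isInternal_of_projections _
      (fun i => (M.comp i).restrict (p := N.restrictScalars k) (q := N.restrictScalars k)
        (fun m hm => hN i m hm)) ?_ ?_ ?_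
    · intro i v hv
      exact Subtype.ext (comp_same hv)
    · intro i j v hv hij
      exact Subtype.ext (comp_ne hv hij)
    · intro v
      obtain ⟨s, hs⟩ := exists_sum_comp (v : M.carrier)
      have : v = ∑ i ∈ s, (⟨M.comp i v, hN i v v.2⟩ : N) := by
        refine Subtype.ext ?_
        rw [AddSubmonoidClass.coe_finsetSum]
        exact (hs s subset_rfl).symm
      rw [this]
      exact Submodule.sum_mem _ fun i _ =>
        Submodule.mem_iSup_of_mem i (by simpa using comp_mem i _)
  smul_mem i j b m hb hm := M.smul_mem i j b m hb hm
  finite := inferInstance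

/-- The quotient by a homogeneous submodule, as an object of `gr B`. -/
def quot (N : Submodule Bᵐᵒᵖ M.carrier) (hN : IsHomogeneous N) : GrMod k ℬ where
  carrier := M.carrier ⧸ N
  deg i := (M.deg i).map (N.mkQ.restrictScalars k)
  isInternal := by
    refine isInternal_of_projections _
      (fun i => (N.restrictScalars k).mapQ (N.restrictScalars k) (M.comp i)
        (fun m hm => hN i m hm)) ?_ ?_ ?_
    · rintro i _ ⟨v, hv, rfl⟩
      exact congrArg N.mkQ (comp_same hv)
    · rintro i j _ ⟨v, hv, rfl⟩ hij
      exact (congrArg N.mkQ (comp_ne hv hij)).trans (map_zero _)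
    · intro v
      obtain ⟨v, rfl⟩ := N.mkQ_surjective v
      obtain ⟨s, hs⟩ := exists_sum_comp v
      rw [← hs s subset_rfl, map_sum]
      exact Submodule.sum_mem _ fun i _ =>
        Submodule.mem_iSup_of_mem i ⟨_, comp_mem i v, rfl⟩
  smul_mem := by
    rintro i j b _ hb ⟨v, hv, rfl⟩
    exact ⟨_, M.smul_mem i j b v hb hv, rfl⟩
  finite := Module.Finite.of_surjective N.mkQ N.mkQ_surjective

end

end GrMod

end Pertinency
-- The abelian category `gr B`.
namespace Pertinency

namespace GrMod

open Limits

noncomputable section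

variable {k : Type u} [Field k] {B : Type u} [Ring B] [Algebra k B] {ℬ : ℕ → Submodule k B}

/-! ### The additive structure of `gr B` -/

section Preadditive

variable {M N P : GrMod k ℬ}

instance : Zero (M ⟶ N) := ⟨⟨0, fun _ _ _ => by simp⟩⟩

instance : Add (M ⟶ N) :=
  ⟨fun f g => ⟨lin f + lin g, fun i _ h => (N.deg i).add_mem (lin_mem f h) (lin_mem g h)⟩⟩

instance : Neg (M ⟶ N) := ⟨fun f => ⟨-lin f, fun i _ h => (N.deg i).neg_mem (lin_mem f h)⟩⟩

instance : Sub (M ⟶ N) :=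
  ⟨fun f g => ⟨lin f - lin g, fun i _ h => (N.deg i).sub_mem (lin_mem f h) (lin_mem g h)⟩⟩

instance : SMul ℕ (M ⟶ N) :=
  ⟨fun c f => ⟨c • lin f, fun i _ h => (N.deg i).nsmul_mem (lin_mem f h) c⟩⟩

instance : SMul ℤ (M ⟶ N) :=
  ⟨fun c f => ⟨c • lin f, fun _ _ h => zsmul_mem (lin_mem f h) c⟩⟩

lemma lin_injective : Function.Injective (fun f : M ⟶ N => lin f) := fun _ _ h => Hom.ext h

instance : AddCommGroup (M ⟶ N) :=
  lin_injective.addCommGroup _ rfl (fun _ _ => rfl) (fun _ => rfl) (fun _ _ => rfl)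
    (fun _ _ => rfl) (fun _ _ => rfl)

@[simp] lemma lin_zero : lin (0 : M ⟶ N) = 0 := rfl

@[simp] lemma lin_add (f g : M ⟶ N) : lin (f + g) = lin f + lin g := rfl

instance : Preadditive (GrMod k ℬ) where
  add_comp _ _ _ f g h := hom_ext fun m => by simp
  comp_add _ _ _ f g h := hom_ext fun m => by simp

end Preadditive

/-! ### Isomorphisms -/

/-- The inverse preserves degrees because a graded map commutes with taking components. -/
lemma isIso_of_bijective {M N : GrMod k ℬ} (f : M ⟶ N) (hf : Function.Bijective (lin f)) :
    IsIso f := by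
  let e := LinearEquiv.ofBijective (lin f) hf
  have he : ∀ n, lin f (e.symm n) = n := e.apply_symm_apply
  refine ⟨⟨⟨e.symm.toLinearMap, fun i n hn => ?_⟩, ?_, ?_⟩⟩
  · rw [mem_deg_iff]
    apply hf.1
    rw [lin_comp_apply]
    erw [he]
    exact comp_same hn
  · exact hom_ext fun m => e.symm_apply_apply m
  · exact hom_ext fun m => e.apply_symm_apply m

/-! ### Finite products -/

section Pi

variable {J : Type} [Fintype J] [DecidableEq J] (M : J → GrMod k ℬ)

/-- A finite product of graded modules. -/
def pi : GrMod k ℬ where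
  carrier := ∀ j, (M j).carrier
  deg i := Submodule.pi Set.univ fun j => (M j).deg i
  isInternal := by
    refine isInternal_of_projections _
      (fun i => LinearMap.pi fun j => (M j).comp i ∘ₗ LinearMap.proj j) ?_ ?_ ?_
    · intro i v hv
      exact funext fun j => comp_same (hv j trivial)
    · intro i i' v hv hi
      exact funext fun j => comp_ne (hv j trivial) hi
    · intro v
      rw [← Finset.univ_sum_single v]
      refine Submodule.sum_mem _ fun j _ => ?_
      obtain ⟨s, hs⟩ := exists_sum_comp (v j)
      have h : (Pi.single j (v j) : ∀ j, (M j).carrier) =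
          ∑ i ∈ s, Pi.single j ((M j).comp i (v j)) := by
        conv_lhs => rw [← hs s subset_rfl]
        exact map_sum (AddMonoidHom.single (fun j => (M j).carrier) j) _ _
      rw [h]
      refine Submodule.sum_mem _ fun i _ => Submodule.mem_iSup_of_mem i fun j' _ => ?_
      by_cases hj : j' = j
      · subst hj
        simpa using comp_mem i _
      · simp [Pi.single_eq_of_ne hj]
  smul_mem i l b m hb hm j _ := (M j).smul_mem i l b (m j) hb (hm j trivial)
  finite := by
    have := fun j => (M j).finite
    exact Module.Finite.pi

/-- The projections of a finite product. -/
def piProj (j : J) : pi M ⟶ M j := ⟨LinearMap.proj j, fun _ _ hm => hm j trivial⟩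

/-- The morphism to a finite product with given components. -/
def piLift {N : GrMod k ℬ} (f : ∀ j, N ⟶ M j) : N ⟶ pi M :=
  ⟨LinearMap.pi fun j => lin (f j), fun _ _ hn j _ => lin_mem (f j) hn⟩

instance : HasFiniteProducts (GrMod k ℬ) :=
  ⟨fun n => ⟨fun F => by
    let M : Fin n → GrMod k ℬ := fun j => F.obj ⟨j⟩
    have h : HasLimit (Discrete.functor M) := by
      refine ⟨⟨⟨Fan.mk (pi M) (piProj M), Fan.IsLimit.mk _ (fun s => piLift M s.proj) ?_ ?_⟩⟩⟩
      · intro s j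
        exact hom_ext fun m => rfl
      · intro s m hm
        refine hom_ext fun x => funext fun j => ?_
        exact congrArg (fun f => lin f x) (hm j)
    exact hasLimit_of_iso (F := Discrete.functor M) (Discrete.natIsoFunctor.symm)⟩⟩

end Pi

/-! ### Kernels and cokernels -/

section Kernels

variable {M N : GrMod k ℬ} (f : M ⟶ N)

lemma isHomogeneous_ker : IsHomogeneous (M := M) (LinearMap.ker (lin f)) := by
  intro i m hm
  rw [LinearMap.mem_ker] at hm ⊢
  rw [lin_comp_apply, hm, map_zero]

lemma isHomogeneous_range : IsHomogeneous (M := N) (LinearMap.range (lin f)) := by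
  rintro i _ ⟨m, rfl⟩
  exact ⟨M.comp i m, lin_comp_apply f i m⟩

variable [IsNoetherianRing Bᵐᵒᵖ]

/-- The inclusion of a homogeneous submodule. -/
def subι (K : Submodule Bᵐᵒᵖ M.carrier) (hK : IsHomogeneous K) : M.sub K hK ⟶ M :=
  ⟨K.subtype, fun _ _ h => h⟩

/-- The projection to the quotient by a homogeneous submodule. -/
def quotπ (K : Submodule Bᵐᵒᵖ M.carrier) (hK : IsHomogeneous K) : M ⟶ M.quot K hK :=
  ⟨K.mkQ, fun _ _ h => ⟨_, h, rfl⟩⟩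

/-- Morphisms that land in a homogeneous submodule factor through it. -/
def subLift {P : GrMod k ℬ} (K : Submodule Bᵐᵒᵖ M.carrier) (hK : IsHomogeneous K) (g : P ⟶ M)
    (h : ∀ p, lin g p ∈ K) : P ⟶ M.sub K hK :=
  ⟨(lin g).codRestrict K h, fun _ _ hp => lin_mem g hp⟩

/-- Morphisms that vanish on a homogeneous submodule factor through the quotient. -/
def quotDesc {P : GrMod k ℬ} (K : Submodule Bᵐᵒᵖ M.carrier) (hK : IsHomogeneous K) (g : M ⟶ P)
    (h : K ≤ LinearMap.ker (lin g)) : M.quot K hK ⟶ P :=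
  ⟨K.liftQ (lin g) h, by
    rintro i _ ⟨m, hm, rfl⟩
    exact lin_mem g hm⟩

/-- The kernel, as an object of `gr B`. -/
abbrev ker : GrMod k ℬ := M.sub (LinearMap.ker (lin f)) (isHomogeneous_ker f)

/-- The cokernel, as an object of `gr B`. -/
abbrev coker : GrMod k ℬ := N.quot (LinearMap.range (lin f)) (isHomogeneous_range f)

/-- The inclusion of the kernel. -/
abbrev kerι : ker f ⟶ M := subι (LinearMap.ker (lin f)) (isHomogeneous_ker f)

/-- The projection to the cokernel. -/
abbrev cokerπ : N ⟶ coker f := quotπ (LinearMap.range (lin f)) (isHomogeneous_range f)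

lemma kerι_comp : kerι f ≫ f = 0 := hom_ext fun m => m.2

omit [IsNoetherianRing Bᵐᵒᵖ] in
lemma comp_cokerπ : f ≫ cokerπ f = 0 :=
  hom_ext fun m => (Submodule.Quotient.mk_eq_zero _).2 ⟨m, rfl⟩

/-- The inclusion of the kernel is a kernel. -/
def isLimitKer : IsLimit (KernelFork.ofι (kerι f) (kerι_comp f)) :=
  KernelFork.IsLimit.ofι _ _
    (fun g hg => subLift _ _ g fun p => congrArg (fun h => lin h p) hg)
    (fun _ _ => hom_ext fun _ => rfl)
    (fun _ _ _ hm => hom_ext fun p => Subtype.ext (congrArg (fun h => lin h p) hm))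

/-- The projection to the cokernel is a cokernel. -/
def isColimitCoker : IsColimit (CokernelCofork.ofπ (cokerπ f) (comp_cokerπ f)) :=
  CokernelCofork.IsColimit.ofπ _ _
    (fun g hg => quotDesc _ _ g (by
      rintro _ ⟨m, rfl⟩
      exact congrArg (fun h => lin h m) hg))
    (fun _ _ => hom_ext fun _ => rfl)
    (fun _ _ _ hm => hom_ext fun p => by
      obtain ⟨p, rfl⟩ := Submodule.mkQ_surjective _ p
      exact congrArg (fun h => lin h p) hm)

instance : HasKernels (GrMod k ℬ) := ⟨fun f => ⟨⟨⟨_, isLimitKer f⟩⟩⟩⟩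

instance : HasCokernels (GrMod k ℬ) := ⟨fun f => ⟨⟨⟨_, isColimitCoker f⟩⟩⟩⟩

lemma mono_iff_injective : Mono f ↔ Function.Injective (lin f) := by
  refine ⟨fun _ => ?_, fun h => ⟨fun g g' hg => hom_ext fun p =>
    h (congrArg (fun h => lin h p) hg)⟩⟩
  rw [injective_iff_map_eq_zero]
  intro m hm
  have : kerι f = 0 := by
    rw [← cancel_mono f, kerι_comp, zero_comp]
  exact congrArg (fun h => lin h (⟨m, hm⟩ : LinearMap.ker (lin f))) this

omit [IsNoetherianRing Bᵐᵒᵖ] in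
lemma epi_iff_surjective : Epi f ↔ Function.Surjective (lin f) := by
  refine ⟨fun _ => ?_, fun h => ⟨fun g g' hg => hom_ext fun p => ?_⟩⟩
  · have : cokerπ f = 0 := by
      rw [← cancel_epi f, comp_cokerπ, comp_zero]
    intro n
    exact (Submodule.Quotient.mk_eq_zero _).1 (congrArg (fun h => lin h n) this)
  · obtain ⟨m, rfl⟩ := h p
    exact congrArg (fun h => lin h m) hg

/-- A graded bijection onto the kernel of `g` exhibits its source as the kernel of `g`. -/
def isLimitOfExact {P : GrMod k ℬ} (g : N ⟶ P) (w : f ≫ g = 0) (hf : Function.Injective (lin f))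
    (h : ∀ n, lin g n = 0 → n ∈ LinearMap.range (lin f)) :
    IsLimit (KernelFork.ofι f w) := by
  have : IsIso (subLift (P := M) _ (isHomogeneous_ker g) f
      fun p => congrArg (fun h => lin h p) w) := by
    refine isIso_of_bijective _ ⟨fun a b hab => hf (congrArg Subtype.val hab), fun n => ?_⟩
    obtain ⟨m, hm⟩ := h n.1 n.2
    exact ⟨m, Subtype.ext hm⟩
  exact (isLimitKer g).ofIsoLimit (Fork.ext (asIso (subLift (P := M) _ (isHomogeneous_ker g) f
      fun p => congrArg (fun h => lin h p) w)).symm (by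
        rw [Iso.symm_hom, asIso_inv, IsIso.inv_comp_eq]
        exact hom_ext fun _ => rfl))

/-- A graded surjection is the cokernel of the maps that cover its kernel. -/
def isColimitOfExact {P : GrMod k ℬ} (g : N ⟶ P) (w : f ≫ g = 0)
    (hg : Function.Surjective (lin g)) (h : ∀ n, lin g n = 0 → n ∈ LinearMap.range (lin f)) :
    IsColimit (CokernelCofork.ofπ g w) := by
  have hw : LinearMap.range (lin f) ≤ LinearMap.ker (lin g) := by
    rintro _ ⟨m, rfl⟩
    exact congrArg (fun h => lin h m) w
  have : IsIso (quotDesc (M := N) _ (isHomogeneous_range f) g hw) := by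
    refine isIso_of_bijective _ ⟨?_, fun p => ?_⟩
    · rw [injective_iff_map_eq_zero]
      intro n hn
      obtain ⟨n, rfl⟩ := Submodule.mkQ_surjective _ n
      exact (Submodule.Quotient.mk_eq_zero _).2 (h n hn)
    · obtain ⟨n, rfl⟩ := hg p
      exact ⟨Submodule.mkQ _ n, rfl⟩
  exact (isColimitCoker f).ofIsoColimit (Cofork.ext
    (asIso (quotDesc (M := N) _ (isHomogeneous_range f) g hw)) (hom_ext fun _ => rfl))

end Kernels

variable [IsNoetherianRing Bᵐᵒᵖ]

instance : Abelian (GrMod k ℬ) where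
  normalMonoOfMono f hf := ⟨{
    Z := _
    g := cokerπ f
    w := comp_cokerπ f
    isLimit := isLimitOfExact f _ (comp_cokerπ f) ((mono_iff_injective f).1 hf) fun _ hn =>
      (Submodule.Quotient.mk_eq_zero _).1 hn }⟩
  normalEpiOfEpi f hf := ⟨{
    W := _
    g := kerι f
    w := kerι_comp f
    isColimit := isColimitOfExact (kerι f) f (kerι_comp f) ((epi_iff_surjective f).1 hf)
      fun n hn => ⟨⟨n, hn⟩, rfl⟩ }⟩

/-- The canonical short exact sequence of an epimorphism. -/
lemma shortExact_ker {M N : GrMod k ℬ} (f : M ⟶ N) (hf : Function.Surjective (lin f)) :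
    (ShortComplex.mk (kerι f) f (kerι_comp f)).ShortExact where
  exact := ShortComplex.exact_of_f_is_kernel _ (isLimitKer f)
  mono_f := (mono_iff_injective _).2 Subtype.val_injective
  epi_g := (epi_iff_surjective _).2 hf

end

end GrMod

end Pertinency
-- Growth estimates and modules of GK-dimension at most zero.
namespace Pertinency

section GrowthLemmas

/-- Positivity of `D` keeps its logarithm real, while `d` may be `0` with logarithm `⊥`. -/
lemma log_natCast_div_le {d D m : ℕ} (hD : 1 ≤ D) (h : d ≤ D) :
    ENNReal.log (d : ENNReal) / ((Real.log (m : ℝ) : ℝ) : EReal) ≤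
      ((Real.log D / Real.log m : ℝ) : EReal) := by
  have h1 : ENNReal.log (D : ENNReal) = ((Real.log D : ℝ) : EReal) := by
    rw [← ENNReal.ofReal_natCast, ENNReal.log_ofReal, if_neg]
    have : (0 : ℝ) < D := by exact_mod_cast hD
    exact not_le.2 this
  rw [EReal.coe_div, ← h1]
  refine EReal.div_le_div_right_of_nonneg ?_ (ENNReal.log_monotone (by exact_mod_cast h))
  exact_mod_cast Real.log_natCast_nonneg m

lemma le_log_natCast_div {d D m : ℕ} (hD : 1 ≤ D) (h : D ≤ d) :
    ((Real.log D / Real.log m : ℝ) : EReal) ≤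
      ENNReal.log (d : ENNReal) / ((Real.log (m : ℝ) : ℝ) : EReal) := by
  have h1 : ENNReal.log (D : ENNReal) = ((Real.log D : ℝ) : EReal) := by
    rw [← ENNReal.ofReal_natCast, ENNReal.log_ofReal, if_neg]
    have : (0 : ℝ) < D := by exact_mod_cast hD
    exact not_le.2 this
  rw [EReal.coe_div, ← h1]
  refine EReal.div_le_div_right_of_nonneg ?_ (ENNReal.log_monotone (by exact_mod_cast h))
  exact_mod_cast Real.log_natCast_nonneg m

open Filter Topology

lemma limsup_log_div_le {d : ℕ → ℕ} {D : ℕ → ℕ} {c : ℝ} (hD : ∀ m, 1 ≤ D m) (h : ∀ m, d m ≤ D m)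
    (hc : Tendsto (fun m : ℕ => Real.log (D m) / Real.log m) atTop (𝓝 c)) :
    limsup (fun m : ℕ => ENNReal.log (d m : ENNReal) / ((Real.log (m : ℝ) : ℝ) : EReal)) atTop ≤
      (c : EReal) := by
  have h1 : Tendsto (fun m : ℕ => ((Real.log (D m) / Real.log m : ℝ) : EReal)) atTop (𝓝 (c : EReal)) :=
    (continuous_coe_real_ereal.tendsto c).comp hc
  rw [← h1.limsup_eq]
  refine limsup_le_limsup ?_
  exact Eventually.of_forall fun m => log_natCast_div_le (hD m) (h m)

/-- Positivity is asked only for `m ≥ 1`, so that comparison functions such as `m` may vanish at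
`0`. -/
lemma le_limsup_log_div {d : ℕ → ℕ} {D : ℕ → ℕ} {c : ℝ} (hD : ∀ m, 1 ≤ m → 1 ≤ D m)
    (h : ∀ m, D m ≤ d m)
    (hc : Tendsto (fun m : ℕ => Real.log (D m) / Real.log m) atTop (𝓝 c)) :
    (c : EReal) ≤
      limsup (fun m : ℕ => ENNReal.log (d m : ENNReal) / ((Real.log (m : ℝ) : ℝ) : EReal)) atTop := by
  have h1 : Tendsto (fun m : ℕ => ((Real.log (D m) / Real.log m : ℝ) : EReal)) atTop (𝓝 (c : EReal)) :=
    (continuous_coe_real_ereal.tendsto c).comp hc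
  rw [← h1.limsup_eq]
  refine limsup_le_limsup ?_
  filter_upwards [eventually_ge_atTop 1] with m hm
  exact le_log_natCast_div (hD m hm) (h m)

lemma tendsto_log_const_div (D : ℕ) :
    Tendsto (fun m : ℕ => Real.log (D : ℝ) / Real.log m) atTop (𝓝 0) :=
  tendsto_const_nhds.div_atTop (Real.tendsto_log_atTop.comp tendsto_natCast_atTop_atTop)

end GrowthLemmas

section ModuleGK

variable {k : Type*} [Field k] {A : Type*} {M : Type*} [Ring A] [Algebra k A] [AddCommGroup M]
  [Module k M] [Module A M] [IsScalarTower k A M]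

lemma Submodule.FG.smul_submodule {V : Submodule k A} {W : Submodule k M} (hV : V.FG)
    (hW : W.FG) : (V • W).FG := by
  have : V • W = Submodule.map₂ (Algebra.lsmul k k M : A →ₐ[k] Module.End k M).toLinearMap V W :=
    le_antisymm (Submodule.smul_le.2 fun a ha m hm => Submodule.apply_mem_map₂ _ ha hm)
      (Submodule.map₂_le.2 fun a ha m hm => Submodule.smul_mem_smul ha hm)
  rw [this]
  exact hV.map₂ _ hW

lemma moduleGKdim_le_zero_of_finite [Module.Finite k M] : moduleGKdim k A M ≤ 0 := by
  refine iSup_le fun V => iSup_le fun _ => iSup_le fun W => iSup_le fun _ => ?_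
  -- The summand `1` keeps the bound positive when `M = 0`.
  refine limsup_log_div_le (D := fun _ => Module.finrank k M + 1) (by simp) (fun m => ?_)
    (tendsto_log_const_div _)
  exact (Submodule.finrank_le _).trans (Nat.le_succ _)

/-- A growth gap: for generating subspaces `V ∋ 1` and `W`, the chain `V ^ m • W` either stabilizes
at `M`, which is then finite dimensional, or grows strictly. In the second case its dimension is at
least `m` and the GK-dimension at least `1`. -/
lemma finite_of_moduleGKdim_le_zero [hA : Algebra.FiniteType k A] [hM : Module.Finite A M]
    (h : moduleGKdim k A M ≤ 0) : Module.Finite k M := by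
  classical
  by_contra hfin
  obtain ⟨s, hs⟩ := hA.out
  obtain ⟨t, ht⟩ := hM.fg_top
  let V : Submodule k A := Submodule.span k (insert 1 (s : Set A))
  let W : Submodule k M := Submodule.span k (t : Set M)
  have hV : V.FG := ⟨insert 1 s, by simp [V]⟩
  have hW : W.FG := ⟨t, rfl⟩
  have h1 : (1 : A) ∈ V := Submodule.subset_span (by simp)
  have hmono : Monotone fun m : ℕ => V ^ m • W := by
    refine monotone_nat_of_le_succ fun m => Submodule.smul_mono_left ?_
    rw [pow_succ]
    intro x hx
    simpa using Submodule.mul_mem_mul hx h1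
  have hsucc (m : ℕ) : V ^ (m + 1) • W = V • V ^ m • W := by
    rw [pow_succ', ← smul_eq_mul, Submodule.smul_assoc]
  have hfg (m : ℕ) : (V ^ m • W).FG := Submodule.FG.smul_submodule (hV.pow m) hW
  have hunion : ∀ x : M, ∃ m : ℕ, x ∈ V ^ m • W := by
    have key : ∀ a : A, ∀ m : ℕ, ∀ y ∈ V ^ m • W, ∃ m' : ℕ, a • y ∈ V ^ m' • W := by
      intro a
      have ha : a ∈ Algebra.adjoin k (s : Set A) := hs ▸ Algebra.mem_top
      induction ha using Algebra.adjoin_induction with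
      | mem x hx =>
        intro m y hy
        refine ⟨m + 1, ?_⟩
        rw [hsucc]
        exact Submodule.smul_mem_smul (Submodule.subset_span (by simp [hx])) hy
      | algebraMap r =>
        intro m y hy
        exact ⟨m, by simpa using Submodule.smul_mem _ r hy⟩
      | add a b _ _ ha hb =>
        intro m y hy
        obtain ⟨m₁, h₁⟩ := ha m y hy
        obtain ⟨m₂, h₂⟩ := hb m y hy
        refine ⟨max m₁ m₂, ?_⟩
        rw [add_smul]
        exact add_mem (hmono (le_max_left _ _) h₁) (hmono (le_max_right _ _) h₂)
      | mul a b _ _ ha hb =>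
        intro m y hy
        obtain ⟨m₁, h₁⟩ := hb m y hy
        rw [mul_smul]
        exact ha m₁ _ h₁
    intro x
    have hx : x ∈ Submodule.span A (t : Set M) := ht ▸ Submodule.mem_top
    induction hx using Submodule.span_induction with
    | mem x hx =>
      refine ⟨0, ?_⟩
      rw [pow_zero]
      have := Submodule.smul_mem_smul (I := (1 : Submodule k A)) (N := W) (r := 1) (n := x)
        (Submodule.one_le.1 le_rfl) (Submodule.subset_span hx)
      simpa using this
    | zero => exact ⟨0, zero_mem _⟩
    | add x y _ _ hx hy =>
      obtain ⟨m₁, h₁⟩ := hx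
      obtain ⟨m₂, h₂⟩ := hy
      exact ⟨max m₁ m₂, add_mem (hmono (le_max_left _ _) h₁) (hmono (le_max_right _ _) h₂)⟩
    | smul a x _ hx =>
      obtain ⟨m, hm⟩ := hx
      exact key a m x hm
  have hstrict : ∀ m : ℕ, V ^ m • W < V ^ (m + 1) • W := by
    intro m
    refine lt_of_le_of_ne (hmono (Nat.le_succ m)) fun heq => hfin ?_
    have hstab : ∀ j : ℕ, V ^ (m + j) • W = V ^ m • W := by
      intro j
      induction j with
      | zero => rfl
      | succ j ih => rw [← add_assoc, hsucc, ih, ← hsucc, ← heq]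
    refine ⟨?_⟩
    have : (⊤ : Submodule k M) = V ^ m • W := by
      refine (eq_top_iff.2 fun x _ => ?_).symm
      obtain ⟨j, hj⟩ := hunion x
      rw [← hstab j]
      exact hmono (Nat.le_add_left j m) hj
    rw [this]
    exact hfg m
  have hrank : ∀ m : ℕ, m ≤ Module.finrank k ↥(V ^ m • W) := by
    intro m
    induction m with
    | zero => exact Nat.zero_le _
    | succ m ih =>
      have : FiniteDimensional k ↥(V ^ (m + 1) • W) :=
        Module.Finite.iff_fg.2 (hfg (m + 1))
      exact Nat.succ_le_of_lt (ih.trans_lt (Submodule.finrank_lt_finrank_of_lt (hstrict m)))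
  have h2 : ((1 : ℝ) : EReal) ≤ moduleGKdim k A M := by
    refine le_trans ?_ (le_iSup_of_le V (le_iSup_of_le hV (le_iSup_of_le W (le_iSup_of_le hW le_rfl))))
    refine le_limsup_log_div (D := fun m => m) (fun m hm => hm) hrank ?_
    refine tendsto_const_nhds.congr' ?_
    filter_upwards [Filter.eventually_ge_atTop 2] with m hm
    have : Real.log (m : ℝ) ≠ 0 := by
      refine (Real.log_pos ?_).ne'
      exact_mod_cast hm
    field_simp
  have h3 : ((1 : ℝ) : EReal) ≤ ((0 : ℝ) : EReal) := h2.trans h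
  exact absurd (EReal.coe_le_coe_iff.1 h3) (by norm_num)

lemma moduleGKdim_le_zero_iff [Algebra.FiniteType k A] [Module.Finite A M] :
    moduleGKdim k A M ≤ 0 ↔ Module.Finite k M :=
  ⟨finite_of_moduleGKdim_le_zero, fun _ => moduleGKdim_le_zero_of_finite⟩

end ModuleGK

end Pertinency
namespace Pertinency

namespace GrMod

open Limits

noncomputable section

variable {k : Type u} [Field k] {B : Type u} [Ring B] [Algebra k B] {ℬ : ℕ → Submodule k B}

/-! ### Finite dimensional graded modules -/

variable (ℬ) in
/-- The graded modules of finite dimension over `k`. -/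
def finiteDim : ObjectProperty (GrMod k ℬ) := fun M => Module.Finite k M.carrier

lemma finite_of_injective {M N : GrMod k ℬ} (f : M ⟶ N) (hf : Function.Injective (lin f))
    [Module.Finite k N.carrier] : Module.Finite k M.carrier :=
  Module.Finite.of_injective ((lin f).restrictScalars k) hf

lemma finite_of_surjective {M N : GrMod k ℬ} (f : M ⟶ N) (hf : Function.Surjective (lin f))
    [Module.Finite k M.carrier] : Module.Finite k N.carrier :=
  Module.Finite.of_surjective ((lin f).restrictScalars k) hf

section Serre

variable [IsNoetherianRing Bᵐᵒᵖ]

instance : (finiteDim ℬ).IsSerreClass where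
  exists_zero := by
    refine ⟨pi (fun j : Empty => nomatch j), ?_, ?_⟩
    · rw [IsZero.iff_id_eq_zero]
      exact hom_ext fun m => funext fun j => nomatch j
    · have : Subsingleton (pi (k := k) (ℬ := ℬ) (fun j : Empty => nomatch j)).carrier :=
        ⟨fun _ _ => funext fun j => nomatch j⟩
      change Module.Finite k (pi (k := k) (ℬ := ℬ) (fun j : Empty => nomatch j)).carrier
      infer_instance
  prop_of_mono f _ h :=
    have : Module.Finite k _ := h
    finite_of_injective f ((mono_iff_injective f).1 inferInstance)
  prop_of_epi f _ h :=
    have : Module.Finite k _ := h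
    finite_of_surjective f ((epi_iff_surjective f).1 inferInstance)
  prop_X₂_of_shortExact {S} hS h₁ h₃ := by
    have h₁ : Module.Finite k S.X₁.carrier := h₁
    have h₃ : Module.Finite k S.X₃.carrier := h₃
    obtain ⟨l, hl⟩ := KernelFork.IsLimit.lift' hS.fIsKernel (kerι S.g) (kerι_comp S.g)
    refine ⟨Submodule.fg_of_fg_map_of_fg_inf_ker ((lin S.g).restrictScalars k) ?_ ?_⟩
    · exact Module.Finite.iff_fg.1 inferInstance
    · have : ⊤ ⊓ LinearMap.ker ((lin S.g).restrictScalars k) =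
          LinearMap.range ((lin S.f).restrictScalars k) := by
        rw [top_inf_eq]
        refine le_antisymm (fun m hm => ?_) ?_
        · exact ⟨lin l (⟨m, hm⟩ : LinearMap.ker (lin S.g)),
            congrArg (fun h => lin h (⟨m, hm⟩ : LinearMap.ker (lin S.g))) hl⟩
        · rintro _ ⟨m, rfl⟩
          exact congrArg (fun h => lin h m) S.zero
      rw [this]
      exact Module.Finite.iff_fg.1 inferInstance

lemma finiteDim_kernel_iff {M N : GrMod k ℬ} (f : M ⟶ N) :
    finiteDim ℬ (kernel f) ↔ Module.Finite k (LinearMap.ker (lin f)) :=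
  (finiteDim ℬ).prop_iff_of_iso ((kernelIsKernel f).conePointUniqueUpToIso (isLimitKer f))

lemma finiteDim_cokernel_iff {M N : GrMod k ℬ} (f : M ⟶ N) :
    finiteDim ℬ (cokernel f) ↔ Module.Finite k (N.carrier ⧸ LinearMap.range (lin f)) :=
  (finiteDim ℬ).prop_iff_of_iso ((cokernelIsCokernel f).coconePointUniqueUpToIso (isColimitCoker f))

lemma isoModSerre_finiteDim_iff {M N : GrMod k ℬ} (f : M ⟶ N) :
    (finiteDim ℬ).isoModSerre f ↔ Module.Finite k (LinearMap.ker (lin f)) ∧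
      Module.Finite k (N.carrier ⧸ LinearMap.range (lin f)) := by
  rw [ObjectProperty.isoModSerre_iff, ObjectProperty.monoModSerre_iff,
    ObjectProperty.epiModSerre_iff, finiteDim_kernel_iff, finiteDim_cokernel_iff]

lemma isoModGKdimLE_zero_iff [Algebra.FiniteType k Bᵐᵒᵖ] {M N : GrMod k ℬ} (f : M ⟶ N) :
    isoModGKdimLE ℬ 0 f ↔ Module.Finite k (LinearMap.ker (lin f)) ∧
      Module.Finite k (N.carrier ⧸ LinearMap.range (lin f)) := by
  have h0 : (((0 : ℤ) : ℝ) : EReal) = 0 := by simp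
  rw [isoModGKdimLE, h0]
  exact and_congr moduleGKdim_le_zero_iff moduleGKdim_le_zero_iff

variable (ℬ) in
-- This turns `qgr` into a Serre quotient by the finite dimensional modules, with no further
-- reference to growth.
lemma isoModGKdimLE_zero_eq [Algebra.FiniteType k Bᵐᵒᵖ] :
    isoModGKdimLE ℬ 0 = (finiteDim ℬ).isoModSerre := by
  ext M N f
  rw [isoModGKdimLE_zero_iff, isoModSerre_finiteDim_iff]

end Serre

/-! ### Truncations -/

lemma exists_comp_eq_zero_of_lt (M : GrMod k ℬ) (t : Finset M.carrier) :
    ∃ d : ℤ, ∀ x ∈ t, ∀ i < d, M.comp i x = 0 := by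
  classical
  have h (x : M.carrier) : ∃ d : ℤ, ∀ i < d, M.comp i x = 0 := by
    obtain ⟨s, hs⟩ := exists_sum_comp x
    obtain ⟨d, hd⟩ := s.bddBelow
    refine ⟨d, fun i hi => ?_⟩
    rw [← hs s subset_rfl, map_sum]
    refine Finset.sum_eq_zero fun j hj => comp_ne (comp_mem j x) ?_
    have := hd (Finset.mem_coe.2 hj)
    omega
  choose d hd using h
  obtain ⟨e, he⟩ := (t.image d).bddBelow
  exact ⟨e, fun x hx i hi => hd x i (lt_of_lt_of_le hi
    (he (Finset.mem_coe.2 (Finset.mem_image_of_mem d hx))))⟩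

lemma exists_comp_eq_zero_of_ge (M : GrMod k ℬ) [hM : Module.Finite k M.carrier] :
    ∃ d : ℤ, ∀ i ≥ d, ∀ x, M.comp i x = 0 := by
  classical
  have h (x : M.carrier) : ∃ d : ℤ, ∀ i ≥ d, M.comp i x = 0 := by
    obtain ⟨s, hs⟩ := exists_sum_comp x
    obtain ⟨d, hd⟩ := s.exists_le
    refine ⟨d + 1, fun i hi => ?_⟩
    rw [← hs s subset_rfl, map_sum]
    refine Finset.sum_eq_zero fun j hj => comp_ne (comp_mem j x) ?_
    have := hd j hj
    omega
  choose d hd using h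
  obtain ⟨t, ht⟩ := hM.fg_top
  obtain ⟨e, he⟩ := (t.image d).exists_le
  refine ⟨e, fun i hi x => ?_⟩
  have hx : x ∈ Submodule.span k (t : Set M.carrier) := ht ▸ Submodule.mem_top
  suffices h : Submodule.span k (t : Set M.carrier) ≤ LinearMap.ker (M.comp i) from h hx
  refine Submodule.span_le.2 fun y hy => hd y i (le_trans ?_ hi)
  exact he _ (Finset.mem_image_of_mem d hy)

section Trunc

variable (hℬ : ⨆ i, ℬ i = ⊤) (M : GrMod k ℬ) (m : ℤ)

lemma comp_comp (i j : ℤ) (x : M.carrier) :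
    M.comp i (M.comp j x) = if i = j then M.comp j x else 0 :=
  comp_of_mem i (comp_mem j x)

/-- The submodule of the elements without components of degree less than `m`. -/
def geSubmodule : Submodule Bᵐᵒᵖ M.carrier where
  carrier := {x | ∀ i < m, M.comp i x = 0}
  add_mem' hx hy i hi := by rw [map_add, hx i hi, hy i hi, add_zero]
  zero_mem' i hi := map_zero _
  smul_mem' := by
    intro b x hx i hi
    obtain ⟨b, rfl⟩ := MulOpposite.op_surjective b
    have hb : b ∈ ⨆ i, ℬ i := hℬ ▸ Submodule.mem_top
    induction hb using Submodule.iSup_induction' with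
    | mem j b hb => rw [comp_smul i j hb, hx _ (by omega), smul_zero]
    | zero => simp
    | add b b' _ _ h h' => rw [MulOpposite.op_add, add_smul, map_add, h, h', add_zero]

lemma isHomogeneous_geSubmodule : IsHomogeneous (M := M) (geSubmodule hℬ M m) := by
  intro j x hx i hi
  rw [comp_comp]
  split_ifs with h
  · exact hx j (h ▸ hi)
  · rfl

/-- If the generators have no components below degree `d`, elements of `B` of degree at least `m -
d` move them into the truncation. So the finitely many lower components of `B`, applied to the
generators, span the quotient. -/
lemma finite_quotient_geSubmodule [∀ i, Module.Finite k (ℬ i)] :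
    Module.Finite k (M.carrier ⧸ geSubmodule hℬ M m) := by
  classical
  obtain ⟨t, ht⟩ := M.finite.fg_top
  obtain ⟨d, hd⟩ := exists_comp_eq_zero_of_lt M t
  obtain ⟨L, hL⟩ : ∃ L : ℕ, m ≤ d + L := ⟨(m - d).toNat, by omega⟩
  let V : Submodule k B := ⨆ l ∈ Finset.range L, ℬ l
  have hV : (V.map (MulOpposite.opLinearEquiv k).toLinearMap).FG :=
    Submodule.FG.map _ (Submodule.fg_biSup _ _ fun l _ => Module.Finite.iff_fg.1 inferInstance)
  let U : Submodule k M.carrier :=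
    V.map (MulOpposite.opLinearEquiv k).toLinearMap • Submodule.span k (t : Set M.carrier)
  have hU : U.FG := Submodule.FG.smul_submodule hV ⟨t, rfl⟩
  have key : ∀ y : M.carrier, y ∈ (geSubmodule hℬ M m).restrictScalars k ⊔ U := by
    intro y
    have hy : y ∈ Submodule.span Bᵐᵒᵖ (t : Set M.carrier) := ht ▸ Submodule.mem_top
    obtain ⟨c, -, rfl⟩ := Submodule.mem_span_finset.1 hy
    refine Submodule.sum_mem _ fun x hx => ?_
    obtain ⟨b, hb⟩ := MulOpposite.op_surjective (c x)
    rw [← hb]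
    clear hb
    have hb : b ∈ ⨆ i, ℬ i := hℬ ▸ Submodule.mem_top
    induction hb using Submodule.iSup_induction' with
    | mem l b hb =>
      by_cases hl : l < L
      · refine Submodule.mem_sup_right (Submodule.smul_mem_smul ⟨b, ?_, rfl⟩
          (Submodule.subset_span hx))
        exact Submodule.mem_iSup_of_mem l (Submodule.mem_iSup_of_mem (by simpa using hl) hb)
      · refine Submodule.mem_sup_left fun i hi => ?_
        rw [comp_smul i l hb, hd x hx _ (by omega), smul_zero]
    | zero => simp
    | add b b' _ _ h h' =>
      rw [MulOpposite.op_add, add_smul]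
      exact add_mem h h'
  refine ⟨?_⟩
  have : (⊤ : Submodule k (M.carrier ⧸ geSubmodule hℬ M m)) =
      U.map ((geSubmodule hℬ M m).mkQ.restrictScalars k) := by
    refine (eq_top_iff.2 fun y _ => ?_).symm
    obtain ⟨y, rfl⟩ := Submodule.mkQ_surjective _ y
    obtain ⟨a, ha, b, hb, rfl⟩ := Submodule.mem_sup.1 (key y)
    refine ⟨b, hb, ?_⟩
    rw [map_add]
    have : (geSubmodule hℬ M m).mkQ a = 0 := (Submodule.Quotient.mk_eq_zero _).2 ha
    rw [this, zero_add]
    rfl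
  rw [this]
  exact hU.map _

variable [IsNoetherianRing Bᵐᵒᵖ]

/-- The truncation `M_{≥ m}` of a graded module. -/
abbrev trunc : GrMod k ℬ := M.sub _ (isHomogeneous_geSubmodule hℬ M m)

/-- The inclusion of the truncation. -/
abbrev truncι : trunc hℬ M m ⟶ M := subι _ (isHomogeneous_geSubmodule hℬ M m)

lemma isoModSerre_truncι [∀ i, Module.Finite k (ℬ i)] :
    (finiteDim ℬ).isoModSerre (truncι hℬ M m) := by
  rw [isoModSerre_finiteDim_iff]
  constructor
  · have : LinearMap.ker (lin (truncι hℬ M m)) = ⊥ :=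
      LinearMap.ker_eq_bot.2 Subtype.val_injective
    rw [this]
    infer_instance
  · have : LinearMap.range (lin (truncι hℬ M m)) = geSubmodule hℬ M m := Submodule.range_subtype _
    rw [this]
    exact finite_quotient_geSubmodule hℬ M m

variable {M} in
/-- The map induced on truncations. -/
def truncMap {N : GrMod k ℬ} (f : M ⟶ N) : trunc hℬ M m ⟶ trunc hℬ N m :=
  subLift _ _ (truncι hℬ M m ≫ f) fun x i hi => by
    have h : M.comp i (lin (truncι hℬ M m) x) = 0 := x.2 i hi
    rw [lin_comp, LinearMap.comp_apply, ← lin_comp_apply, h, map_zero]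

variable {M} in
-- The finite dimensional kernel and cokernel vanish in large degrees.
lemma exists_isIso_truncMap {N : GrMod k ℬ} (f : M ⟶ N) (hf : (finiteDim ℬ).isoModSerre f) :
    ∃ m, IsIso (truncMap hℬ m f) := by
  rw [isoModSerre_finiteDim_iff] at hf
  have h₁ : Module.Finite k (ker f).carrier := hf.1
  have h₂ : Module.Finite k (coker f).carrier := hf.2
  obtain ⟨d₁, hd₁⟩ := exists_comp_eq_zero_of_ge (ker f)
  obtain ⟨d₂, hd₂⟩ := exists_comp_eq_zero_of_ge (coker f)
  refine ⟨max d₁ d₂, isIso_of_bijective _ ⟨?_, ?_⟩⟩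
  · rw [injective_iff_map_eq_zero]
    intro x hx
    refine Subtype.ext (ext_comp fun i => ?_)
    by_cases hi : i < max d₁ d₂
    · rw [x.2 i hi]
      exact (map_zero _).symm
    · have hx' : lin f x.1 = 0 := congrArg Subtype.val hx
      have := hd₁ i (by omega) (⟨x.1, hx'⟩ : LinearMap.ker (lin f))
      have h2 := lin_comp_apply (kerι f) i (⟨x.1, hx'⟩ : LinearMap.ker (lin f))
      rw [this, map_zero] at h2
      exact h2.symm.trans (map_zero _).symm
  · intro z
    have key : ∀ i, N.comp i z.1 ∈ (geSubmodule hℬ M (max d₁ d₂)).map (lin f) := by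
      intro i
      by_cases hi : i < max d₁ d₂
      · rw [z.2 i hi]
        exact zero_mem _
      · have h1 := lin_comp_apply (cokerπ f) i z.1
        rw [hd₂ i (by omega)] at h1
        obtain ⟨w, hw⟩ := (Submodule.Quotient.mk_eq_zero _).1 h1
        refine ⟨M.comp i w, fun j hj => ?_, ?_⟩
        · rw [comp_comp, if_neg (by omega)]
        · rw [lin_comp_apply, hw, comp_comp, if_pos rfl]
    obtain ⟨s, hs⟩ := exists_sum_comp z.1
    have hz := Submodule.sum_mem _ fun i (_ : i ∈ s) => key i
    rw [hs s subset_rfl] at hz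
    obtain ⟨w, hw, hwz⟩ := hz
    exact ⟨⟨w, hw⟩, Subtype.ext hwz⟩

include hℬ in
-- This is the lifting hypothesis `hT` of `exists_mapExactFunctor_eq`. If `s` is bijective in
-- degrees `≥ m`, truncate `E` there: the kernel on the truncation lies in the truncated `kernel g`,
-- which is isomorphic to that of `K`.
lemma exists_isoModSerre_factor [∀ i, Module.Finite k (ℬ i)] {E X K : GrMod k ℬ} (g : E ⟶ X)
    (s : K ⟶ kernel g) (hs : (finiteDim ℬ).isoModSerre s) :
    ∃ (E' : GrMod k ℬ) (t : E' ⟶ E) (_ : (finiteDim ℬ).isoModSerre t) (l : kernel (t ≫ g) ⟶ K),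
      l ≫ s ≫ kernel.ι g = kernel.ι (t ≫ g) ≫ t := by
  obtain ⟨m, hm⟩ := exists_isIso_truncMap hℬ s hs
  let t := truncι hℬ E m
  let a : kernel (t ≫ g) ⟶ kernel g := kernel.lift g (kernel.ι (t ≫ g) ≫ t) (by
    rw [Category.assoc, kernel.condition])
  have ha : a ≫ kernel.ι g = kernel.ι (t ≫ g) ≫ t := kernel.lift_ι _ _ _
  let b : kernel (t ≫ g) ⟶ trunc hℬ (kernel g) m := subLift _ _ a fun x i hi => by
    apply (mono_iff_injective (kernel.ι g)).1 inferInstance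
    rw [lin_comp_apply, map_zero]
    have : lin (kernel.ι g) (lin a x) = lin t (lin (kernel.ι (t ≫ g)) x) :=
      congrArg (fun h => lin h x) ha
    rw [this]
    exact (lin (kernel.ι (t ≫ g)) x).2 i hi
  have hb : b ≫ truncι hℬ (kernel g) m = a := rfl
  have hts : truncι hℬ K m ≫ s = truncMap hℬ m s ≫ truncι hℬ (kernel g) m := rfl
  refine ⟨_, t, isoModSerre_truncι hℬ E m, b ≫ inv (truncMap hℬ m s) ≫ truncι hℬ K m, ?_⟩
  rw [Category.assoc, Category.assoc, reassoc_of% hts, IsIso.inv_hom_id_assoc, ← Category.assoc,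
    hb, ha]

end Trunc

end

end GrMod

end Pertinency
-- Idempotents: the passage from `M` to `M e`.
namespace Pertinency

section Fix

variable (k : Type u) [Field k] {A : Type v} [Ring A] [Algebra k A]

/-- The elements of a right `A`-module `M` that are fixed by `e`; this is `M e` if `e` is
idempotent. -/
def fixedBy (e : A) (M : Type w) [AddCommGroup M] [Module k M] [Module Aᵐᵒᵖ M]
    [IsScalarTower k Aᵐᵒᵖ M] : Submodule k M :=
  LinearMap.ker (Module.toModuleEnd k (S := Aᵐᵒᵖ) M (MulOpposite.op e) - LinearMap.id)

variable {k} {e : A} {M : Type w} [AddCommGroup M] [Module k M] [Module Aᵐᵒᵖ M]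
    [IsScalarTower k Aᵐᵒᵖ M]

lemma mem_fixedBy {m : M} : m ∈ fixedBy k e M ↔ MulOpposite.op e • m = m := by
  simp [fixedBy, sub_eq_zero]

lemma smul_mem_fixedBy (he : e * e = e) (m : M) : MulOpposite.op e • m ∈ fixedBy k e M := by
  rw [mem_fixedBy, smul_smul, ← MulOpposite.op_mul, he]

/-- If `A / A e A` is finite dimensional and `A` is finite over a central subring, then a finitely
generated right `A`-module `M` is finite dimensional if `M e` is. -/
lemma finite_of_finite_fixedBy (C : Type*) [CommRing C] [Algebra C A] [Module.Finite C A]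
    (he : e * e = e) {U : Submodule k A} (hU : U.FG)
    (hUe : ∀ a, ∃ u ∈ U, a - u ∈ TwoSidedIdeal.span {e}) [hM : Module.Finite Aᵐᵒᵖ M]
    [hf : Module.Finite k (fixedBy k e M)] : Module.Finite k M := by
  obtain ⟨s, hs⟩ := hM.fg_top
  obtain ⟨t, ht⟩ := Module.Finite.fg_top (R := C) (M := A)
  let V : Submodule k Aᵐᵒᵖ :=
    (Submodule.span k (t : Set A)).map (MulOpposite.opLinearEquiv k).toLinearMap
  have hV : V.FG := Submodule.FG.map _ ⟨t, rfl⟩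
  let U' : Submodule k Aᵐᵒᵖ := U.map (MulOpposite.opLinearEquiv k).toLinearMap
  have hU' : U'.FG := hU.map _
  let T : Submodule k M := V • fixedBy k e M
  have hT : T.FG := Submodule.FG.smul_submodule hV (Module.Finite.iff_fg.1 hf)
  let S : Submodule k M := U' • Submodule.span k (s : Set M)
  have hS : S.FG := Submodule.FG.smul_submodule hU' ⟨s, rfl⟩
  -- `Me` is stable under the central ring `C`, so `Me · A` is already spanned by `Me` times the
  -- `C`-generators of `A`.
  have h1 (a : A) (m : M) (hm : m ∈ fixedBy k e M) : MulOpposite.op a • m ∈ T := by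
    have ha : a ∈ Submodule.span C (t : Set A) := ht ▸ Submodule.mem_top
    induction ha using Submodule.span_induction generalizing m with
    | mem a ha => exact Submodule.smul_mem_smul ⟨a, Submodule.subset_span ha, rfl⟩ hm
    | zero => simp
    | add a b _ _ h h' =>
      rw [MulOpposite.op_add, add_smul]
      exact add_mem (h m hm) (h' m hm)
    | smul c a _ h =>
      rw [Algebra.smul_def, MulOpposite.op_mul, mul_smul]
      refine h _ ?_
      rw [mem_fixedBy] at hm ⊢
      rw [smul_smul, ← MulOpposite.op_mul, Algebra.commutes, MulOpposite.op_mul, mul_smul, hm]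
  -- `m (x e y) = (m x e) y` lies in `Me · A`. The extra factor `b` lets the induction absorb right
  -- multiplications.
  have h2 (a : A) (ha : a ∈ TwoSidedIdeal.span {e}) :
      ∀ (b : A) (m : M), MulOpposite.op (a * b) • m ∈ T := by
    induction ha using TwoSidedIdeal.span_induction with
    | mem x hx =>
      obtain rfl : x = e := hx
      intro b m
      rw [MulOpposite.op_mul, mul_smul]
      exact h1 b _ (smul_mem_fixedBy he m)
    | zero => simp
    | add a b _ _ h h' =>
      intro c m
      rw [add_mul, MulOpposite.op_add, add_smul]
      exact add_mem (h c m) (h' c m)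
    | neg a _ h =>
      intro c m
      rw [neg_mul, MulOpposite.op_neg, neg_smul]
      exact neg_mem (h c m)
    | left_absorb b a _ h =>
      intro c m
      rw [mul_assoc, MulOpposite.op_mul, mul_smul]
      exact h _ _
    | right_absorb b a ha h =>
      intro c m
      rw [mul_assoc]
      exact h _ _
  refine ⟨?_⟩
  -- Modulo `AeA` the coefficients of the generators can be taken in `U`.
  have : (⊤ : Submodule k M) = T ⊔ S := by
    refine (eq_top_iff.2 fun y _ => ?_).symm
    have hy : y ∈ Submodule.span Aᵐᵒᵖ (s : Set M) := hs ▸ Submodule.mem_top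
    obtain ⟨c, -, rfl⟩ := Submodule.mem_span_finset.1 hy
    refine Submodule.sum_mem _ fun x hx => ?_
    obtain ⟨a, ha⟩ := MulOpposite.op_surjective (c x)
    obtain ⟨u, hu, hau⟩ := hUe a
    rw [← ha, ← sub_add_cancel a u, MulOpposite.op_add, add_smul]
    refine add_mem (Submodule.mem_sup_left (by simpa using h2 _ hau 1 x)) (Submodule.mem_sup_right ?_)
    exact Submodule.smul_mem_smul ⟨u, hu, rfl⟩ (Submodule.subset_span hx)
  rw [this]
  exact hT.sup hS

end Fix


/-! ### The corner functor -/

section Corner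

variable {k : Type u} [Field k] {A B : Type u} [Ring A] [Algebra k A] [Ring B] [Algebra k B]

/-- An idempotent `e` of degree `0` of the graded algebra `A` that commutes with the image of an
algebra homomorphism `ι : B → A` of graded algebras, such that `e A e = ι(B) e`; the map `tr`
describes this equality. -/
structure Corner (𝒜 : ℕ → Submodule k A) (ℬ : ℕ → Submodule k B) where
  ι : B →ₐ[k] A
  e : A
  tr : A →ₗ[k] B
  e_mul_e : e * e = e
  commute : ∀ b, e * ι b = ι b * e
  e_mul_mul_e : ∀ a, e * a * e = ι (tr a) * e
  tr_mul : ∀ a b, tr (a * ι b) = tr a * b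
  tr_e_mul : ∀ a, tr (e * a) = tr a
  tr_mul_e : ∀ a, tr (a * e) = tr a
  tr_one : tr 1 = 1
  ι_mem : ∀ i b, b ∈ ℬ i → ι b ∈ 𝒜 i
  tr_mem : ∀ i a, a ∈ 𝒜 i → tr a ∈ ℬ i
  e_mem : e ∈ 𝒜 0

namespace Corner

open GrMod MulOpposite

noncomputable section

variable {𝒜 : ℕ → Submodule k A} {ℬ : ℕ → Submodule k B} (D : Corner 𝒜 ℬ)

/-- The `B`-module structure of `M e`. -/
abbrev moduleFixedBy (M : Type w) [AddCommGroup M] [Module k M] [Module Aᵐᵒᵖ M]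
    [IsScalarTower k Aᵐᵒᵖ M] : Module Bᵐᵒᵖ (fixedBy k D.e M) where
  smul b m := ⟨op (D.ι b.unop) • m.1, by
    have := m.2
    rw [mem_fixedBy] at this ⊢
    rw [smul_smul, ← op_mul, ← D.commute, op_mul, mul_smul, this]⟩
  one_smul m := Subtype.ext (by
    change op (D.ι 1) • m.1 = m.1
    rw [map_one, op_one, one_smul])
  mul_smul b c m := Subtype.ext (by
    change op (D.ι (c.unop * b.unop)) • m.1 = op (D.ι b.unop) • op (D.ι c.unop) • m.1
    rw [map_mul, op_mul, mul_smul])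
  smul_zero b := Subtype.ext (smul_zero _)
  smul_add b m m' := Subtype.ext (smul_add _ _ _)
  add_smul b c m := Subtype.ext (by
    change op (D.ι (b.unop + c.unop)) • m.1 = op (D.ι b.unop) • m.1 + op (D.ι c.unop) • m.1
    rw [map_add, MulOpposite.op_add, add_smul])
  zero_smul m := Subtype.ext (by
    change op (D.ι 0) • m.1 = 0
    rw [map_zero, op_zero, zero_smul])

lemma isScalarTower_fixedBy (M : Type w) [AddCommGroup M] [Module k M] [Module Aᵐᵒᵖ M]
    [IsScalarTower k Aᵐᵒᵖ M] :
    letI := D.moduleFixedBy M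
    IsScalarTower k Bᵐᵒᵖ (fixedBy k D.e M) :=
  letI := D.moduleFixedBy M
  ⟨fun c b m => Subtype.ext (by
    change op (D.ι (c • b.unop)) • m.1 = c • op (D.ι b.unop) • m.1
    rw [map_smul, op_smul, smul_assoc])⟩

end

end Corner

end Corner

section Central

/-- A subgroup of a finitely generated module that is stable under a noetherian central subring,
over which the algebra is finite, is finitely generated over any algebra over this subring. -/
lemma finite_of_injective_of_central {C D E : Type*} [CommRing C] [IsNoetherianRing C] [Ring D]
    [Algebra C D] [Module.Finite C D] [Ring E] [Algebra C E] {M N J : Type*} [AddCommGroup M]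
    [AddCommGroup N] [Module D M] [Module E N] [Module.Finite D M] [Finite J]
    (f : N →+ (J → M)) (hf : Function.Injective f)
    (h : ∀ (c : C) n, f (algebraMap C E c • n) = algebraMap C D c • f n) : Module.Finite E N := by
  let _ : Module C M := Module.compHom M (algebraMap C D)
  let _ : Module C N := Module.compHom N (algebraMap C E)
  have : IsScalarTower C D M := .of_algebraMap_smul fun _ _ => rfl
  have : IsScalarTower C E N := .of_algebraMap_smul fun _ _ => rfl
  have : Module.Finite C M := Module.Finite.trans D M
  let f' : N →ₗ[C] (J → M) := { f with map_smul' := h }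
  have : Module.Finite C N := Module.Finite.of_injective f' hf
  exact Module.Finite.of_restrictScalars_finite C E N

end Central

end Pertinency
-- The corner functor and coinduction.
namespace Pertinency

namespace Corner

open GrMod MulOpposite

noncomputable section

variable {k : Type u} [Field k] {A B : Type u} [Ring A] [Algebra k A] [Ring B] [Algebra k B]
  {𝒜 : ℕ → Submodule k A} {ℬ : ℕ → Submodule k B} (D : Corner 𝒜 ℬ)

lemma finite_op (C : Type*) [CommRing C] [Algebra C A] [Module.Finite C A] :
    Module.Finite C Aᵐᵒᵖ :=
  Module.Finite.equiv (opLinearEquiv C)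

lemma comp_mem_fixedBy {M : GrMod k 𝒜} (i : ℤ) {m : M.carrier}
    (hm : m ∈ fixedBy k D.e M.carrier) : M.comp i m ∈ fixedBy k D.e M.carrier := by
  rw [mem_fixedBy] at hm ⊢
  have := comp_smul i 0 D.e_mem m
  rw [hm] at this
  simpa using this.symm

variable (C : Type u) [CommRing C] [IsNoetherianRing C] [Algebra C A] [Algebra C B]
  [Module.Finite C A] (hC : ∀ c, D.ι (algebraMap C B c) = algebraMap C A c)

include hC in
-- `Me` is a submodule of `M` over the noetherian ring `C`, and `hC` makes the two actions of `C` on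
-- it agree.
lemma finite_fixedBy (M : Type u) [AddCommGroup M] [Module k M] [Module Aᵐᵒᵖ M]
    [IsScalarTower k Aᵐᵒᵖ M] [Module.Finite Aᵐᵒᵖ M] :
    letI := D.moduleFixedBy M
    Module.Finite Bᵐᵒᵖ (fixedBy k D.e M) := by
  have := finite_op (A := A) C
  let _ := D.moduleFixedBy M
  let f : fixedBy k D.e M →+ (Unit → M) :=
    { toFun := fun m _ => m.1
      map_zero' := rfl
      map_add' := fun _ _ => rfl }
  refine finite_of_injective_of_central (C := C) (D := Aᵐᵒᵖ) f
    (fun m m' h => Subtype.ext (congrFun h ())) fun c m => funext fun _ => ?_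
  change op (D.ι (algebraMap C B c)) • m.1 = op (algebraMap C A c) • m.1
  rw [hC]

/-- The functor `M ↦ M e` from `gr A` to `gr B`. -/
def functor : GrMod k 𝒜 ⥤ GrMod k ℬ where
  obj M :=
    { carrier := fixedBy k D.e M.carrier
      module := D.moduleFixedBy M.carrier
      isScalarTower := D.isScalarTower_fixedBy M.carrier
      deg := fun i => (M.deg i).comap (fixedBy k D.e M.carrier).subtype
      isInternal := by
        refine isInternal_of_projections _
          (fun i => (M.comp i).restrict (p := fixedBy k D.e M.carrier)
            (q := fixedBy k D.e M.carrier) (fun m hm => D.comp_mem_fixedBy i hm)) ?_ ?_ ?_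
        · intro i v hv
          exact Subtype.ext (comp_same hv)
        · intro i j v hv hij
          exact Subtype.ext (comp_ne hv hij)
        · intro v
          obtain ⟨s, hs⟩ := exists_sum_comp (v : M.carrier)
          have : v = ∑ i ∈ s,
              (⟨M.comp i v, D.comp_mem_fixedBy i v.2⟩ : fixedBy k D.e M.carrier) := by
            refine Subtype.ext ?_
            rw [AddSubmonoidClass.coe_finsetSum]
            exact (hs s subset_rfl).symm
          rw [this]
          exact Submodule.sum_mem _ fun i _ =>
            Submodule.mem_iSup_of_mem i (by simpa using comp_mem i _)
      smul_mem := fun i j b m hb hm => M.smul_mem i j _ _ (D.ι_mem i b hb) hm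
      finite := by
        have := M.finite
        exact D.finite_fixedBy C hC M.carrier }
  map {M N} f :=
    { toLinearMap :=
        letI := D.moduleFixedBy M.carrier
        letI := D.moduleFixedBy N.carrier
        { toFun := fun m => ⟨lin f m.1, by
            have := m.2
            rw [mem_fixedBy] at this ⊢
            rw [← map_smul, this]⟩
          map_add' := fun m m' => Subtype.ext (map_add _ _ _)
          map_smul' := fun b m => Subtype.ext (map_smul (lin f) _ _) }
      map_mem := fun i m hm => lin_mem f hm }
  map_id M := hom_ext fun m => rfl
  map_comp f g := hom_ext fun m => rfl

/-! ### The coinduced module -/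

/-- The `B`-linear maps `A e → N`. -/
def coindAll (N : Type u) [AddCommGroup N] [Module k N] [Module Bᵐᵒᵖ N] [IsScalarTower k Bᵐᵒᵖ N] :
    Submodule k (A →ₗ[k] N) where
  carrier := {f | (∀ a b, f (a * D.ι b) = op b • f a) ∧ ∀ a, f (a * D.e) = f a}
  add_mem' hf hg := ⟨fun a b => by simp [hf.1, hg.1], fun a => by simp [hf.2, hg.2]⟩
  zero_mem' := ⟨fun a b => by simp, fun a => by simp⟩
  smul_mem' c f hf := ⟨fun a b => by
    rw [LinearMap.smul_apply, LinearMap.smul_apply, hf.1, smul_comm], fun a => by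
    rw [LinearMap.smul_apply, LinearMap.smul_apply, hf.2]⟩

/-- The homogeneous `B`-linear maps `A e → N` of degree `j`. -/
def coindDeg (N : GrMod k ℬ) (j : ℤ) : Submodule k (A →ₗ[k] N.carrier) where
  carrier := {f | f ∈ D.coindAll N.carrier ∧ ∀ i a, a ∈ 𝒜 i → f a ∈ N.deg (i + j)}
  add_mem' hf hg := ⟨add_mem hf.1 hg.1, fun i a ha => add_mem (hf.2 i a ha) (hg.2 i a ha)⟩
  zero_mem' := ⟨zero_mem _, fun _ _ _ => zero_mem _⟩
  smul_mem' c _ hf := ⟨Submodule.smul_mem _ c hf.1,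
    fun i a ha => Submodule.smul_mem _ c (hf.2 i a ha)⟩

/-- The sums of homogeneous `B`-linear maps `A e → N`. -/
def coind (N : GrMod k ℬ) : Submodule k (A →ₗ[k] N.carrier) := ⨆ j, D.coindDeg N j

lemma coindDeg_le (N : GrMod k ℬ) (j : ℤ) : D.coindDeg N j ≤ D.coind N :=
  le_iSup (D.coindDeg N) j

lemma coind_le (N : GrMod k ℬ) : D.coind N ≤ D.coindAll N.carrier :=
  iSup_le fun _ _ hf => hf.1

variable {D} in
lemma coind_mul {N : GrMod k ℬ} {f : A →ₗ[k] N.carrier} (hf : f ∈ D.coind N) (a : A) (b : B) :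
    f (a * D.ι b) = op b • f a := (D.coind_le N hf).1 a b

variable {D} in
lemma coind_mul_e {N : GrMod k ℬ} {f : A →ₗ[k] N.carrier} (hf : f ∈ D.coind N) (a : A) :
    f (a * D.e) = f a := (D.coind_le N hf).2 a

variable [SetLike.GradedMonoid 𝒜]

lemma comp_mulLeft_mem_coindDeg {N : GrMod k ℬ} {i : ℕ} {j : ℤ} {a : A} {f : A →ₗ[k] N.carrier}
    (ha : a ∈ 𝒜 i) (hf : f ∈ D.coindDeg N j) :
    f ∘ₗ LinearMap.mulLeft k a ∈ D.coindDeg N (j + i) := by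
  refine ⟨⟨fun x b => ?_, fun x => ?_⟩, fun l x hx => ?_⟩
  · simp only [LinearMap.comp_apply, LinearMap.mulLeft_apply]
    rw [← mul_assoc, hf.1.1]
  · simp only [LinearMap.comp_apply, LinearMap.mulLeft_apply]
    rw [← mul_assoc, hf.1.2]
  · have := hf.2 _ _ (SetLike.mul_mem_graded ha hx)
    have h : ((i + l : ℕ) : ℤ) + j = l + (j + i) := by push_cast; ring
    rwa [h] at this

variable (h𝒜 : ⨆ i, 𝒜 i = ⊤)

include h𝒜 in
lemma comp_mulLeft_mem_coind {N : GrMod k ℬ} (a : A) {f : A →ₗ[k] N.carrier}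
    (hf : f ∈ D.coind N) : f ∘ₗ LinearMap.mulLeft k a ∈ D.coind N := by
  have ha : a ∈ ⨆ i, 𝒜 i := h𝒜 ▸ Submodule.mem_top
  induction ha using Submodule.iSup_induction' with
  | mem i a ha =>
    induction hf using Submodule.iSup_induction' with
    | mem j f hf => exact D.coindDeg_le N _ (D.comp_mulLeft_mem_coindDeg ha hf)
    | zero => simp
    | add f g _ _ h h' =>
      rw [LinearMap.add_comp]
      exact add_mem h h'
  | zero => simp
  | add a b _ _ h h' =>
    have : f ∘ₗ LinearMap.mulLeft k (a + b) =
        f ∘ₗ LinearMap.mulLeft k a + f ∘ₗ LinearMap.mulLeft k b := by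
      ext x
      simp [add_mul]
    rw [this]
    exact add_mem h h'

/-- The `A`-module structure of the coinduced module. -/
abbrev moduleCoind (N : GrMod k ℬ) : Module Aᵐᵒᵖ (D.coind N) where
  smul a f := ⟨f.1 ∘ₗ LinearMap.mulLeft k a.unop, D.comp_mulLeft_mem_coind h𝒜 _ f.2⟩
  one_smul f := Subtype.ext (LinearMap.ext fun x => congrArg f.1 (one_mul x))
  mul_smul a b f := Subtype.ext (LinearMap.ext fun x => congrArg f.1 (mul_assoc _ _ x))
  smul_zero a := rfl
  smul_add a f g := rfl
  add_smul a b f := Subtype.ext (LinearMap.ext fun x => by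
    change f.1 ((a.unop + b.unop) * x) = f.1 (a.unop * x) + f.1 (b.unop * x)
    rw [add_mul, map_add])
  zero_smul f := Subtype.ext (LinearMap.ext fun x => by
    change f.1 (0 * x) = 0
    rw [zero_mul, map_zero])

include hC in
-- A map in the coinduced module is `C`-linear, so its values on finitely many `C`-generators of `A`
-- embed the module in a finite power of `N`.
lemma finite_coind (N : GrMod k ℬ) [Module.Finite C B] :
    letI := D.moduleCoind h𝒜 N
    Module.Finite Aᵐᵒᵖ (D.coind N) := by
  have := finite_op (A := A) C
  have := finite_op (A := B) C
  have := N.finite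
  let _ := D.moduleCoind h𝒜 N
  obtain ⟨t, ht⟩ := Module.Finite.fg_top (R := C) (M := A)
  let F : D.coind N →+ (t → N.carrier) :=
    { toFun := fun f x => f.1 x.1
      map_zero' := rfl
      map_add' := fun _ _ => rfl }
  have hmul (f : D.coind N) (c : C) (a : A) :
      f.1 (algebraMap C A c * a) = op (algebraMap C B c) • f.1 a := by
    rw [← coind_mul f.2, hC, Algebra.commutes]
  refine finite_of_injective_of_central (C := C) (D := Bᵐᵒᵖ) F ?_ fun c f => funext fun x => ?_
  · rw [injective_iff_map_eq_zero]
    intro f hf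
    refine Subtype.ext (LinearMap.ext fun a => ?_)
    have ha : a ∈ Submodule.span C (t : Set A) := ht ▸ Submodule.mem_top
    induction ha using Submodule.span_induction with
    | mem a ha => exact congrFun hf ⟨a, ha⟩
    | zero => exact map_zero _
    | add a b _ _ h h' => rw [map_add, h, h', map_add]
    | smul c a _ h =>
      rw [Algebra.smul_def, hmul, h]
      simp
  · exact hmul f c x.1

/-- The coinduced graded module. -/
def coinduced [Module.Finite C B] (N : GrMod k ℬ) : GrMod k 𝒜 where
  carrier := D.coind N
  module := D.moduleCoind h𝒜 N
  isScalarTower :=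
    letI := D.moduleCoind h𝒜 N
    ⟨fun c a f => Subtype.ext (LinearMap.ext fun x => by
      change f.1 ((c • a.unop) * x) = c • f.1 (a.unop * x)
      rw [smul_mul_assoc, map_smul])⟩
  deg j := (D.coindDeg N j).comap (D.coind N).subtype
  isInternal := by
    -- On arguments of degree `i`, the summand of degree `j` is read off from the component of
    -- degree `i + j` of the value. This gives uniqueness of the decomposition.
    have hval (x : DirectSum ℤ fun j => (D.coindDeg N j).comap (D.coind N).subtype) (i : ℕ) (j : ℤ)
        (a : A) (ha : a ∈ 𝒜 i) : N.comp (i + j) ((DirectSum.coeAddMonoidHom _ x : D.coind N).1 a) =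
          (x j).1.1 a := by
      induction x using DirectSum.induction_on with
      | zero => simp
      | of l y =>
        have hy : y.1.1 a ∈ N.deg (i + l) := y.2.2 i a ha
        rw [DirectSum.coeAddMonoidHom_of, comp_of_mem _ hy]
        by_cases h : j = l
        · subst h
          rw [if_pos rfl, DirectSum.of_eq_same]
        · rw [if_neg (by omega), DirectSum.of_eq_of_ne _ _ _ h]
          rfl
      | add x y hx hy => simp_all
    refine ⟨fun x y hxy => DFinsupp.ext fun j => Subtype.ext (Subtype.ext (LinearMap.ext
      fun a => ?_)), fun f => ?_⟩
    · have ha : a ∈ ⨆ i, 𝒜 i := h𝒜 ▸ Submodule.mem_top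
      induction ha using Submodule.iSup_induction' with
      | mem i a ha => rw [← hval x i j a ha, ← hval y i j a ha, hxy]
      | zero => rw [map_zero, map_zero]
      | add a b _ _ h h' => rw [map_add, map_add, h, h']
    · obtain ⟨f, hf⟩ := f
      have hf' : f ∈ ⨆ j, D.coindDeg N j := hf
      induction hf' using Submodule.iSup_induction' with
      | mem j g hg =>
        refine ⟨DirectSum.of (fun j => (D.coindDeg N j).comap (D.coind N).subtype) j
          ⟨⟨g, hf⟩, hg⟩, ?_⟩
        rw [DirectSum.coeAddMonoidHom_of]
      | zero => exact ⟨0, map_zero _⟩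
      | add g h hg hh h1 h2 =>
        obtain ⟨a, ha⟩ := h1 hg
        obtain ⟨b, hb⟩ := h2 hh
        refine ⟨a + b, ?_⟩
        rw [map_add, ha, hb]
        rfl
  smul_mem i j a f ha hf := D.comp_mulLeft_mem_coindDeg ha hf
  finite := D.finite_coind C hC h𝒜 N

end

end Corner

end Pertinency
-- The adjunction, and the corner functor as a localization.
namespace Pertinency

namespace Corner

open GrMod MulOpposite

noncomputable section

variable {k : Type u} [Field k] {A B : Type u} [Ring A] [Algebra k A] [Ring B] [Algebra k B]
  {𝒜 : ℕ → Submodule k A} {ℬ : ℕ → Submodule k B} (D : Corner 𝒜 ℬ)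
  (C : Type u) [CommRing C] [IsNoetherianRing C] [Algebra C A] [Algebra C B]
  [Module.Finite C A] (hC : ∀ c, D.ι (algebraMap C B c) = algebraMap C A c)

/-- The projection `m ↦ m e`. -/
def proj (M : GrMod k 𝒜) : M.carrier →ₗ[k] ((D.functor C hC).obj M).carrier :=
  LinearMap.codRestrict (fixedBy k D.e M.carrier)
    (Module.toModuleEnd k (S := Aᵐᵒᵖ) M.carrier (op D.e)) (smul_mem_fixedBy D.e_mul_e)

lemma proj_mul_ι {M : GrMod k 𝒜} (m : M.carrier) (a : A) (b : B) :
    D.proj C hC M (op (a * D.ι b) • m) = op b • D.proj C hC M (op a • m) := by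
  refine Subtype.ext ?_
  change op D.e • op (a * D.ι b) • m = op (D.ι b) • op D.e • op a • m
  rw [op_mul, mul_smul, smul_smul, smul_smul (op (D.ι b)), ← op_mul, ← op_mul, D.commute]

lemma proj_mul_e {M : GrMod k 𝒜} (m : M.carrier) (a : A) :
    D.proj C hC M (op (a * D.e) • m) = D.proj C hC M (op a • m) := by
  refine Subtype.ext ?_
  change op D.e • op (a * D.e) • m = op D.e • op a • m
  rw [op_mul, mul_smul, smul_smul (op D.e) (op D.e), ← op_mul, D.e_mul_e]

lemma proj_mem {M : GrMod k 𝒜} {j : ℤ} {m : M.carrier} (hm : m ∈ M.deg j) :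
    D.proj C hC M m ∈ ((D.functor C hC).obj M).deg j := by
  have := M.smul_mem 0 _ _ _ D.e_mem hm
  rw [Nat.cast_zero, add_zero] at this
  exact this

lemma e_smul_val {M : GrMod k 𝒜} (m : ((D.functor C hC).obj M).carrier) : op D.e • m.1 = m.1 :=
  mem_fixedBy.1 m.2

lemma proj_val {M : GrMod k 𝒜} (m : ((D.functor C hC).obj M).carrier) :
    D.proj C hC M m.1 = m :=
  Subtype.ext (D.e_smul_val C hC m)

/-- The map `m ↦ (a ↦ φ (m a e))` for a morphism `φ : M e ⟶ N`. -/
def adjunct {M : GrMod k 𝒜} {N : GrMod k ℬ} (φ : (D.functor C hC).obj M ⟶ N) :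
    M.carrier →ₗ[k] A →ₗ[k] N.carrier :=
  LinearMap.mk₂ k (fun m a => lin φ (D.proj C hC M (op a • m)))
    (fun m m' a => by rw [smul_add, map_add, map_add])
    (fun c m a => by rw [smul_comm, map_smul, lin_smul_base])
    (fun m a b => by rw [MulOpposite.op_add, add_smul, map_add, map_add])
    (fun c m a => by rw [op_smul, smul_assoc, map_smul, lin_smul_base])

lemma adjunct_apply {M : GrMod k 𝒜} {N : GrMod k ℬ} (φ : (D.functor C hC).obj M ⟶ N)
    (m : M.carrier) (a : A) :
    D.adjunct C hC φ m a = lin φ (D.proj C hC M (op a • m)) := rfl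

lemma adjunct_mem_coindDeg {M : GrMod k 𝒜} {N : GrMod k ℬ} (φ : (D.functor C hC).obj M ⟶ N)
    {j : ℤ} {m : M.carrier} (hm : m ∈ M.deg j) : D.adjunct C hC φ m ∈ D.coindDeg N j := by
  refine ⟨⟨fun a b => ?_, fun a => ?_⟩, fun i a ha => ?_⟩
  · rw [adjunct_apply, adjunct_apply, proj_mul_ι, map_smul]
  · rw [adjunct_apply, adjunct_apply, proj_mul_e]
  · rw [add_comm]
    exact lin_mem φ (D.proj_mem C hC (M.smul_mem i j a m ha hm))

lemma adjunct_mem_coind {M : GrMod k 𝒜} {N : GrMod k ℬ} (φ : (D.functor C hC).obj M ⟶ N)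
    (m : M.carrier) : D.adjunct C hC φ m ∈ D.coind N := by
  induction m using induction_homogeneous with
  | h0 =>
    rw [map_zero]
    exact zero_mem _
  | hh j m hm => exact D.coindDeg_le N j (D.adjunct_mem_coindDeg C hC φ hm)
  | ha m m' h h' =>
    rw [map_add]
    exact add_mem h h'

variable [Module.Finite C B] [SetLike.GradedMonoid 𝒜] (h𝒜 : ⨆ i, 𝒜 i = ⊤)

/-- The adjunction between the corner functor and coinduction, on morphisms. -/
def homEquiv (M : GrMod k 𝒜) (N : GrMod k ℬ) :
    ((D.functor C hC).obj M ⟶ N) ≃ (M ⟶ D.coinduced C hC h𝒜 N) where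
  toFun φ :=
    { toLinearMap :=
        letI := D.moduleCoind h𝒜 N
        { toFun := fun m => ⟨D.adjunct C hC φ m, D.adjunct_mem_coind C hC φ m⟩
          map_add' := fun m m' => Subtype.ext (map_add (D.adjunct C hC φ) m m')
          map_smul' := fun a m => Subtype.ext (LinearMap.ext fun x =>
            congrArg (fun y => lin φ (D.proj C hC M y)) (by
              rw [smul_smul]
              rfl)) }
      map_mem := fun j m hm => D.adjunct_mem_coindDeg C hC φ hm }
  invFun ψ :=
    { toLinearMap :=
        letI := D.moduleFixedBy M.carrier
        letI := D.moduleCoind h𝒜 N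
        { toFun := fun m => (lin ψ m.1).1 1
          map_add' := fun m m' => by
            change (lin ψ (m.1 + m'.1)).1 1 = _
            rw [map_add]
            rfl
          map_smul' := fun b m => by
            change (lin ψ (op (D.ι b.unop) • m.1)).1 1 = _
            rw [map_smul]
            change (lin ψ m.1).1 (D.ι b.unop * 1) = _
            rw [mul_one, ← one_mul (D.ι b.unop), coind_mul (lin ψ m.1).2]
            rfl }
      map_mem := fun j m hm => by
        have h1 : (1 : A) ∈ 𝒜 0 := SetLike.GradedOne.one_mem
        have := (lin_mem ψ hm).2 0 1 h1
        simpa using this }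
  left_inv φ := hom_ext fun m => congrArg (lin φ) (by
    rw [op_one, one_smul, proj_val])
  right_inv ψ := hom_ext fun m => Subtype.ext (LinearMap.ext fun a => by
    change (lin ψ (op D.e • op a • m)).1 1 = (lin ψ m).1 a
    rw [map_smul, map_smul]
    change (lin ψ m).1 (a * (D.e * 1)) = _
    rw [mul_one, coind_mul_e (lin ψ m).2])

lemma homEquiv_naturality {M M' : GrMod k 𝒜} {N : GrMod k ℬ} (f : M' ⟶ M)
    (g : (D.functor C hC).obj M ⟶ N) :
    D.homEquiv C hC h𝒜 M' N ((D.functor C hC).map f ≫ g) = f ≫ D.homEquiv C hC h𝒜 M N g :=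
  hom_ext fun m => Subtype.ext (LinearMap.ext fun a => congrArg (lin g) (Subtype.ext (by
    change lin f (op D.e • op a • m) = op D.e • op a • lin f m
    rw [map_smul, map_smul])))

/-- Coinduction, as a functor. -/
def coindFunctor : GrMod k ℬ ⥤ GrMod k 𝒜 :=
  Adjunction.rightAdjointOfEquiv (F := D.functor C hC) (G_obj := D.coinduced C hC h𝒜)
    (D.homEquiv C hC h𝒜) (fun _ _ _ f g => D.homEquiv_naturality C hC h𝒜 f g)

/-- The adjunction between the corner functor and coinduction. -/
def adjunction : D.functor C hC ⊣ D.coindFunctor C hC h𝒜 :=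
  Adjunction.adjunctionOfEquivRight (F := D.functor C hC) (G_obj := D.coinduced C hC h𝒜)
    (D.homEquiv C hC h𝒜) (fun _ _ _ f g => D.homEquiv_naturality C hC h𝒜 f g)

/-- The counit is evaluation at `1`. A coinduced map `f` fixed by `e` satisfies `f a = f (e a e) = f
(ι (tr a) e) = f 1 · tr a`, so `f` is determined by `f 1`. Conversely `a ↦ n · tr a` takes the value
`n` at `1`. -/
instance isIso_counit : IsIso (D.adjunction C hC h𝒜).counit := by
  refine @NatIso.isIso_of_isIso_app _ _ _ _ _ _ _ fun N => ?_
  have h : (D.adjunction C hC h𝒜).counit.app N = (D.homEquiv C hC h𝒜 _ N).symm (𝟙 _) := by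
    simp [adjunction]
    rfl
  rw [h]
  refine isIso_of_bijective _ ⟨?_, ?_⟩
  · rw [injective_iff_map_eq_zero]
    intro f hf
    refine Subtype.ext (Subtype.ext (LinearMap.ext fun a => ?_))
    have hf1 : f.1.1 1 = 0 := hf
    have hfe (x : A) : f.1.1 (D.e * x) = f.1.1 x :=
      congrArg (fun g : (D.coinduced C hC h𝒜 N).carrier => g.1 x)
        (D.e_smul_val C hC f)
    change f.1.1 a = 0
    rw [← hfe, ← coind_mul_e f.1.2, D.e_mul_mul_e, coind_mul_e f.1.2, ← one_mul (D.ι _),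
      coind_mul f.1.2, hf1, smul_zero]
  · intro n
    let g (n : N.carrier) : A →ₗ[k] N.carrier :=
      { toFun := fun a => op (D.tr a) • n
        map_add' := fun a b => by rw [map_add, MulOpposite.op_add, add_smul]
        map_smul' := fun c a => by rw [map_smul, op_smul, smul_assoc]; rfl }
    have hg (n : N.carrier) : g n ∈ D.coind N := by
      induction n using induction_homogeneous with
      | h0 =>
        convert zero_mem (D.coind N)
        exact LinearMap.ext fun a => smul_zero _
      | hh j n hn =>
        refine D.coindDeg_le N j ⟨⟨fun a b => ?_, fun a => ?_⟩, fun i a ha => ?_⟩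
        · change op (D.tr (a * D.ι b)) • n = op b • op (D.tr a) • n
          rw [D.tr_mul, op_mul, mul_smul]
        · change op (D.tr (a * D.e)) • n = op (D.tr a) • n
          rw [D.tr_mul_e]
        · rw [add_comm]
          exact N.smul_mem i j _ n (D.tr_mem i a ha) hn
      | ha n n' h h' =>
        have : g (n + n') = g n + g n' := LinearMap.ext fun a => smul_add _ _ _
        rw [this]
        exact add_mem h h'
    refine ⟨⟨⟨g n, hg n⟩, mem_fixedBy.2 (Subtype.ext (LinearMap.ext fun a => ?_))⟩, ?_⟩
    · change op (D.tr (D.e * a)) • n = op (D.tr a) • n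
      rw [D.tr_e_mul]
    · change op (D.tr 1) • n = n
      rw [D.tr_one, op_one, one_smul]

include h𝒜 in
/-- The corner functor is a localization. -/
lemma isLocalization_functor : (D.functor C hC).IsLocalization
    ((MorphismProperty.isomorphisms _).inverseImage (D.functor C hC)) := by
  have h := (D.adjunction C hC h𝒜).fullyFaithfulROfIsIsoCounit
  have := h.full
  have := h.faithful
  exact (D.adjunction C hC h𝒜).isLocalization

end

end Corner

end Pertinency
-- Comparison of the quotient categories of an algebra and its corner.
namespace Pertinency

namespace Corner

open GrMod MulOpposite

noncomputable section

variable {k : Type u} [Field k] {A B : Type u} [Ring A] [Algebra k A] [Ring B] [Algebra k B]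
  {𝒜 : ℕ → Submodule k A} {ℬ : ℕ → Submodule k B} (D : Corner 𝒜 ℬ)
  (C : Type u) [CommRing C] [IsNoetherianRing C] [Algebra C A] [Algebra C B]
  [Module.Finite C A] (hC : ∀ c, D.ι (algebraMap C B c) = algebraMap C A c)
  {U : Submodule k A} (hU : U.FG) (hUe : ∀ a, ∃ u ∈ U, a - u ∈ TwoSidedIdeal.span {D.e})

include hU hUe in
-- The kernel of the restricted map is `(ker f) e`, and `finite_of_finite_fixedBy` recovers
-- finiteness of `ker f` from it.
lemma finite_ker_map_iff [IsNoetherianRing Aᵐᵒᵖ] {M N : GrMod k 𝒜} (f : M ⟶ N) :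
    Module.Finite k (LinearMap.ker (lin ((D.functor C hC).map f))) ↔
      Module.Finite k (LinearMap.ker (lin f)) := by
  constructor
  · intro h
    have : Module.Finite k (fixedBy k D.e (LinearMap.ker (lin f))) := by
      let g : fixedBy k D.e (LinearMap.ker (lin f)) →ₗ[k]
          LinearMap.ker (lin ((D.functor C hC).map f)) :=
        { toFun := fun m => ⟨(⟨m.1.1, mem_fixedBy.2 (congrArg Subtype.val (mem_fixedBy.1 m.2))⟩ :
            fixedBy k D.e M.carrier), Subtype.ext m.1.2⟩
          map_add' := fun _ _ => rfl
          map_smul' := fun _ _ => rfl }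
      exact Module.Finite.of_injective g fun m m' hm => Subtype.ext (Subtype.ext
        (congrArg (fun x : LinearMap.ker (lin ((D.functor C hC).map f)) => x.1.1) hm))
    exact finite_of_finite_fixedBy C D.e_mul_e hU hUe
  · intro h
    let g : LinearMap.ker (lin ((D.functor C hC).map f)) →ₗ[k] LinearMap.ker (lin f) :=
      { toFun := fun m => ⟨m.1.1, congrArg Subtype.val m.2⟩
        map_add' := fun _ _ => rfl
        map_smul' := fun _ _ => rfl }
    exact Module.Finite.of_injective g fun m m' hm => Subtype.ext (Subtype.ext
      (congrArg (fun x : LinearMap.ker (lin f) => x.1) hm))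

include hU hUe in
lemma finite_coker_map_iff {M N : GrMod k 𝒜} (f : M ⟶ N) :
    Module.Finite k (((D.functor C hC).obj N).carrier ⧸
        LinearMap.range (lin ((D.functor C hC).map f))) ↔
      Module.Finite k (N.carrier ⧸ LinearMap.range (lin f)) := by
  let p := (LinearMap.range (lin ((D.functor C hC).map f))).restrictScalars k
  let q := (LinearMap.range (lin f)).restrictScalars k
  let i : ((D.functor C hC).obj N).carrier →ₗ[k] N.carrier := (fixedBy k D.e N.carrier).subtype
  -- The restricted map has range `range f ∩ Ne`: if `n = n e = f m`, then `n = f (m e)`. So its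
  -- cokernel embeds in that of `f`, and covers the part of it fixed by `e`.
  have hpq : p = q.comap i := by
    ext n
    constructor
    · rintro ⟨m, rfl⟩
      exact ⟨m.1, rfl⟩
    · rintro ⟨m, hm⟩
      refine ⟨D.proj C hC M m, Subtype.ext ?_⟩
      change lin f (op D.e • m) = n.1
      rw [map_smul, hm]
      exact D.e_smul_val C hC n
  let φ : (((D.functor C hC).obj N).carrier ⧸ p) →ₗ[k] (N.carrier ⧸ q) := p.mapQ q i hpq.le
  constructor
  · intro h
    have h : Module.Finite k (((D.functor C hC).obj N).carrier ⧸ p) := h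
    have : Module.Finite k (fixedBy k D.e (N.carrier ⧸ LinearMap.range (lin f))) := by
      have hle : fixedBy k D.e (N.carrier ⧸ LinearMap.range (lin f)) ≤ LinearMap.range φ := by
        intro x hx
        obtain ⟨n, rfl⟩ := Submodule.mkQ_surjective _ x
        refine ⟨p.mkQ (D.proj C hC N n), ?_⟩
        exact mem_fixedBy.1 hx
      refine Module.Finite.iff_fg.2 (Submodule.FG.of_le (T := LinearMap.range φ) ?_ hle)
      exact Module.Finite.iff_fg.1 (Module.Finite.range φ)
    exact finite_of_finite_fixedBy C D.e_mul_e hU hUe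
  · intro h
    have h : Module.Finite k (N.carrier ⧸ q) := h
    have hφ : Function.Injective φ := by
      rw [← LinearMap.ker_eq_bot, Submodule.ker_mapQ, ← hpq, Submodule.mkQ_map_self]
    exact Module.Finite.of_injective φ hφ

variable [IsNoetherianRing Aᵐᵒᵖ] [IsNoetherianRing Bᵐᵒᵖ] [Algebra.FiniteType k Aᵐᵒᵖ] [Algebra.FiniteType k Bᵐᵒᵖ]

include hU hUe in
lemma inverseImage_isoModGKdimLE :
    (isoModGKdimLE ℬ 0).inverseImage (D.functor C hC) = isoModGKdimLE 𝒜 0 := by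
  ext M N f
  rw [MorphismProperty.inverseImage_iff, isoModGKdimLE_zero_iff, isoModGKdimLE_zero_iff,
    D.finite_ker_map_iff C hC hU hUe, D.finite_coker_map_iff C hC hU hUe]

variable [Module.Finite C B] [SetLike.GradedMonoid 𝒜] (h𝒜 : ⨆ i, 𝒜 i = ⊤)

include h𝒜 hU hUe in
-- Two localizations in succession. The maps that the corner functor inverts lie in the class for
-- `A`, which is the preimage of the class for `B`. Every map in the latter is, by the counit,
-- isomorphic to the image of its coinduction.
lemma isLocalization_comp : (D.functor C hC ⋙ (isoModGKdimLE ℬ 0).Q).IsLocalization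
    (isoModGKdimLE 𝒜 0) := by
  have := D.isLocalization_functor C hC h𝒜
  have hW := D.inverseImage_isoModGKdimLE C hC hU hUe
  have hresp : (isoModGKdimLE 𝒜 0).RespectsIso := by
    rw [isoModGKdimLE_zero_eq]
    infer_instance
  refine Functor.IsLocalization.comp (D.functor C hC) (isoModGKdimLE ℬ 0).Q
    ((MorphismProperty.isomorphisms _).inverseImage (D.functor C hC)) (isoModGKdimLE ℬ 0)
    (isoModGKdimLE 𝒜 0) ?_ ?_ ?_
  · intro M N f hf
    rw [← hW] at hf
    exact Localization.inverts (isoModGKdimLE ℬ 0).Q _ _ hf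
  · intro M N f hf
    rw [← hW]
    have hf : IsIso ((D.functor C hC).map f) := hf
    change isoModGKdimLE ℬ 0 _
    rw [isoModGKdimLE_zero_eq]
    exact MorphismProperty.of_isIso _ _
  · intro M N g hg
    let e : Arrow.mk ((D.functor C hC).map ((D.coindFunctor C hC h𝒜).map g)) ≅ Arrow.mk g :=
      Arrow.isoMk (asIso ((D.adjunction C hC h𝒜).counit.app M))
        (asIso ((D.adjunction C hC h𝒜).counit.app N))
        ((D.adjunction C hC h𝒜).counit.naturality g).symm
    have hg' : isoModGKdimLE ℬ 0 ((D.functor C hC).map ((D.coindFunctor C hC h𝒜).map g)) := by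
      rw [isoModGKdimLE_zero_eq] at hg ⊢
      exact ((finiteDim ℬ).isoModSerre.arrow_mk_iso_iff e).2 hg
    have hg' : isoModGKdimLE 𝒜 0 ((D.coindFunctor C hC h𝒜).map g) := by
      rw [← hW]
      exact hg'
    exact (((isoModGKdimLE 𝒜 0).map (D.functor C hC)).arrow_mk_iso_iff e).1
      (MorphismProperty.map_mem_map _ _ _ hg')

include h𝒜 hU hUe hC in
/-- The equivalence of the quotient categories of `A` and of its corner. -/
theorem nonempty_qgr_equivalence : Nonempty (qgr k A 𝒜 0 ≌ qgr k B ℬ 0) :=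
  have := D.isLocalization_comp C hC hU hUe h𝒜
  ⟨Localization.uniq (isoModGKdimLE 𝒜 0).Q (D.functor C hC ⋙ (isoModGKdimLE ℬ 0).Q)
    (isoModGKdimLE 𝒜 0)⟩

include h𝒜 hU hUe hC in
/-- The quotient category of the corner has finite global dimension if `gr A` has. -/
theorem hasFiniteGlobalDimension_qgr [∀ i, Module.Finite k (𝒜 i)] {n : ℕ}
    (hA : ∀ M : GrMod k 𝒜, HasProjectiveDimensionLE M n) :
    HasFiniteGlobalDimension (qgr k B ℬ 0) := by
  have hL := D.isLocalization_comp C hC hU hUe h𝒜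
  rw [isoModGKdimLE_zero_eq 𝒜] at hL
  let L : GrMod k 𝒜 ⥤ qgr k B ℬ 0 := D.functor C hC ⋙ (isoModGKdimLE ℬ 0).Q
  have hL : L.IsLocalization (finiteDim 𝒜).isoModSerre := hL
  let _ := Localization.preadditive L (finiteDim 𝒜).isoModSerre
  have := Localization.functor_additive L (finiteDim 𝒜).isoModSerre
  let _ := ObjectProperty.SerreClassLocalization.abelian L (finiteDim 𝒜)
  have := ObjectProperty.SerreClassLocalization.preservesFiniteLimits L (finiteDim 𝒜)
  have := ObjectProperty.SerreClassLocalization.preservesFiniteColimits L (finiteDim 𝒜)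
  exact ⟨inferInstance, n, hasProjectiveDimensionLE_of_isLocalization (finiteDim 𝒜) L
    (fun g s hs => exists_isoModSerre_factor h𝒜 g s hs) hA⟩

end

end Corner

end Pertinency
namespace Pertinency

/-! ### Projective dimension of modules -/

section ProjectiveDimension

variable (S : Type u) [Ring S] (M : Type u) [AddCommGroup M] [Module S M]

/-- The projective dimension of the `S`-module `M` is at most `n`. -/
abbrev PdLE (n : ℕ) : Prop := HasProjectiveDimensionLE (ModuleCat.of S M) n

variable {S M}

lemma pdLE_zero_iff : PdLE S M 0 ↔ Module.Projective S M := by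
  rw [PdLE, ← projective_iff_hasProjectiveDimensionLE_zero, ← IsProjective.iff_projective]

lemma pdLE_of_projective [Module.Projective S M] (n : ℕ) : PdLE S M n :=
  have : PdLE S M 0 := pdLE_zero_iff.2 inferInstance
  hasProjectiveDimensionLT_of_ge _ 1 (n + 1) (by omega)

variable {K N : Type u} [AddCommGroup K] [Module S K] [AddCommGroup N] [Module S N]

lemma shortExact_of_linearMap (f : K →ₗ[S] M) (g : M →ₗ[S] N) (hf : Function.Injective f)
    (hg : Function.Surjective g) (h : Function.Exact f g) :
    (ShortComplex.mk (ModuleCat.ofHom f) (ModuleCat.ofHom g) (by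
      ext x
      exact h.apply_apply_eq_zero x)).ShortExact where
  exact := (ShortComplex.ShortExact.moduleCat_exact_iff_function_exact _).2 h
  mono_f := (ModuleCat.mono_iff_injective _).2 hf
  epi_g := (ModuleCat.epi_iff_surjective _).2 hg

lemma PdLE.of_shortExact (f : K →ₗ[S] M) (g : M →ₗ[S] N) (hf : Function.Injective f)
    (hg : Function.Surjective g) (h : Function.Exact f g) {n : ℕ} (hK : PdLE S K n)
    (hM : PdLE S M (n + 1)) : PdLE S N (n + 1) :=
  (shortExact_of_linearMap f g hf hg h).hasProjectiveDimensionLT_X₃ (n + 1) hK hM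

lemma PdLE.ker [Module.Projective S M] (g : M →ₗ[S] N)
    (hg : Function.Surjective g) {n : ℕ} (hN : PdLE S N (n + 1)) : PdLE S (LinearMap.ker g) n :=
  ((shortExact_of_linearMap (LinearMap.ker g).subtype g Subtype.val_injective hg
    (LinearMap.exact_subtype_ker_map g)).hasProjectiveDimensionLT_X₃_iff n
    ((IsProjective.iff_projective M).1 inferInstance)).1 hN

variable (S M) in
lemma surjective_linearCombination_id :
    Function.Surjective (Finsupp.linearCombination S (id : M → M)) :=
  Finsupp.linearCombination_id_surjective S M

lemma PdLE.of_semilinear {S' : Type u} [Ring S'] {M' : Type u} [AddCommGroup M'] [Module S' M']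
    (e : S ≃+* S') (f : M ≃+ M') (h : ∀ s m, f (s • m) = e s • f m) {n : ℕ} (hM : PdLE S M n) :
    PdLE S' M' n := by
  let _ := RingHomInvPair.of_ringEquiv e
  let _ := RingHomInvPair.of_ringEquiv_symm e
  let f' : M ≃ₛₗ[RingHomClass.toRingHom e] M' := { f with map_smul' := h }
  have : HasProjectiveDimensionLE (ModuleCat.of S M) n := hM
  exact ModuleCat.hasProjectiveDimensionLE_of_semiLinearEquiv (M := ModuleCat.of S M)
    (N := ModuleCat.of S' M') e f' n

end ProjectiveDimension

/-! ### Modules over the skew polynomial ring -/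

/-- The `(-1)`-skew polynomial ring, with the semiring structure that comes from its ring
structure. -/
def SkewRing (k : Type u) [Field k] (n : ℕ) : Type u := SkewPoly k n

namespace SkewRing

noncomputable section

instance (k : Type u) [Field k] (n : ℕ) : Ring (SkewRing k n) := inferInstanceAs (Ring (SkewPoly k n))

instance (k : Type u) [Field k] (n : ℕ) : Algebra k (SkewRing k n) :=
  inferInstanceAs (Algebra k (SkewPoly k n))

variable (k : Type u) [Field k] (n : ℕ) in
/-- The identification with the skew polynomial ring. -/
def equivSkewPoly : SkewRing k n ≃ₐ[k] SkewPoly k n :=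
  AlgEquiv.refl (R := k) (A₁ := SkewPoly k n)

variable (k : Type u) [Field k] (n : ℕ) in
/-- The generators. -/
def X (i : Fin n) : SkewRing k n := SkewPoly.X k n i

variable {k : Type u} [Field k] {n : ℕ}

lemma X_mul_X {i j : Fin n} (h : i ≠ j) : X k n i * X k n j = -(X k n j * X k n i) :=
  SkewPoly.X_mul_X h

lemma algHom_ext {A : Type*} [Ring A] [Algebra k A] {f g : SkewRing k n →ₐ[k] A}
    (h : ∀ i, f (X k n i) = g (X k n i)) : f = g := by
  have := SkewPoly.algHom_ext (f := f.comp (equivSkewPoly k n).symm.toAlgHom)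
    (g := g.comp (equivSkewPoly k n).symm.toAlgHom) h
  exact AlgHom.ext fun a => congrArg (fun h => h (equivSkewPoly k n a)) this

/-- The universal property of the skew polynomial ring. -/
def lift {A : Type*} [Ring A] [Algebra k A] (f : Fin n → A)
    (hf : ∀ i j, i ≠ j → f i * f j = -(f j * f i)) : SkewRing k n →ₐ[k] A :=
  (RingQuot.liftAlgHom k (s := SkewRel k n) ⟨FreeAlgebra.lift k f, by
    rintro _ _ ⟨i, j, h⟩
    simpa using hf i j h⟩).comp (equivSkewPoly k n).toAlgHom

@[simp]
lemma lift_X {A : Type*} [Ring A] [Algebra k A] (f : Fin n → A)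
    (hf : ∀ i j, i ≠ j → f i * f j = -(f j * f i)) (i : Fin n) : lift f hf (X k n i) = f i := by
  change RingQuot.liftAlgHom k _ (SkewPoly.X k n i) = f i
  simp [SkewPoly.X]

/-- By the universal property the identity factors through the subalgebra generated by the `x_i`. -/
lemma adjoin_range_X : Algebra.adjoin k (Set.range (X k n)) = ⊤ := by
  let T := Algebra.adjoin k (Set.range (X k n))
  let f : SkewRing k n →ₐ[k] T := lift (A := T)
    (fun i => ⟨X k n i, Algebra.subset_adjoin ⟨i, rfl⟩⟩) fun i j h => Subtype.ext (X_mul_X h)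
  have hf : T.val.comp f = AlgHom.id k _ := algHom_ext fun i => by simp [f]
  refine eq_top_iff.2 fun a _ => ?_
  have := congrArg (fun g => g a) hf
  rw [← show T.val (f a) = a from this]
  exact (f a).2

lemma induction_X {p : SkewRing k n → Prop} (hk : ∀ c, p (algebraMap k _ c))
    (hX : ∀ i, p (X k n i)) (hadd : ∀ a b, p a → p b → p (a + b))
    (hmul : ∀ a b, p a → p b → p (a * b)) (a : SkewRing k n) : p a := by
  have ha : a ∈ Algebra.adjoin k (Set.range (X k n)) := by
    rw [adjoin_range_X]
    exact Algebra.mem_top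
  induction ha using Algebra.adjoin_induction with
  | mem x hx =>
    obtain ⟨i, rfl⟩ := hx
    exact hX i
  | algebraMap c => exact hk c
  | add a b _ _ h h' => exact hadd a b h h'
  | mul a b _ _ h h' => exact hmul a b h h'

section Linear

variable {M N : Type*} [AddCommGroup M] [Module k M] [Module (SkewRing k n) M]
  [IsScalarTower k (SkewRing k n) M] [AddCommGroup N] [Module k N] [Module (SkewRing k n) N]
  [IsScalarTower k (SkewRing k n) N]

/-- A `k`-linear map that commutes with the generators is linear over the skew polynomial ring. -/
def linearMapOfX (f : M →ₗ[k] N) (h : ∀ i m, f (X k n i • m) = X k n i • f m) :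
    M →ₗ[SkewRing k n] N where
  toFun := f
  map_add' := f.map_add
  map_smul' a := by
    induction a using induction_X with
    | hk c => intro m; simp [algebraMap_smul]
    | hX i => exact h i
    | hadd a b h h' => intro m; simp_all [add_smul]
    | hmul a b h h' => intro m; simp_all [mul_smul]

@[simp] lemma linearMapOfX_apply (f : M →ₗ[k] N) (h) (m : M) :
    linearMapOfX (n := n) f h m = f m := rfl

end Linear

/-- The inclusion of the skew polynomial ring on the first `n` generators. -/
def incl : SkewRing k n →ₐ[k] SkewRing k (n + 1) :=
  lift (fun i => X k (n + 1) i.castSucc) fun _ _ h =>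
    X_mul_X ((Fin.castSucc_injective n).ne h)

@[simp] lemma incl_X (i : Fin n) : incl (X k n i) = X k (n + 1) i.castSucc := lift_X ..

/-- The automorphism `x_i ↦ -x_i`. -/
def neg : SkewRing k n →ₐ[k] SkewRing k n :=
  lift (fun i => -X k n i) fun i j h => by
    rw [neg_mul_neg, neg_mul_neg, X_mul_X h]

@[simp] lemma neg_X (i : Fin n) : neg (X k n i) = -X k n i := lift_X ..

end

end SkewRing

end Pertinency
-- Polynomials with coefficients in a module, over one more generator.
namespace Pertinency

/-- The polynomials in one variable with coefficients in a module. -/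
def PolyMod (M : Type u) [AddCommGroup M] : Type u := ℕ →₀ M

namespace PolyMod

noncomputable section

variable {k : Type u} [Field k] {n : ℕ} {M N P : Type u} [AddCommGroup M] [AddCommGroup N]
  [AddCommGroup P]

instance : AddCommGroup (PolyMod M) := inferInstanceAs (AddCommGroup (ℕ →₀ M))

instance [Module k M] : Module k (PolyMod M) := inferInstanceAs (Module k (ℕ →₀ M))

section Basic

variable (k) [Module k M] [Module k N] [Module k P]

/-- The monomial `m x ^ j`. -/
def mono (j : ℕ) : M →ₗ[k] PolyMod M := Finsupp.lsingle j

/-- The coefficient of `x ^ j`. -/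
def coeff (j : ℕ) : PolyMod M →ₗ[k] M := Finsupp.lapply j

variable {k}

lemma coeff_mono (i j : ℕ) (m : M) : coeff k i (mono k j m) = if j = i then m else 0 :=
  Finsupp.single_apply

@[ext]
lemma hom_ext {f g : PolyMod M →ₗ[k] N} (h : ∀ j m, f (mono k j m) = g (mono k j m)) : f = g :=
  Finsupp.lhom_ext h

variable (k) in
lemma ext_coeff {v w : PolyMod M} (h : ∀ j, coeff k j v = coeff k j w) : v = w :=
  Finsupp.ext h

variable (k) in
lemma exists_coeff_eq_zero (v : PolyMod M) : ∃ d, ∀ j ≥ d, coeff k j v = 0 := by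
  classical
  obtain ⟨d, hd⟩ := (show ℕ →₀ M from v).support.exists_nat_subset_range
  refine ⟨d, fun j hj => ?_⟩
  by_contra h
  have := hd (Finsupp.mem_support_iff.2 h)
  rw [Finset.mem_range] at this
  omega

/-- The linear map with given values on the monomials. -/
def desc (f : ℕ → M →ₗ[k] N) : PolyMod M →ₗ[k] N := Finsupp.lsum ℕ f

@[simp]
lemma desc_mono (f : ℕ → M →ₗ[k] N) (j : ℕ) (m : M) : desc f (mono k j m) = f j m :=
  Finsupp.lsum_single ℕ f j m

/-- The map on polynomials given by a map on coefficients. -/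
def map (f : M →ₗ[k] N) : PolyMod M →ₗ[k] PolyMod N := desc fun j => mono k j ∘ₗ f

@[simp]
lemma map_mono (f : M →ₗ[k] N) (j : ℕ) (m : M) : map f (mono k j m) = mono k j (f m) := by
  simp [map]

lemma coeff_map (f : M →ₗ[k] N) (j : ℕ) (v : PolyMod M) :
    coeff k j (map f v) = f (coeff k j v) := by
  have : coeff k j ∘ₗ map f = f ∘ₗ coeff k j := by
    ext i m
    simp only [LinearMap.comp_apply, map_mono, coeff_mono]
    split_ifs <;> simp
  exact congrArg (fun g => g v) this

lemma map_injective {f : M →ₗ[k] N} (hf : Function.Injective f) : Function.Injective (map f) := by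
  intro v w h
  refine ext_coeff k fun j => hf ?_
  rw [← coeff_map, ← coeff_map, h]

lemma map_surjective {f : M →ₗ[k] N} (hf : Function.Surjective f) :
    Function.Surjective (map f) := by
  rw [← LinearMap.range_eq_top]
  refine eq_top_iff.2 fun v _ => ?_
  induction v using Finsupp.induction_linear with
  | zero => exact zero_mem _
  | add v w hv hw => exact add_mem (hv trivial) (hw trivial)
  | single j m =>
    obtain ⟨m, rfl⟩ := hf m
    exact ⟨mono k j m, map_mono f j m⟩

lemma map_exact {f : M →ₗ[k] N} {g : N →ₗ[k] P} (hf : Function.Injective f)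
    (h : Function.Exact f g) : Function.Exact (map f) (map g) := by
  intro v
  constructor
  · intro hv
    have hv' (j : ℕ) : ∃ m, f m = coeff k j v := by
      refine (h _).1 ?_
      rw [← coeff_map, hv, map_zero]
    choose m hm using hv'
    obtain ⟨d, hd⟩ := exists_coeff_eq_zero k v
    refine ⟨∑ i ∈ Finset.range d, mono k i (m i), ext_coeff k fun j => ?_⟩
    rw [coeff_map, map_sum, ← hm]
    congr 1
    simp only [coeff_mono, Finset.sum_ite_eq', Finset.mem_range]
    split_ifs with hj
    · rfl
    -- Beyond the degree of `v` the chosen preimages vanish, since `f` is injective, so the finite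
    -- sum misses nothing.
    · apply hf
      rw [hm, hd j (by omega), map_zero]
  · rintro ⟨w, rfl⟩
    refine ext_coeff k fun j => ?_
    rw [coeff_map, coeff_map, h.apply_apply_eq_zero, map_zero]

end Basic

section Action

variable [Module k M] [Module (SkewRing k n) M] [IsScalarTower k (SkewRing k n) M]
  [Module k N] [Module (SkewRing k n) N] [IsScalarTower k (SkewRing k n) N]

variable (k n M) in
/-- The action of the generators on the polynomials: the last one is multiplication by `x`, and
the others anticommute with `x`. -/
def act : Fin (n + 1) → Module.End k (PolyMod M) :=
  Fin.lastCases (desc fun j => mono k (j + 1)) fun i =>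
    desc fun j => (-1 : k) ^ j • mono k j ∘ₗ Algebra.lsmul k k M (SkewRing.X k n i)

lemma act_castSucc_mono (i : Fin n) (j : ℕ) (m : M) :
    act k n M i.castSucc (mono k j m) = (-1 : k) ^ j • mono k j (SkewRing.X k n i • m) := by
  simp [act]

lemma act_last_mono (j : ℕ) (m : M) :
    act k n M (Fin.last n) (mono k j m) = mono k (j + 1) m := by
  simp [act]

lemma act_mul (i j : Fin (n + 1)) (h : i ≠ j) :
    act k n M i * act k n M j = -(act k n M j * act k n M i) := by
  refine hom_ext fun l m => ?_
  rw [LinearMap.neg_apply, Module.End.mul_apply, Module.End.mul_apply]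
  induction i using Fin.lastCases with
  | last =>
    induction j using Fin.lastCases with
    | last => exact absurd rfl h
    | cast j =>
      rw [act_castSucc_mono, map_smul, act_last_mono, act_last_mono, act_castSucc_mono, pow_succ]
      simp
  | cast i =>
    induction j using Fin.lastCases with
    | last =>
      rw [act_castSucc_mono, map_smul, act_last_mono, act_last_mono, act_castSucc_mono, pow_succ]
      simp
    | cast j =>
      rw [act_castSucc_mono, act_castSucc_mono, LinearMap.map_smul_of_tower (act k n M i.castSucc),
        LinearMap.map_smul_of_tower (act k n M j.castSucc), act_castSucc_mono,
        act_castSucc_mono, smul_smul, smul_smul, smul_smul, smul_smul, SkewRing.X_mul_X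
        (fun e => h (congrArg _ e))]
      rw [neg_smul, map_neg, smul_neg]

instance : Module (SkewRing k (n + 1)) (PolyMod M) :=
  Module.compHom _ (SkewRing.lift (act k n M) act_mul).toRingHom

lemma smul_def (a : SkewRing k (n + 1)) (v : PolyMod M) :
    a • v = SkewRing.lift (act k n M) act_mul a v := rfl

instance : IsScalarTower k (SkewRing k (n + 1)) (PolyMod M) :=
  ⟨fun c a v => by rw [smul_def, smul_def, map_smul, LinearMap.smul_apply]⟩

@[simp]
lemma X_castSucc_smul_mono (i : Fin n) (j : ℕ) (m : M) :
    SkewRing.X k (n + 1) i.castSucc • mono k j m =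
      (-1 : k) ^ j • mono k j (SkewRing.X k n i • m) := by
  rw [smul_def, SkewRing.lift_X, act_castSucc_mono]

@[simp]
lemma X_last_smul_mono (j : ℕ) (m : M) :
    SkewRing.X k (n + 1) (Fin.last n) • mono k j m = mono k (j + 1) m := by
  rw [smul_def, SkewRing.lift_X, act_last_mono]

/-- A linear map from polynomials that commutes with the generators on monomials is linear over
the skew polynomial ring. -/
def linearMap {L : Type u} [AddCommGroup L] [Module k L] [Module (SkewRing k (n + 1)) L]
    [IsScalarTower k (SkewRing k (n + 1)) L] (f : ℕ → M →ₗ[k] L)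
    (hlast : ∀ j m, f (j + 1) m = SkewRing.X k (n + 1) (Fin.last n) • f j m)
    (hcast : ∀ (i : Fin n) j m, (-1 : k) ^ j • f j (SkewRing.X k n i • m) =
      SkewRing.X k (n + 1) i.castSucc • f j m) :
    PolyMod M →ₗ[SkewRing k (n + 1)] L :=
  SkewRing.linearMapOfX (desc f) fun i v => by
    have : desc f ∘ₗ Algebra.lsmul k k (PolyMod M) (SkewRing.X k (n + 1) i) =
        Algebra.lsmul k k L (SkewRing.X k (n + 1) i) ∘ₗ desc f := by
      refine hom_ext (M := M) fun j m => ?_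
      simp only [LinearMap.comp_apply, Algebra.lsmul_coe]
      induction i using Fin.lastCases with
      | last => rw [X_last_smul_mono, desc_mono, desc_mono, hlast]
      | cast i => rw [X_castSucc_smul_mono, map_smul, desc_mono, desc_mono, hcast]
    exact congrArg (fun g => g v) this

lemma linearMap_mono {L : Type u} [AddCommGroup L] [Module k L] [Module (SkewRing k (n + 1)) L]
    [IsScalarTower k (SkewRing k (n + 1)) L] (f : ℕ → M →ₗ[k] L) (hlast) (hcast)
    (j : ℕ) (m : M) : linearMap (n := n) f hlast hcast (mono k j m) = f j m :=
  desc_mono f j m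

end Action

end

end PolyMod

end Pertinency
-- Extension of scalars to one more generator preserves projective dimension bounds.
namespace Pertinency

namespace PolyMod

noncomputable section

variable {k : Type u} [Field k] {n : ℕ} {M N P L : Type u} [AddCommGroup M] [AddCommGroup N]
  [AddCommGroup P] [AddCommGroup L]
  [Module k M] [Module (SkewRing k n) M] [IsScalarTower k (SkewRing k n) M]
  [Module k N] [Module (SkewRing k n) N] [IsScalarTower k (SkewRing k n) N]
  [Module k P] [Module (SkewRing k n) P] [IsScalarTower k (SkewRing k n) P]
  [Module k L] [Module (SkewRing k (n + 1)) L] [IsScalarTower k (SkewRing k (n + 1)) L]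

lemma X_mul_X_last_pow (i : Fin n) (j : ℕ) :
    SkewRing.X k (n + 1) i.castSucc * SkewRing.X k (n + 1) (Fin.last n) ^ j =
      (-1 : k) ^ j • (SkewRing.X k (n + 1) (Fin.last n) ^ j * SkewRing.X k (n + 1) i.castSucc) := by
  induction j with
  | zero => simp
  | succ j ih =>
    have h : SkewRing.X k (n + 1) i.castSucc * SkewRing.X k (n + 1) (Fin.last n) =
        (-1 : k) • (SkewRing.X k (n + 1) (Fin.last n) * SkewRing.X k (n + 1) i.castSucc) := by
      rw [SkewRing.X_mul_X (Fin.castSucc_lt_last i).ne]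
      exact (neg_one_smul k _).symm
    rw [pow_succ, ← mul_assoc, ih, smul_mul_assoc, mul_assoc, h, mul_smul_comm, smul_smul,
      pow_succ, mul_assoc]

/-- The extension of a linear map over the skew polynomial ring in fewer generators. -/
def extend (g : M →ₗ[k] L)
    (hg : ∀ (i : Fin n) m, g (SkewRing.X k n i • m) = SkewRing.X k (n + 1) i.castSucc • g m) :
    PolyMod M →ₗ[SkewRing k (n + 1)] L :=
  linearMap (fun j => Algebra.lsmul k k L (SkewRing.X k (n + 1) (Fin.last n) ^ j) ∘ₗ g)
    (fun j m => by
      simp only [LinearMap.comp_apply, Algebra.lsmul_coe]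
      rw [pow_succ', mul_smul])
    (fun i j m => by
      simp only [LinearMap.comp_apply, Algebra.lsmul_coe]
      rw [hg, ← mul_smul (SkewRing.X k (n + 1) i.castSucc), X_mul_X_last_pow, smul_assoc,
        mul_smul])

lemma extend_mono (g : M →ₗ[k] L) (hg) (j : ℕ) (m : M) :
    extend (n := n) g hg (mono k j m) = SkewRing.X k (n + 1) (Fin.last n) ^ j • g m :=
  linearMap_mono _ _ _ j m

variable (k n) in
lemma X_last_pow_smul_mono_zero (j : ℕ) (m : M) :
    SkewRing.X k (n + 1) (Fin.last n) ^ j • mono k 0 m = mono k j m := by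
  induction j with
  | zero => simp
  | succ j ih => rw [pow_succ', mul_smul, ih, X_last_smul_mono]

lemma linearMap_ext {f g : PolyMod M →ₗ[SkewRing k (n + 1)] L}
    (h : ∀ m, f (mono k 0 m) = g (mono k 0 m)) : f = g := by
  refine LinearMap.ext fun v => ?_
  have : f.restrictScalars k = g.restrictScalars k := hom_ext fun j m => by
    change f _ = g _
    rw [← X_last_pow_smul_mono_zero k n, map_smul, map_smul, h]
  exact congrArg (fun f => f v) this

variable (k n) in
-- `PolyMod M` is `M` with scalars extended, so maps out of it are maps out of `M`, restricted to
-- constants. A lift over the smaller ring, which exists by projectivity of `M`, extends to a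
-- section over the larger one.
lemma projective [Module.Projective (SkewRing k n) M] :
    Module.Projective (SkewRing k (n + 1)) (PolyMod M) := by
  refine Module.Projective.of_lifting_property'' fun f hf => ?_
  let Q := PolyMod M →₀ SkewRing k (n + 1)
  let _ : Module (SkewRing k n) Q := Module.compHom Q (SkewRing.incl (k := k) (n := n)).toRingHom
  let _ : Module (SkewRing k n) (PolyMod M) :=
    Module.compHom (PolyMod M) (SkewRing.incl (k := k) (n := n)).toRingHom
  have hQ (i : Fin n) (q : Q) : SkewRing.X k n i • q = SkewRing.X k (n + 1) i.castSucc • q := by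
    change SkewRing.incl (SkewRing.X k n i) • q = _
    rw [SkewRing.incl_X]
  have hP (i : Fin n) (q : PolyMod M) :
      SkewRing.X k n i • q = SkewRing.X k (n + 1) i.castSucc • q := by
    change SkewRing.incl (SkewRing.X k n i) • q = _
    rw [SkewRing.incl_X]
  have : IsScalarTower k (SkewRing k n) Q := ⟨fun c a q => by
    change SkewRing.incl (c • a) • q = c • SkewRing.incl a • q
    rw [map_smul, smul_assoc]⟩
  have : IsScalarTower k (SkewRing k n) (PolyMod M) := ⟨fun c a q => by
    change SkewRing.incl (c • a) • q = c • SkewRing.incl a • q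
    rw [map_smul, smul_assoc]⟩
  let f' : Q →ₗ[SkewRing k n] PolyMod M :=
    { f with map_smul' := fun a q => f.map_smul (SkewRing.incl a) q }
  let i' : M →ₗ[SkewRing k n] PolyMod M := SkewRing.linearMapOfX (mono k 0) fun i m => by
    rw [hP, X_castSucc_smul_mono, pow_zero, one_smul]
  obtain ⟨h, hh⟩ := Module.projective_lifting_property f' i' hf
  refine ⟨extend (L := Q) (h.restrictScalars k) fun i m => ?_, linearMap_ext fun m => ?_⟩
  · rw [← hQ]
    exact h.map_smul _ _
  · rw [LinearMap.comp_apply, extend_mono, pow_zero, one_smul]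
    exact congrArg (fun g => g m) hh

/-- The map on polynomials given by a linear map on coefficients, as a linear map over the skew
polynomial ring. -/
def mapX (f : M →ₗ[SkewRing k n] N) : PolyMod M →ₗ[SkewRing k (n + 1)] PolyMod N :=
  linearMap (fun j => mono k j ∘ₗ f.restrictScalars k)
    (fun j m => by simp) (fun i j m => by simp)

lemma mapX_injective {f : M →ₗ[SkewRing k n] N} (hf : Function.Injective f) :
    Function.Injective (mapX f) :=
  fun _ _ h => map_injective (f := f.restrictScalars k) hf h

lemma mapX_surjective {f : M →ₗ[SkewRing k n] N} (hf : Function.Surjective f) :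
    Function.Surjective (mapX f) :=
  map_surjective (f := f.restrictScalars k) hf

lemma mapX_exact {f : M →ₗ[SkewRing k n] N} {g : N →ₗ[SkewRing k n] P}
    (hf : Function.Injective f) (h : Function.Exact f g) : Function.Exact (mapX f) (mapX g) :=
  map_exact (f := f.restrictScalars k) (g := g.restrictScalars k) hf h

lemma pdLE_of_exact [Module.Projective (SkewRing k n) N] (f : M →ₗ[SkewRing k n] N)
    (g : N →ₗ[SkewRing k n] P) (hf : Function.Injective f) (hg : Function.Surjective g)
    (h : Function.Exact f g) {j : ℕ} (hM : PdLE (SkewRing k (n + 1)) (PolyMod M) j) :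
    PdLE (SkewRing k (n + 1)) (PolyMod P) (j + 1) := by
  have := projective k n (M := N)
  exact PdLE.of_shortExact _ _ (mapX_injective hf) (mapX_surjective hg) (mapX_exact hf h) hM
    (pdLE_of_projective _)

variable (k n M) in
-- Passing to polynomials is exact and preserves projectives, so it carries resolutions to
-- resolutions.
lemma pdLE {j : ℕ} (h : PdLE (SkewRing k n) M j) :
    PdLE (SkewRing k (n + 1)) (PolyMod M) j := by
  induction j generalizing M with
  | zero =>
    rw [pdLE_zero_iff] at h ⊢
    exact projective k n
  | succ j ih =>
    let g := Finsupp.linearCombination (SkewRing k n) (id : M → M)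
    have hg : Function.Surjective g := surjective_linearCombination_id (SkewRing k n) M
    exact pdLE_of_exact (LinearMap.ker g).subtype g (Submodule.injective_subtype _) hg
      (LinearMap.exact_subtype_ker_map g) (ih _ (h.ker g hg))

end

end PolyMod

end Pertinency
-- The syzygy theorem for the skew polynomial ring.
namespace Pertinency

/-- Restriction of scalars along a homomorphism of algebras. -/
def Restr {R S : Type*} (_ : R → S) (L : Type u) : Type u := L

namespace Restr

variable {k : Type*} [Field k] {R S : Type*} [Ring R] [Algebra k R] [Ring S] [Algebra k S]
  (φ : R →ₐ[k] S) (L : Type u) [AddCommGroup L] [Module k L] [Module S L] [IsScalarTower k S L]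

instance {R S : Type*} (f : R → S) : AddCommGroup (Restr f L) := inferInstanceAs (AddCommGroup L)

instance {R S : Type*} (f : R → S) : Module k (Restr f L) := inferInstanceAs (Module k L)

instance : Module R (Restr φ L) := Module.compHom L φ.toRingHom

instance : IsScalarTower k R (Restr φ L) := ⟨fun c a m => by
  change φ (c • a) • (show L from m) = c • φ a • (show L from m)
  rw [map_smul, smul_assoc]⟩

/-- The identity, as a `k`-linear equivalence. -/
def equiv : Restr φ L ≃ₗ[k] L := LinearEquiv.refl k L

@[simp]
lemma equiv_smul {L : Type u} [AddCommGroup L] [Module k L] [Module S L] (a : R) (m : Restr φ L) : equiv φ L (a • m) = φ a • equiv φ L m := rfl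

end Restr

namespace PolyMod

noncomputable section

open SkewRing (incl neg X)

variable {k : Type u} [Field k] {n : ℕ} (L : Type u) [AddCommGroup L]
  [Module k L] [Module (SkewRing k (n + 1)) L] [IsScalarTower k (SkewRing k (n + 1)) L]

variable (k n) in
/-- The evaluation `m x ^ j ↦ x ^ j • m`. -/
def eval : PolyMod (Restr (incl (k := k) (n := n)) L) →ₗ[SkewRing k (n + 1)] L :=
  extend (Restr.equiv incl L).toLinearMap fun i m => by simp

lemma eval_mono (j : ℕ) (m : Restr (incl (k := k) (n := n)) L) :
    eval k n L (mono k j m) = X k (n + 1) (Fin.last n) ^ j • Restr.equiv incl L m :=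
  extend_mono _ _ j m

lemma eval_surjective : Function.Surjective (eval k n L) := fun m =>
  ⟨mono k 0 ((Restr.equiv incl L).symm m), by rw [eval_mono]; simp⟩

variable (k n) in
/-- Multiplication by the last generator, for different scalars. -/
def mulLast : Restr (incl.comp (neg (k := k) (n := n))) L →ₗ[k] Restr (incl (k := k) (n := n)) L :=
  (Restr.equiv incl L).symm.toLinearMap ∘ₗ Algebra.lsmul k k L (X k (n + 1) (Fin.last n)) ∘ₗ
    (Restr.equiv (incl.comp neg) L).toLinearMap

variable (k n) in
/-- The change of the scalars. -/
def retwist : Restr (incl.comp (neg (k := k) (n := n))) L →ₗ[k] Restr (incl (k := k) (n := n)) L :=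
  (Restr.equiv incl L).symm.toLinearMap ∘ₗ (Restr.equiv (incl.comp neg) L).toLinearMap

omit [IsScalarTower k (SkewRing k (n + 1)) L] in
lemma retwist_X_smul (i : Fin n) (m : Restr (incl.comp (neg (k := k) (n := n))) L) :
    retwist k n L (X k n i • m) = -(X k n i • retwist k n L m) := by
  apply (Restr.equiv incl L).injective
  rw [map_neg, Restr.equiv_smul]
  change (incl (neg (X k n i))) • Restr.equiv (incl.comp neg) L m =
    -(incl (X k n i) • Restr.equiv (incl.comp neg) L m)
  rw [SkewRing.neg_X, map_neg, neg_smul]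

lemma mulLast_X_smul (i : Fin n) (m : Restr (incl.comp (neg (k := k) (n := n))) L) :
    mulLast k n L (X k n i • m) = X k n i • mulLast k n L m := by
  apply (Restr.equiv incl L).injective
  rw [Restr.equiv_smul]
  change X k (n + 1) (Fin.last n) • (incl (neg (X k n i))) • Restr.equiv (incl.comp neg) L m =
    incl (X k n i) • X k (n + 1) (Fin.last n) • Restr.equiv (incl.comp neg) L m
  rw [SkewRing.neg_X, map_neg, SkewRing.incl_X, ← mul_smul, ← mul_smul, mul_neg,
    SkewRing.X_mul_X (Fin.castSucc_lt_last i).ne]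

variable (k n) in
/-- The kernel of the evaluation, as a module of polynomials. -/
def syzygy : PolyMod (Restr (incl.comp (neg (k := k) (n := n))) L) →ₗ[SkewRing k (n + 1)]
    PolyMod (Restr (incl (k := k) (n := n)) L) :=
  -- `m x^j ↦ m x^(j+1) - (x m) x^j`. An earlier generator passes one more `x` in each term, in the
  -- first inside the polynomial and in the second inside `L`. The twist by `neg` on the source
  -- absorbs that sign.
  linearMap (fun j => mono k (j + 1) ∘ₗ retwist k n L - mono k j ∘ₗ mulLast k n L)
    (fun j m => by
      rw [LinearMap.sub_apply, LinearMap.sub_apply, smul_sub]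
      simp only [LinearMap.comp_apply, X_last_smul_mono])
    (fun i j m => by
      rw [LinearMap.sub_apply, LinearMap.sub_apply, smul_sub, smul_sub]
      simp only [LinearMap.comp_apply, X_castSucc_smul_mono]
      rw [retwist_X_smul, mulLast_X_smul, map_neg, pow_succ, mul_neg_one, neg_smul, smul_neg])

lemma syzygy_mono (j : ℕ) (m : Restr (incl.comp (neg (k := k) (n := n))) L) :
    syzygy k n L (mono k j m) = mono k (j + 1) (retwist k n L m) - mono k j (mulLast k n L m) :=
  linearMap_mono _ _ _ j m

lemma coeff_succ_syzygy (j : ℕ) (v : PolyMod (Restr (incl.comp (neg (k := k) (n := n))) L)) :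
    coeff k (j + 1) (syzygy k n L v) =
      retwist k n L (coeff k j v) - mulLast k n L (coeff k (j + 1) v) := by
  have : coeff k (j + 1) ∘ₗ (syzygy k n L).restrictScalars k =
      retwist k n L ∘ₗ coeff k j - mulLast k n L ∘ₗ coeff k (j + 1) := by
    refine hom_ext fun i m => ?_
    simp only [LinearMap.comp_apply, LinearMap.sub_apply, LinearMap.restrictScalars_apply,
      syzygy_mono, map_sub, coeff_mono, add_left_inj]
    congr 1
    split_ifs
    · rfl
    · rw [map_zero]
  exact congrArg (fun f => f v) this

/-- If `v` is in the kernel and its coefficient of degree `j + 1` is zero, so is the one of degree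
`j`. The high coefficients vanish, hence all do by descent. -/
lemma syzygy_injective : Function.Injective (syzygy k n L) := by
  rw [injective_iff_map_eq_zero]
  intro v hv
  obtain ⟨d, hd⟩ := exists_coeff_eq_zero k v
  have step (j : ℕ) (h : coeff k (j + 1) v = 0) : coeff k j v = 0 := by
    have := coeff_succ_syzygy L j v
    rw [hv, h, map_zero, map_zero, sub_zero] at this
    exact this.symm
  refine ext_coeff k fun j => ?_
  rw [map_zero]
  rcases le_total d j with h | h
  · exact hd j h
  · induction h using Nat.decreasingInduction with
    | self => exact hd d le_rfl
    | of_succ j _ ih => exact step j ih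

lemma eval_syzygy (v) : eval k n L (syzygy k n L v) = 0 := by
  have : (eval k n L).restrictScalars k ∘ₗ (syzygy k n L).restrictScalars k = 0 := by
    refine hom_ext fun j m => ?_
    change eval k n L (syzygy k n L _) = 0
    rw [syzygy_mono, map_sub, eval_mono, eval_mono, sub_eq_zero, pow_succ, mul_smul]
    rfl
  exact congrArg (fun f => f v) this

/-- Modulo the range, `m x^(j+1)` equals `(x m) x^j`, so every monomial reduces to the constant
given by its evaluation. -/
lemma mono_sub_mem_range_syzygy (j : ℕ) (m : L) :
    mono k j ((Restr.equiv incl L).symm m) -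
      mono k 0 ((Restr.equiv incl L).symm (X k (n + 1) (Fin.last n) ^ j • m)) ∈
      LinearMap.range (syzygy k n L) := by
  induction j generalizing m with
  | zero => simp
  | succ j ih =>
    have h : mono k (j + 1) ((Restr.equiv incl L).symm m) -
        mono k j ((Restr.equiv incl L).symm (X k (n + 1) (Fin.last n) • m)) ∈
        LinearMap.range (syzygy k n L) :=
      ⟨mono k j ((Restr.equiv (incl.comp neg) L).symm m), syzygy_mono L j _⟩
    have := add_mem h (ih (X k (n + 1) (Fin.last n) • m))
    rwa [sub_add_sub_cancel, ← mul_smul, ← pow_succ] at this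

lemma sub_mem_range_syzygy (v : PolyMod (Restr (incl (k := k) (n := n)) L)) :
    v - mono k 0 ((Restr.equiv incl L).symm (eval k n L v)) ∈
      LinearMap.range (syzygy k n L) := by
  let p := (LinearMap.range (syzygy k n L)).restrictScalars k
  have : p.mkQ ∘ₗ (LinearMap.id - mono k 0 ∘ₗ (Restr.equiv incl L).symm.toLinearMap ∘ₗ
      (eval k n L).restrictScalars k) = 0 := by
    refine hom_ext fun j m => (Submodule.Quotient.mk_eq_zero p).2 ?_
    have := mono_sub_mem_range_syzygy (k := k) (n := n) L j (Restr.equiv incl L m)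
    rw [LinearEquiv.symm_apply_apply, ← eval_mono] at this
    exact this
  exact (Submodule.Quotient.mk_eq_zero p).1 (congrArg (fun f => f v) this)

lemma exact_syzygy_eval : Function.Exact (syzygy k n L) (eval k n L) := by
  intro v
  constructor
  · intro hv
    have := sub_mem_range_syzygy L v
    rw [hv, map_zero, map_zero, sub_zero] at this
    exact this
  · rintro ⟨w, rfl⟩
    exact eval_syzygy L w

end

end PolyMod

namespace SkewRing

variable {k : Type u} [Field k]

/-- The syzygy theorem for the skew polynomial ring in `n` generators. -/
theorem pdLE (n : ℕ) (L : Type u) [AddCommGroup L] [Module k L] [Module (SkewRing k n) L]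
    [IsScalarTower k (SkewRing k n) L] : PdLE (SkewRing k n) L n := by
  induction n generalizing L with
  | zero =>
    rw [pdLE_zero_iff]
    -- Without generators, a `k`-linear section is linear over the whole ring.
    refine Module.Projective.of_lifting_property'' fun f hf => ?_
    obtain ⟨g, hg⟩ := (f.restrictScalars k).exists_rightInverse_of_surjective
      (LinearMap.range_eq_top.2 hf)
    refine ⟨linearMapOfX g fun i => i.elim0, LinearMap.ext fun m => ?_⟩
    exact congrArg (fun h => h m) hg
  | succ n ih =>
    exact PdLE.of_shortExact _ _ (PolyMod.syzygy_injective L) (PolyMod.eval_surjective L)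
      (PolyMod.exact_syzygy_eval L) (PolyMod.pdLE k n _ (ih _))
      (have := PolyMod.pdLE k n _ (ih (Restr (incl (k := k) (n := n)) L))
       hasProjectiveDimensionLT_of_ge _ (n + 1) (n + 2) (by omega))

end SkewRing

end Pertinency
namespace Pertinency

/-! ### Skew group rings -/

/-- The ring `T` is a skew group ring of the group `G` over the ring `S`: it is a free `S`-module
on the elements of `G`, and `g s = φ_g(s) g`. -/
structure SkewGroup (S T G : Type*) [Ring S] [Ring T] [Group G] [Fintype G] where
  f : S →+* T
  u : G →* T
  φ : G → S → S
  u_mul_f : ∀ g s, u g * f s = f (φ g s) * u g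
  c : T →+ (G → S)
  c_f_mul : ∀ s t g, c (f s * t) g = s * c t g
  sum_c : ∀ t, ∑ g, f (c t g) * u g = t
  c_sum : ∀ r : G → S, c (∑ g, f (r g) * u g) = r

namespace SkewGroup

variable {S T : Type u} {G : Type w} [Ring S] [Ring T] [Group G] [Fintype G]
  (D : SkewGroup S T G) [Module S T] [IsScalarTower S T T]

section

variable (hD : ∀ s, D.f s = s • (1 : T))

include hD

lemma smul_eq (s : S) (t : T) : s • t = D.f s * t := by
  rw [hD, smul_mul_assoc, one_mul]

/-- The coordinates. -/
def equivFun : T ≃ₗ[S] (G → S) where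
  toFun := D.c
  map_add' := D.c.map_add
  map_smul' s t := by
    ext g
    rw [D.smul_eq hD, D.c_f_mul]
    rfl
  invFun r := ∑ g, D.f (r g) * D.u g
  left_inv := D.sum_c
  right_inv := D.c_sum

variable {M N : Type u} [AddCommGroup M] [Module S M] [Module T M] [IsScalarTower S T M]
  [AddCommGroup N] [Module S N] [Module T N] [IsScalarTower S T N]

omit [IsScalarTower S T T] in
lemma f_smul (s : S) (m : M) : D.f s • m = s • m := by
  rw [hD, smul_assoc, one_smul]

lemma projective_restrict [Module.Projective T M] : Module.Projective S M := by
  obtain ⟨s, hs⟩ := (Module.projective_def (R := T) (P := M)).1 inferInstance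
  have : Module.Free S T := Module.Free.of_equiv (D.equivFun hD).symm
  exact Module.Projective.of_split (s.restrictScalars S)
    ((Finsupp.linearCombination T (id : M → M)).restrictScalars S) (LinearMap.ext hs)

omit hD [Module S T] [IsScalarTower S T T] in
lemma u_mul_u_inv (g : G) : D.u g * D.u g⁻¹ = 1 := by
  rw [← map_mul, mul_inv_cancel, map_one]

omit hD [Module S T] [IsScalarTower S T T] [IsScalarTower S T M] [IsScalarTower S T N] in
/-- The sum of the conjugates of an `S`-linear map, as an additive map. -/
def averageHom (s : M →ₗ[S] N) : M →+ N where
  toFun m := ∑ g, D.u g • s (D.u g⁻¹ • m)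
  map_zero' := by simp
  map_add' m m' := by
    simp only [smul_add, map_add, Finset.sum_add_distrib]

/-- The sum of the conjugates of an `S`-linear map. -/
def average (s : M →ₗ[S] N) : M →ₗ[T] N where
  toFun := D.averageHom s
  map_add' := map_add _
  map_smul' t m := by
    -- Each summand is already `S`-linear: the twist of `r` by `g⁻¹` is undone by `g`.
    have hf (r : S) (m : M) : D.averageHom s (D.f r • m) = D.f r • D.averageHom s m := by
      change ∑ g, D.u g • s (D.u g⁻¹ • D.f r • m) = D.f r • ∑ g, D.u g • s (D.u g⁻¹ • m)
      rw [Finset.smul_sum]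
      refine Finset.sum_congr rfl fun g _ => ?_
      rw [smul_smul, D.u_mul_f, mul_smul, D.f_smul hD, map_smul, ← D.f_smul hD, smul_smul,
        smul_smul]
      congr 1
      have : D.f (D.φ g⁻¹ r) = D.u g⁻¹ * D.f r * D.u g := by
        rw [D.u_mul_f, mul_assoc, ← map_mul, inv_mul_cancel, map_one, mul_one]
      rw [this, ← mul_assoc, ← mul_assoc, D.u_mul_u_inv, one_mul]
    have hu (h : G) (m : M) : D.averageHom s (D.u h • m) = D.u h • D.averageHom s m := by
      change ∑ g, D.u g • s (D.u g⁻¹ • D.u h • m) = D.u h • ∑ g, D.u g • s (D.u g⁻¹ • m)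
      rw [Finset.smul_sum, ← Equiv.sum_comp (Equiv.mulLeft h)]
      refine Finset.sum_congr rfl fun g _ => ?_
      rw [Equiv.coe_mulLeft, map_mul, mul_smul, smul_smul (D.u (h * g)⁻¹), ← map_mul, mul_inv_rev,
        inv_mul_cancel_right]
    rw [RingHom.id_apply, ← D.sum_c t]
    simp only [Finset.sum_smul, mul_smul, map_sum, hf, hu]

omit [IsScalarTower S T T] in
lemma average_apply (s : M →ₗ[S] N) (m : M) :
    D.average hD s m = ∑ g, D.u g • s (D.u g⁻¹ • m) := rfl

/-- Maschke's argument: average an `S`-linear section over `G` and divide by `|G|`, which is central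
and invertible in `T`. -/
lemma projective_of_restrict (hG : IsUnit (Fintype.card G : T)) [Module.Projective S M] :
    Module.Projective T M := by
  refine Module.Projective.of_lifting_property'' fun f hf => ?_
  obtain ⟨s, hs⟩ := Module.projective_lifting_property (f.restrictScalars S) LinearMap.id hf
  replace hs (m : M) : f (s m) = m := congrArg (fun g => g m) hs
  obtain ⟨r, hr⟩ := hG
  have hcomm (t : T) : (Fintype.card G : T) * t = t * (Fintype.card G : T) :=
    Nat.cast_commute _ t
  have hcomm' (t : T) : ↑r⁻¹ * t = t * ↑r⁻¹ := by
    have := hcomm t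
    rw [← hr] at this
    rw [Units.inv_mul_eq_iff_eq_mul, ← mul_assoc, this, mul_assoc, Units.mul_inv, mul_one]
  refine ⟨{ toFun m := (↑r⁻¹ : T) • D.average hD s m
            map_add' m m' := by rw [map_add, smul_add]
            map_smul' t m := by
              rw [map_smul, smul_smul, hcomm', mul_smul, RingHom.id_apply] }, ?_⟩
  refine LinearMap.ext fun m => ?_
  change f ((↑r⁻¹ : T) • D.average hD s m) = m
  rw [average_apply, map_smul, map_sum]
  simp only [map_smul, hs, smul_smul, D.u_mul_u_inv, one_smul]
  rw [Finset.sum_const, Finset.card_univ, ← Nat.cast_smul_eq_nsmul T, ← hr, smul_smul,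
    Units.inv_mul, one_smul]

/-- Free `T`-modules are projective over `S`, so syzygies over `T` are also syzygies over `S`, and
induction reduces to the projective case. -/
lemma pdLE_of_restrict (hG : IsUnit (Fintype.card G : T)) {n : ℕ} (hM : PdLE S M n) :
    PdLE T M n := by
  induction n generalizing M with
  | zero =>
    rw [pdLE_zero_iff] at hM ⊢
    exact D.projective_of_restrict hD hG
  | succ n ih =>
    have hp := surjective_linearCombination_id T M
    set p := Finsupp.linearCombination T (id : M → M)
    have : Module.Projective S (M →₀ T) := D.projective_restrict hD
    have hK : PdLE S (LinearMap.ker (p.restrictScalars S)) n :=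
      PdLE.ker (p.restrictScalars S) hp hM
    have hK' : PdLE T (LinearMap.ker p) n := ih (M := LinearMap.ker p) hK
    exact PdLE.of_shortExact (LinearMap.ker p).subtype p Subtype.val_injective hp
      (LinearMap.exact_subtype_ker_map p) hK' (pdLE_of_projective _)

end

omit [Module S T] [IsScalarTower S T T] in
include D in
/-- Global dimension does not grow in skew group rings of groups of invertible order. -/
theorem pdLE (hG : IsUnit (Fintype.card G : T)) {n : ℕ}
    (h : ∀ (L : Type u) [AddCommGroup L] [Module S L], PdLE S L n)
    (M : Type u) [AddCommGroup M] [Module T M] : PdLE T M n := by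
  let _ : Module S T := Module.compHom T D.f
  let _ : Module S M := Module.compHom M D.f
  have : IsScalarTower S T T := ⟨fun s t t' => mul_assoc (D.f s) t t'⟩
  have : IsScalarTower S T M := ⟨fun s t m => mul_smul (D.f s) t m⟩
  exact D.pdLE_of_restrict (fun s => (mul_one (D.f s)).symm) hG (h M)

end SkewGroup

end Pertinency
-- Right modules over the smash product.
namespace Pertinency

open MulOpposite

namespace Smash

noncomputable section

variable {R : Type u} {G : Type w} [Ring R] [Group G] [MulSemiringAction G R]

omit [Group G] [MulSemiringAction G R] in
open SkewMonoidAlgebra in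
lemma sum_single_coeff [Fintype G] (a : Smash R G) : ∑ g, single g (a.coeff g) = a := by
  classical
  refine SkewMonoidAlgebra.ext fun h => ?_
  have : (∑ g, single g (a.coeff g)).coeff h = ∑ g, (single g (a.coeff g)).coeff h :=
    map_sum ((Finsupp.applyAddHom h).comp coeffAddEquiv.toAddMonoidHom) _ _
  rw [this]
  simp [Finsupp.single_apply]

omit [Group G] [MulSemiringAction G R] in
open SkewMonoidAlgebra in
lemma coeff_sum_single [Fintype G] (r : G → R) (h : G) : (∑ g, single g (r g)).coeff h = r h := by
  classical
  have : (∑ g, single g (r g)).coeff h = ∑ g, (single g (r g)).coeff h :=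
    map_sum ((Finsupp.applyAddHom h).comp coeffAddEquiv.toAddMonoidHom) _ _
  rw [this]
  simp [Finsupp.single_apply]

open SkewMonoidAlgebra in
/-- The group elements in the opposite of the smash product. -/
def opUnit : G →* (Smash R G)ᵐᵒᵖ where
  -- The inverse compensates the reversed multiplication of the opposite ring.
  toFun g := op (single g⁻¹ 1)
  map_one' := by rw [inv_one, single_one_one, op_one]
  map_mul' g h := by
    rw [← op_mul, single_mul_single, mul_inv_rev, smul_one, mul_one]

/-- The coefficients of elements of the smash product, written on the left of the group. -/
def opCoeff : (Smash R G)ᵐᵒᵖ →+ (G → Rᵐᵒᵖ) where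
  toFun t g := op (g • t.unop.coeff g⁻¹)
  map_zero' := by ext; simp
  map_add' s t := by
    ext g
    change op (g • (s.unop + t.unop).coeff g⁻¹) =
      op (g • s.unop.coeff g⁻¹ + g • t.unop.coeff g⁻¹)
    rw [← smul_add, SkewMonoidAlgebra.coeff_add, Finsupp.add_apply]

open SkewMonoidAlgebra in
lemma op_mul_opUnit (r : R) (g : G) :
    RingHom.op (singleOneRingHom (k := R) (G := G)) (op r) * opUnit g =
      op (single g⁻¹ (g⁻¹ • r)) := by
  change op (single g⁻¹ 1 * single 1 r) = _
  rw [single_mul_single, mul_one, one_mul]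

variable (R G) in
open SkewMonoidAlgebra in
/-- The opposite of the smash product is a skew group ring. -/
def skewGroupOp [Fintype G] : SkewGroup Rᵐᵒᵖ (Smash R G)ᵐᵒᵖ G where
  f := RingHom.op (singleOneRingHom (k := R) (G := G))
  u := opUnit
  φ g s := op (g • s.unop)
  u_mul_f g s := by
    rw [op_mul_opUnit, inv_smul_smul]
    change op (single 1 s.unop * single g⁻¹ 1) = _
    rw [single_mul_single, smul_one, mul_one, one_mul]
  c := opCoeff
  c_f_mul s t g := by
    change op (g • (t.unop * single 1 s.unop).coeff g⁻¹) = _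
    rw [coeff_mul_single_one, smul_mul', smul_inv_smul]
    rfl
  sum_c t := by
    conv_rhs => rw [← op_unop t, ← sum_single_coeff t.unop, ← Equiv.sum_comp (Equiv.inv G)]
    rw [Finset.op_sum]
    refine Finset.sum_congr rfl fun g _ => ?_
    change _ * opUnit g = _
    rw [← op_unop (opCoeff t g), op_mul_opUnit]
    change op (single g⁻¹ (g⁻¹ • g • _)) = _
    rw [inv_smul_smul]
    rfl
  c_sum r := by
    have (g : G) : RingHom.op (singleOneRingHom (k := R) (G := G)) (r g) * opUnit g =
        op (single g⁻¹ (g⁻¹ • (r g).unop)) := op_mul_opUnit _ _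
    simp only [this]
    rw [← Finset.op_sum, ← Equiv.sum_comp (Equiv.inv G)]
    ext g
    change op (g • (∑ h : G, single (h⁻¹)⁻¹ ((h⁻¹)⁻¹ • (r h⁻¹).unop)).coeff g⁻¹) = _
    simp only [inv_inv]
    rw [coeff_sum_single, inv_inv, smul_inv_smul, op_unop]

end

end Smash

namespace SkewRing

noncomputable section

variable (k : Type u) [Field k] (n : ℕ)

/-- The involution of the skew polynomial ring that fixes the generators. -/
def opHom : SkewRing k n →ₐ[k] (SkewRing k n)ᵐᵒᵖ :=
  lift (fun i => op (X k n i)) fun i j h => by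
    rw [← op_mul, ← op_mul, ← MulOpposite.op_neg, X_mul_X h.symm]

@[simp] lemma opHom_X (i : Fin n) : opHom k n (X k n i) = op (X k n i) := lift_X ..

lemma opHom_opHom (a : SkewRing k n) : (opHom k n (opHom k n a).unop).unop = a := by
  induction a using induction_X with
  | hk c => rw [AlgHom.commutes, MulOpposite.algebraMap_apply, unop_op, AlgHom.commutes,
      MulOpposite.algebraMap_apply, unop_op]
  | hX i => simp
  | hadd a b h h' => rw [map_add, MulOpposite.unop_add, map_add, MulOpposite.unop_add, h, h']
  | hmul a b h h' => rw [map_mul, unop_mul, map_mul, unop_mul, h, h']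

/-- The skew polynomial ring is isomorphic to its opposite ring. -/
def opEquiv : SkewRing k n ≃ₐ[k] (SkewRing k n)ᵐᵒᵖ where
  __ := opHom k n
  invFun a := (opHom k n a.unop).unop
  left_inv := opHom_opHom k n
  right_inv a := unop_injective (opHom_opHom k n a.unop)

end

end SkewRing

/-- The syzygy theorem for right modules over the skew polynomial ring. -/
theorem SkewPoly.pdLE_op (k : Type u) [Field k] (n : ℕ) (L : Type u) [AddCommGroup L]
    [Module (SkewPoly k n)ᵐᵒᵖ L] : PdLE (SkewPoly k n)ᵐᵒᵖ L n := by
  let e : SkewRing k n ≃+* (SkewPoly k n)ᵐᵒᵖ := (SkewRing.opEquiv k n).toRingEquiv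
  let _ : Module (SkewRing k n) L := Module.compHom L e.toRingHom
  let _ : Module k L := Module.compHom L (algebraMap k (SkewRing k n))
  have : IsScalarTower k (SkewRing k n) L := .of_algebraMap_smul fun _ _ => rfl
  exact PdLE.of_semilinear e (AddEquiv.refl L) (fun _ _ => rfl) (SkewRing.pdLE n L)

/-- The global dimension of the smash product of the skew polynomial ring with a finite group whose
order is invertible. -/
theorem SkewPoly.pdLE_smash_op (k : Type u) [Field k] (n : ℕ) (G : Type u) [Group G] [Fintype G]
    [MulSemiringAction G (SkewPoly k n)] (hG : (Fintype.card G : k) ≠ 0) (M : Type u)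
    [AddCommGroup M] [Module (Smash (SkewPoly k n) G)ᵐᵒᵖ M] :
    PdLE (Smash (SkewPoly k n) G)ᵐᵒᵖ M n := by
  refine (Smash.skewGroupOp (SkewPoly k n) G).pdLE ?_ (SkewPoly.pdLE_op k n) M
  have := (isUnit_iff_ne_zero.2 hG).map ((RingHom.op (SkewMonoidAlgebra.singleOneRingHom
    (k := SkewPoly k n) (G := G))).comp (algebraMap k (SkewPoly k n)ᵐᵒᵖ))
  rwa [map_natCast] at this

end Pertinency
namespace Pertinency

namespace GrMod

noncomputable section

variable {k : Type u} [Field k] {B : Type u} [Ring B] [Algebra k B] {ℬ : ℕ → Submodule k B}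

/-! ### Projective graded modules -/

section DegreeZero

variable {M N : GrMod k ℬ}

/-- The part of degree zero of a linear map between graded modules, as a map over the base. -/
def degZeroBase (h : M.carrier →ₗ[Bᵐᵒᵖ] N.carrier) : M.carrier →ₗ[k] N.carrier :=
  DirectSum.toModule k ℤ N.carrier
      (fun i => N.comp i ∘ₗ h.restrictScalars k ∘ₗ (M.deg i).subtype) ∘ₗ
    (DirectSum.decomposeLinearEquiv M.deg).toLinearMap

lemma degZeroBase_of_mem (h : M.carrier →ₗ[Bᵐᵒᵖ] N.carrier) {i : ℤ} {m : M.carrier}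
    (hm : m ∈ M.deg i) : degZeroBase h m = N.comp i (h m) := by
  change DirectSum.toModule k ℤ N.carrier _ (DirectSum.decompose M.deg m) = _
  rw [DirectSum.decompose_of_mem _ hm]
  exact DirectSum.toModule_lof k (M := fun i => M.deg i) i ⟨m, hm⟩

/-- The part of degree zero of a linear map between graded modules. -/
def degZero (hB : ⨆ i, ℬ i = ⊤) (h : M.carrier →ₗ[Bᵐᵒᵖ] N.carrier) : M ⟶ N where
  toLinearMap :=
    { degZeroBase h with
      map_smul' b m := by
        change degZeroBase h (b • m) = b • degZeroBase h m
        induction m using induction_homogeneous with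
        | h0 => simp
        | ha m m' hm hm' => rw [smul_add, map_add, hm, hm', map_add, smul_add]
        | hh i m hm =>
          obtain ⟨b, rfl⟩ := MulOpposite.op_surjective b
          have hb : b ∈ ⨆ i, ℬ i := hB ▸ Submodule.mem_top
          induction hb using Submodule.iSup_induction' with
          | zero => simp
          | add x y _ _ hx hy =>
            rw [MulOpposite.op_add, add_smul, map_add, hx, hy, add_smul]
          | mem j x hx =>
            rw [degZeroBase_of_mem h (M.smul_mem j i x m hx hm), degZeroBase_of_mem h hm, map_smul,
              comp_smul _ j hx, add_sub_cancel_right] }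
  map_mem i m hm := by
    change degZeroBase h m ∈ _
    rw [degZeroBase_of_mem h hm]
    exact comp_mem _ _

lemma lin_degZero (hB : ⨆ i, ℬ i = ⊤) (h : M.carrier →ₗ[Bᵐᵒᵖ] N.carrier) {i : ℤ} {m : M.carrier}
    (hm : m ∈ M.deg i) : lin (degZero hB h) m = N.comp i (h m) :=
  degZeroBase_of_mem h hm

end DegreeZero

/-- The degree zero part of an ungraded lift is a graded lift. -/
lemma projective_of_projective [IsNoetherianRing Bᵐᵒᵖ] (hB : ⨆ i, ℬ i = ⊤) (P : GrMod k ℬ)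
    [Module.Projective Bᵐᵒᵖ P.carrier] : Projective P where
  factors {E X} f e he := by
    obtain ⟨h, hh⟩ := Module.projective_lifting_property (lin e) (lin f)
      ((epi_iff_surjective e).1 he)
    refine ⟨degZero hB h, hom_ext fun m => ?_⟩
    induction m using induction_homogeneous with
    | h0 => simp
    | ha m m' hm hm' => rw [map_add, hm, hm', map_add]
    | hh i m hm =>
      change lin e (lin (degZero hB h) m) = lin f m
      rw [lin_degZero hB h hm, lin_comp_apply]
      change X.comp i ((lin e ∘ₗ h) m) = _
      rw [hh, comp_same (lin_mem f hm)]

/-! ### Free graded modules -/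

section Shift

/-- The grading by the integers defined by a grading by the natural numbers. -/
def intGrading (ℬ : ℕ → Submodule k B) : ℤ → Submodule k B
  | .ofNat j => ℬ j
  | .negSucc _ => ⊥

lemma isInternal_intGrading (hB : DirectSum.IsInternal ℬ) (d : ℤ) :
    DirectSum.IsInternal fun i => intGrading ℬ (i - d) := by
  let _ := hB.chooseDecomposition
  let c (i : ℕ) : B →ₗ[k] B := (ℬ i).subtype ∘ₗ DirectSum.component k ℕ _ i ∘ₗ
    (DirectSum.decomposeLinearEquiv ℬ).toLinearMap
  let c' : ℤ → B →ₗ[k] B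
    | .ofNat j => c j
    | .negSucc _ => 0
  refine isInternal_of_projections _ (fun i => c' (i - d)) ?_ ?_ ?_
  · intro i v hv
    change v ∈ intGrading ℬ (i - d) at hv
    change c' (i - d) v = v
    generalize i - d = j at hv ⊢
    cases j with
    | ofNat j => exact DirectSum.decompose_of_mem_same ℬ hv
    | negSucc j => exact ((Submodule.mem_bot k).1 hv) ▸ map_zero _
  · intro i j v hv hij
    change v ∈ intGrading ℬ (i - d) at hv
    change c' (j - d) v = 0
    replace hij : j - d ≠ i - d := fun h => hij (by omega)
    generalize i - d = i at hv hij ⊢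
    generalize j - d = j at hij ⊢
    cases j with
    | ofNat j =>
      cases i with
      | ofNat i => exact DirectSum.decompose_of_mem_ne ℬ hv fun e => hij (congrArg _ e.symm)
      | negSucc i =>
        rw [show v = 0 from hv, map_zero]
    | negSucc j => rfl
  · intro v
    have hv : v ∈ ⨆ i, ℬ i := hB.submodule_iSup_eq_top ▸ Submodule.mem_top
    refine (iSup_le fun j => ?_ : ⨆ i, ℬ i ≤ _) hv
    refine le_trans (le_of_eq ?_) (le_iSup _ ((j : ℤ) + d))
    rw [add_sub_cancel_right]
    rfl

variable [SetLike.GradedMonoid ℬ]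

/-- The free graded module of rank one with a generator in degree `d`. -/
def shift (hB : DirectSum.IsInternal ℬ) (d : ℤ) : GrMod k ℬ where
  carrier := B
  deg i := intGrading ℬ (i - d)
  isInternal := isInternal_intGrading hB d
  smul_mem i j b m hb hm := by
    have h : j + i - d = (j - d) + i := by omega
    rw [h]
    generalize j - d = j at hm
    cases j with
    | ofNat j => exact SetLike.mul_mem_graded (A := ℬ) hm hb
    | negSucc j =>
      rw [show m = 0 from hm, smul_zero]
      exact zero_mem _
  finite := ⟨⟨{1}, eq_top_iff.2 fun b _ => by
    have : b = MulOpposite.op b • (1 : B) := (one_mul b).symm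
    rw [this]
    exact Submodule.smul_mem _ _ (Submodule.subset_span (by simp))⟩⟩

omit [SetLike.GradedMonoid ℬ] in
lemma op_smul_mem_deg {M : GrMod k ℬ} {d i : ℤ} {x : M.carrier} (hx : x ∈ M.deg d) {b : B}
    (hb : b ∈ intGrading ℬ i) : MulOpposite.op b • x ∈ M.deg (d + i) := by
  cases i with
  | ofNat j => exact M.smul_mem j d b x hb hx
  | negSucc j =>
    rw [show b = 0 from hb, MulOpposite.op_zero, zero_smul]
    exact zero_mem _

omit [SetLike.GradedMonoid ℬ] in
/-- The map from `B` given by an element of a right module. -/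
def rightSMul {M : GrMod k ℬ} (x : M.carrier) : B →ₗ[Bᵐᵒᵖ] M.carrier where
  toFun b := MulOpposite.op b • x
  map_add' b c := by rw [MulOpposite.op_add, add_smul]
  map_smul' b c := by
    rw [RingHom.id_apply, smul_smul]
    rfl

/-- The morphism from a free graded module of rank one given by a homogeneous element. -/
def shiftDesc (hB : DirectSum.IsInternal ℬ) {M : GrMod k ℬ} {d : ℤ} {x : M.carrier}
    (hx : x ∈ M.deg d) : shift hB d ⟶ M where
  toLinearMap := rightSMul x
  map_mem i b hb := by
    have h : i = d + (i - d) := by omega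
    rw [h]
    exact op_smul_mem_deg hx hb

lemma shiftDesc_one (hB : DirectSum.IsInternal ℬ) {M : GrMod k ℬ} {d : ℤ} {x : M.carrier}
    (hx : x ∈ M.deg d) : lin (shiftDesc hB hx) (1 : B) = x :=
  one_smul Bᵐᵒᵖ x

/-- Finitely many homogeneous elements generate `M`, and a sum of shifts of `B` maps onto it. Its
carrier is free over `B`, so the kernel is a syzygy in the graded and in the ungraded sense. -/
lemma exists_projective_cover [IsNoetherianRing Bᵐᵒᵖ] (hB : DirectSum.IsInternal ℬ)
    (M : GrMod k ℬ) : ∃ (F : GrMod k ℬ) (f : F ⟶ M), Module.Projective Bᵐᵒᵖ F.carrier ∧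
      Function.Surjective (lin f) := by
  classical
  let H : Set M.carrier := {m | ∃ i, m ∈ M.deg i}
  have hH : Submodule.span Bᵐᵒᵖ H = ⊤ := by
    refine eq_top_iff.2 fun m _ => ?_
    induction m using induction_homogeneous with
    | h0 => exact zero_mem _
    | ha m m' hm hm' => exact add_mem (hm trivial) (hm' trivial)
    | hh i m hm => exact Submodule.subset_span ⟨i, hm⟩
  have hfg : (Submodule.span Bᵐᵒᵖ H).FG := hH ▸ M.finite.1
  obtain ⟨s, hs, hspan⟩ := (Submodule.fg_span_iff_fg_span_finset_subset H).1 hfg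
  rw [hH] at hspan
  let x (j : Fin s.card) : M.carrier := s.equivFin.symm j
  choose d hd using fun j : Fin s.card => hs (s.equivFin.symm j).2
  let F : GrMod k ℬ := pi fun j => shift hB (d j)
  have hF : Module.Projective Bᵐᵒᵖ F.carrier := by
    let e : Bᵐᵒᵖ ≃ₗ[Bᵐᵒᵖ] B :=
      { MulOpposite.opAddEquiv.symm with map_smul' := fun _ _ => rfl }
    have : Module.Free Bᵐᵒᵖ B := Module.Free.of_equiv e
    exact inferInstanceAs (Module.Projective Bᵐᵒᵖ (Fin s.card → B))
  let f : F ⟶ M := ∑ j, piProj (fun j => shift hB (d j)) j ≫ shiftDesc hB (hd j)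
  have hf (v : F.carrier) : lin f v = ∑ j, lin (shiftDesc hB (hd j)) (v j) := by
    let L : (F ⟶ M) →+ M.carrier :=
      { toFun g := lin g v
        map_zero' := rfl
        map_add' _ _ := rfl }
    exact map_sum L _ _
  refine ⟨F, f, hF, ?_⟩
  rw [← LinearMap.range_eq_top, eq_top_iff, hspan, Submodule.span_le]
  intro m hm
  let j := s.equivFin ⟨m, hm⟩
  let v : Fin s.card → B := Pi.single j 1
  have hv (i : Fin s.card) (hi : i ≠ j) : v i = 0 := Pi.single_eq_of_ne hi 1
  have hv' : v j = 1 := Pi.single_eq_same j 1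
  refine ⟨v, (hf v).trans ((Finset.sum_eq_single j (fun i _ hi => ?_) ?_).trans ?_)⟩
  · exact (congrArg _ (hv i hi)).trans (map_zero _)
  · simp
  · refine (congrArg _ hv').trans ((shiftDesc_one hB (hd j)).trans ?_)
    simp [j]

end Shift

/-- The projective dimension in `gr B` is at most the one over `B`. -/
theorem hasProjectiveDimensionLE [SetLike.GradedMonoid ℬ] [IsNoetherianRing Bᵐᵒᵖ]
    (hB : DirectSum.IsInternal ℬ) (M : GrMod k ℬ) (n : ℕ) (hM : PdLE Bᵐᵒᵖ M.carrier n) :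
    HasProjectiveDimensionLE M n := by
  have htop := hB.submodule_iSup_eq_top
  induction n generalizing M with
  | zero =>
    have := pdLE_zero_iff.1 hM
    exact (projective_iff_hasProjectiveDimensionLE_zero _).1 (projective_of_projective htop M)
  | succ n ih =>
    obtain ⟨F, f, hF, hf⟩ := exists_projective_cover hB M
    have : Projective F := projective_of_projective htop F
    have hK := ih (ker f) (PdLE.ker (lin f) hf hM)
    exact (shortExact_ker f hf).hasProjectiveDimensionLT_X₃ (n + 1) hK
      (hasProjectiveDimensionLT_of_ge F 1 (n + 2) (by omega))

end

end GrMod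

end Pertinency
namespace Pertinency

/-! ### Ideals of a smash product and their intersection with a central subring -/

section Anticommuting

lemma sum_mul_sum_of_anticommute {R ι : Type*} [Ring R] (s : Finset ι) (f : ι → R)
    (h : ∀ a ∈ s, ∀ b ∈ s, a ≠ b → f a * f b = -(f b * f a)) :
    (∑ a ∈ s, f a) * ∑ a ∈ s, f a = ∑ a ∈ s, f a * f a := by
  classical
  induction s using Finset.induction_on with
  | empty => simp
  | insert a s ha ih =>
    have h' : f a * ∑ b ∈ s, f b = -((∑ b ∈ s, f b) * f a) := by
      rw [Finset.mul_sum, Finset.sum_mul, ← Finset.sum_neg_distrib]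
      refine Finset.sum_congr rfl fun b hb => h a (by simp) b (by simp [hb]) ?_
      rintro rfl
      exact ha hb
    have ih := ih fun b hb c hc => h b (by simp [hb]) c (by simp [hc])
    rw [Finset.sum_insert ha, Finset.sum_insert ha, ← ih, add_mul, mul_add, mul_add, h']
    abel

end Anticommuting

namespace Smash

noncomputable section

open SkewMonoidAlgebra MvPolynomial

variable {k : Type*} [Field k] {ι R G : Type*} [Ring R] [Group G] [Fintype G]
  [MulSemiringAction G R] [MulAction G ι] (φ : MvPolynomial ι k →+* R)

/-- The element of the smash product with given coefficients in a central polynomial ring. -/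
def ofCoeffs (W : G → MvPolynomial ι k) : Smash R G := ∑ g, single g (φ (W g))

omit [Group G] [MulSemiringAction G R] [MulAction G ι] in
lemma ofCoeffs_add (W W' : G → MvPolynomial ι k) :
    ofCoeffs φ (W + W') = ofCoeffs φ W + ofCoeffs φ W' := by
  simp only [ofCoeffs, Pi.add_apply, map_add, single_add, Finset.sum_add_distrib]

omit [MulAction G ι] in
lemma single_mul_ofCoeffs (f : MvPolynomial ι k) (W : G → MvPolynomial ι k) :
    single 1 (φ f) * ofCoeffs φ W = ofCoeffs φ fun g => f * W g := by
  simp only [ofCoeffs, Finset.mul_sum, single_mul_single, one_mul, one_smul, map_mul]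

lemma ofCoeffs_mul_single (hφ : ∀ (g : G) f, g • φ f = φ (rename (g • ·) f))
    (f : MvPolynomial ι k) (W : G → MvPolynomial ι k) :
    ofCoeffs φ W * single 1 (φ f) = ofCoeffs φ fun g => W g * rename (g • ·) f := by
  simp only [ofCoeffs, Finset.sum_mul, single_mul_single, mul_one, hφ, map_mul]

variable (I : TwoSidedIdeal (Smash R G))

/-- The coefficients at `1` of the elements of an ideal of the smash product that are supported on
a subgroup and have coefficients in a central polynomial ring. -/
def coeffIdeal (H : Subgroup G) : Ideal (MvPolynomial ι k) where
  carrier := {f | ∃ W : G → MvPolynomial ι k, W 1 = f ∧ (∀ g ∉ H, W g = 0) ∧ ofCoeffs φ W ∈ I}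
  zero_mem' := ⟨0, rfl, fun _ _ => rfl, by
    have : ofCoeffs φ (0 : G → MvPolynomial ι k) = 0 := by simp [ofCoeffs]
    rw [this]
    exact I.zero_mem⟩
  add_mem' := by
    rintro _ _ ⟨W, rfl, hW, hI⟩ ⟨W', rfl, hW', hI'⟩
    refine ⟨W + W', rfl, fun g hg => by simp [hW g hg, hW' g hg], ?_⟩
    rw [ofCoeffs_add]
    exact I.add_mem hI hI'
  smul_mem' := by
    rintro f _ ⟨W, rfl, hW, hI⟩
    refine ⟨fun g => f * W g, rfl, fun g hg => by simp [hW g hg], ?_⟩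
    rw [← single_mul_ofCoeffs]
    exact I.mul_mem_left _ _ hI

variable {φ I} {H K : Subgroup G}

omit [MulAction G ι] in
lemma single_mem_of_mem_coeffIdeal_bot {f : MvPolynomial ι k} (hf : f ∈ coeffIdeal φ I ⊥) :
    single 1 (φ f) ∈ I := by
  obtain ⟨W, rfl, hW, hI⟩ := hf
  convert hI using 1
  rw [ofCoeffs, Finset.sum_eq_single 1]
  · intro g _ hg
    rw [hW g (by simpa using hg), map_zero, single_zero]
  · simp

omit [MulAction G ι] in
lemma one_mem_coeffIdeal_top (h : ∑ g : G, single g (1 : R) ∈ I) :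
    (1 : MvPolynomial ι k) ∈ coeffIdeal φ I ⊤ :=
  ⟨1, rfl, fun g hg => (hg trivial).elim, by simpa [ofCoeffs] using h⟩

omit [MulAction G ι] in
-- For `w` with coefficients `w_g`, the element `v w v + N w` has coefficient `w_g (v (g • v) + N)`
-- at `g`. This is `2 N w_g` where `g` fixes `v`, and `0` where `g` negates it.
lemma mul_mem_coeffIdeal_of_neg (hc : ∀ f r, φ f * r = r * φ f) {v : R} {N : MvPolynomial ι k}
    (hv : v * v = φ N)
    (hK : ∀ g ∈ K, g • v = v) (hH : ∀ g ∈ H, g ∉ K → g • v = -v) {f : MvPolynomial ι k}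
    (hf : f ∈ coeffIdeal φ I H) : 2 * N * f ∈ coeffIdeal φ I K := by
  classical
  obtain ⟨W, rfl, hW, hI⟩ := hf
  refine ⟨fun g => if g ∈ K then 2 * N * W g else 0, by simp [K.one_mem],
    fun g hg => if_neg hg, ?_⟩
  have key : ofCoeffs φ (fun g => if g ∈ K then 2 * N * W g else 0) =
      single 1 v * ofCoeffs φ W * single 1 v + single 1 (φ N) * ofCoeffs φ W := by
    simp only [ofCoeffs, Finset.mul_sum, Finset.sum_mul, ← Finset.sum_add_distrib]
    refine Finset.sum_congr rfl fun g _ => ?_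
    rw [single_mul_single, single_mul_single, single_mul_single, one_smul, one_mul,
      mul_one, ← single_add]
    congr 1
    by_cases hg : g ∈ K
    · rw [if_pos hg, hK g hg, ← hc (W g) v, mul_assoc (φ (W g)), hv, hc (W g) (φ N)]
      simp only [map_mul, map_ofNat]
      rw [mul_assoc, two_mul]
    · rw [if_neg hg, map_zero]
      by_cases hg' : g ∈ H
      · rw [hH g hg' hg, ← hc (W g) v, mul_assoc (φ (W g)), mul_neg, hv, mul_neg, hc (W g) (φ N),
          neg_add_cancel]
      · rw [hW g hg', map_zero, mul_zero, zero_mul, mul_zero, zero_add]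
  rw [key]
  exact I.add_mem (I.mul_mem_right _ _ (I.mul_mem_left _ _ hI)) (I.mul_mem_left _ _ hI)

/-- The operation `w ↦ X_a w - w X_{g⁻¹a}` preserves the ideal and multiplies the coefficient at `h`
by `X_a - X_{h g⁻¹ a}`. This factor vanishes at `h = g`, so running over `T` erases the coefficients
on `T`. -/
lemma ofCoeffs_prod_mem (hφ : ∀ (g : G) f, g • φ f = φ (rename (g • ·) f)) {W : G → MvPolynomial ι k}
    (hW : ofCoeffs φ W ∈ I) (T : Finset G) (a : G → ι) :
    ofCoeffs φ (fun h => (∏ g ∈ T, (X (a g) - X (h • g⁻¹ • a g))) * W h) ∈ I := by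
  classical
  induction T using Finset.induction_on with
  | empty => simpa using hW
  | insert g T hg ih =>
    have key : ofCoeffs φ (fun h => (∏ g ∈ insert g T, (X (a g) - X (h • g⁻¹ • a g))) * W h) =
        single 1 (φ (X (a g))) *
          ofCoeffs φ (fun h => (∏ g ∈ T, (X (a g) - X (h • g⁻¹ • a g))) * W h) -
        ofCoeffs φ (fun h => (∏ g ∈ T, (X (a g) - X (h • g⁻¹ • a g))) * W h) *
          single 1 (φ (X (g⁻¹ • a g))) := by
      rw [single_mul_ofCoeffs, ofCoeffs_mul_single φ hφ, eq_sub_iff_add_eq, ← ofCoeffs_add]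
      congr 1
      ext1 h
      rw [Pi.add_apply, Finset.prod_insert hg, rename_X]
      ring
    rw [key]
    exact I.sub_mem (I.mul_mem_left _ _ ih) (I.mul_mem_right _ _ ih)

lemma prod_mul_mem_coeffIdeal (hφ : ∀ (g : G) f, g • φ f = φ (rename (g • ·) f)) {f : MvPolynomial ι k}
    (hf : f ∈ coeffIdeal φ I H) (T : Finset G) (hT : ∀ g ∈ H, g ∉ K → g ∈ T) (a : G → ι) :
    (∏ g ∈ T, (X (a g) - X (g⁻¹ • a g))) * f ∈ coeffIdeal φ I K := by
  obtain ⟨W, rfl, hW, hI⟩ := hf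
  refine ⟨_, by simp, fun h hh => ?_, ofCoeffs_prod_mem hφ hI T a⟩
  by_cases hh' : h ∈ H
  · rw [Finset.prod_eq_zero (hT h hh' hh) (by rw [smul_inv_smul, sub_self]), zero_mul]
  · rw [hW h hh', mul_zero]

end

end Smash

end Pertinency
-- Primes over the coefficient ideals, along the chain of subgroups of a cyclic `2`-group.
namespace Pertinency

namespace Smash

noncomputable section

open SkewMonoidAlgebra MvPolynomial

variable {k : Type*} [Field k] {ι R G : Type*} [Ring R] [Group G] [Fintype G]
  [MulSemiringAction G R] [MulAction G ι] {φ : MvPolynomial ι k →+* R}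
  {I : TwoSidedIdeal (Smash R G)}

section Alternating

omit [Fintype G] in
variable (x : ι → R) (s : G) (i : ι) in
/-- The alternating sum of the generators along an orbit. -/
def alternating (M : ℕ) : R := ∑ t ∈ Finset.range M, (-1) ^ t * x (s ^ t • i)

variable {x : ι → R} {s : G} {i : ι} {M : ℕ}

omit [Fintype G] in
-- Acting by `s` shifts the index by one. The term that wraps around has the right sign because `M`
-- is even.
lemma smul_alternating (hgx : ∀ (g : G) i, g • x i = x (g • i)) (hM : Even M) (hs : s ^ M = 1) :
    s • alternating x s i M = -alternating x s i M := by
  have h : s • alternating x s i M = -∑ t ∈ Finset.range M, (-1) ^ (t + 1) * x (s ^ (t + 1) • i) := by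
    rw [alternating, Finset.smul_sum, ← Finset.sum_neg_distrib]
    refine Finset.sum_congr rfl fun t _ => ?_
    rw [smul_mul', smul_pow', smul_neg, smul_one, hgx, smul_smul, ← pow_succ', pow_succ (-1 : R),
      mul_neg_one, neg_mul, neg_neg]
  have h₁ := Finset.sum_range_succ (fun t => (-1 : R) ^ t * x (s ^ t • i)) M
  rw [Finset.sum_range_succ', hM.neg_one_pow, hs, pow_zero, pow_zero, add_left_inj] at h₁
  rw [h, h₁, alternating]

omit [Fintype G] [MulSemiringAction G R] in
-- The points `s ^ t • i` are distinct, so the cross terms anticommute and cancel; the signs square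
-- to `1`.
lemma alternating_mul_self (hx : ∀ i j, i ≠ j → x i * x j = -(x j * x i))
    (hφx : ∀ i, φ (X i) = x i * x i)
    (hinj : ∀ a < M, ∀ b < M, s ^ a • i = s ^ b • i → a = b) :
    alternating x s i M * alternating x s i M = φ (∑ t ∈ Finset.range M, X (s ^ t • i)) := by
  have hneg (t : ℕ) (r : R) : r * (-1) ^ t = (-1) ^ t * r :=
    ((Commute.neg_one_left r).pow_left t).symm
  rw [alternating, sum_mul_sum_of_anticommute, _root_.map_sum]
  · refine Finset.sum_congr rfl fun t _ => ?_
    rw [hφx, mul_assoc, ← mul_assoc (x _), hneg, mul_assoc, ← mul_assoc, ← pow_add, ← two_mul,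
      pow_mul, neg_one_sq, one_pow, one_mul]
  · intro a ha b hb hab
    rw [Finset.mem_range] at ha hb
    have h := hx (s ^ a • i) (s ^ b • i) fun e => hab (hinj a ha b hb e)
    rw [mul_assoc, ← mul_assoc (x _), hneg, mul_assoc, h, mul_assoc, ← mul_assoc (x (s ^ b • i)),
      hneg, mul_assoc, mul_neg, mul_neg, ← mul_assoc, hneg b ((-1) ^ a), mul_assoc]

end Alternating

section Prime

variable {x : ι → R} (hx : ∀ i j, i ≠ j → x i * x j = -(x j * x i))
  (hgx : ∀ (g : G) i, g • x i = x (g • i)) (hφx : ∀ i, φ (X i) = x i * x i)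
  (hc : ∀ f r, φ f * r = r * φ f) (hφ : ∀ (g : G) f, g • φ f = φ (rename (g • ·) f))

include hφ in
-- Otherwise pick for each `g` a point `a g` with difference outside `Q`. The product of these
-- differences with an `f ∉ Q` from the ideal of `H` lies in the ideal of `K`, hence in `Q`, against
-- primality.
lemma exists_X_sub_X_mem [Nonempty ι] {H K : Subgroup G} {Q : Ideal (MvPolynomial ι k)} [Q.IsPrime]
    (hQ : coeffIdeal φ I K ≤ Q) (hQ' : ¬coeffIdeal φ I H ≤ Q) :
    ∃ g ∈ H, g ∉ K ∧ ∀ a, (X a - X (g⁻¹ • a) : MvPolynomial ι k) ∈ Q := by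
  classical
  obtain ⟨f, hf, hfQ⟩ := Set.not_subset.1 hQ'
  by_contra! h
  choose! a ha using h
  let T := Finset.univ.filter fun g => g ∈ H ∧ g ∉ K
  have h₁ := hQ (prod_mul_mem_coeffIdeal (K := K) hφ hf T (fun g hg hg' => by simp [T, hg, hg']) a)
  rcases Ideal.IsPrime.mem_or_mem ‹_› h₁ with h₂ | h₂
  · obtain ⟨g, hg, hgQ⟩ := (Ideal.IsPrime.prod_mem_iff).1 h₂
    simp only [T, Finset.mem_filter] at hg
    exact ha g hg.2.1 hg.2.2 hgQ
  · exact hfQ h₂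

include hx hgx hφx hc hφ in
-- One step of the chain. Removing `⟨s⟩ \ ⟨s²⟩` by differences of variables shows that `X` is
-- constant on `s`-orbits modulo `Q`; removing it by the alternating sum shows that the orbit sum
-- lies in `Q`. Together they put `2 ^ (e + 1) X_i` in `Q`.
lemma X_mem_of_coeffIdeal_le {s : G} {e : ℕ} (hs : s ^ (2 ^ (e + 1)) = 1)
    (hinj : ∀ i : ι, ∀ a < 2 ^ (e + 1), ∀ b < 2 ^ (e + 1), s ^ a • i = s ^ b • i → a = b)
    (h2 : (2 : k) ≠ 0) {Q : Ideal (MvPolynomial ι k)} [Q.IsPrime]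
    (hQ : coeffIdeal φ I (Subgroup.zpowers (s ^ 2)) ≤ Q)
    (hQ' : ¬coeffIdeal φ I (Subgroup.zpowers s) ≤ Q) (i : ι) :
    (X i : MvPolynomial ι k) ∈ Q := by
  have hunit {c : k} (hc : c ≠ 0) {p : MvPolynomial ι k} (hp : C c * p ∈ Q) : p ∈ Q := by
    have := Q.mul_mem_left (C c⁻¹) hp
    rwa [← mul_assoc, ← C_mul, inv_mul_cancel₀ hc, C_1, one_mul] at this
  have heven (m : ℕ) (hm : Even m) : s ^ m ∈ Subgroup.zpowers (s ^ 2) := by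
    obtain ⟨l, rfl⟩ := hm
    rw [← two_mul, pow_mul]
    exact Subgroup.npow_mem_zpowers _ _
  have : Nonempty ι := ⟨i⟩
  obtain ⟨g, hg, hgK, hgQ⟩ := exists_X_sub_X_mem hφ hQ hQ'
  -- the variables of an orbit are equal modulo `Q`
  have horbit (a : ι) : (X a - X (s • a) : MvPolynomial ι k) ∈ Q := by
    obtain ⟨m, rfl⟩ := mem_powers_iff_mem_zpowers.2 hg
    have hm : Odd m := by
      rw [← Nat.not_even_iff_odd]
      exact fun h => hgK (heven m h)
    -- An odd exponent is invertible modulo `2 ^ (e + 1)`, so `s` is itself a power of `g = s ^ m`.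
    obtain ⟨r, hr⟩ := Nat.exists_mul_mod_eq_one_of_coprime (n := m) (k := 2 ^ (e + 1))
      ((Nat.coprime_two_right.2 hm).pow_right _) (Nat.one_lt_two_pow (by omega))
    have hsr : (s ^ m) ^ r = s := by
      rw [← pow_mul, pow_eq_pow_mod _ hs, hr.2, pow_one]
    have hpow (r : ℕ) : (X a - X ((s ^ m) ^ r • a) : MvPolynomial ι k) ∈ Q := by
      induction r with
      | zero => simp
      | succ r ih =>
        have h := hgQ (s ^ m • (s ^ m) ^ r • a)
        rw [inv_smul_smul] at h
        have := Q.add_mem ih (Q.neg_mem h)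
        rw [pow_succ' (s ^ m), mul_smul]
        convert this using 1
        ring
    simpa only [hsr] using hpow r
  have horbit' (t : ℕ) : (X (s ^ t • i) - X i : MvPolynomial ι k) ∈ Q := by
    induction t with
    | zero => simp
    | succ t ih =>
      have := Q.sub_mem ih (horbit (s ^ t • i))
      rw [pow_succ', mul_smul]
      convert this using 1
      ring
  obtain ⟨f, hf, hfQ⟩ := Set.not_subset.1 hQ'
  have hN : (∑ t ∈ Finset.range (2 ^ (e + 1)), X (s ^ t • i) : MvPolynomial ι k) ∈ Q := by
    have hsv := smul_alternating (i := i) hgx (M := 2 ^ (e + 1))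
      (Nat.even_pow.2 ⟨even_two, by omega⟩) hs
    have hv (m : ℕ) : s ^ m • alternating x s i (2 ^ (e + 1)) =
        (-1) ^ m * alternating x s i (2 ^ (e + 1)) := by
      induction m with
      | zero => simp
      | succ m ih => rw [pow_succ s, mul_smul, hsv, smul_neg, ih, pow_succ (-1 : R), mul_neg_one, neg_mul]
    have h := mul_mem_coeffIdeal_of_neg hc (alternating_mul_self hx hφx (hinj i))
      (K := Subgroup.zpowers (s ^ 2)) (H := Subgroup.zpowers s) (fun g hg => ?_)
      (fun g hg hgK => ?_) hf
    · rcases Ideal.IsPrime.mem_or_mem ‹_› (hQ h) with h' | h'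
      · refine hunit h2 ?_
        rwa [map_ofNat]
      · exact (hfQ h').elim
    · obtain ⟨m, rfl⟩ := mem_powers_iff_mem_zpowers.2 hg
      change (s ^ 2) ^ m • _ = _
      rw [← pow_mul, hv, pow_mul, neg_one_sq, one_pow, one_mul]
    · obtain ⟨m, rfl⟩ := mem_powers_iff_mem_zpowers.2 hg
      have hm : Odd m := by
        rw [← Nat.not_even_iff_odd]
        exact fun h => hgK (heven m h)
      change s ^ m • _ = _
      rw [hv, hm.neg_one_pow, neg_one_mul]
  have hM : (C ((2 : k) ^ (e + 1)) * X i : MvPolynomial ι k) ∈ Q := by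
    have := Q.sub_mem hN (Q.sum_mem fun t (_ : t ∈ Finset.range (2 ^ (e + 1))) => horbit' t)
    rw [← Finset.sum_sub_distrib] at this
    rw [C_pow, map_ofNat]
    simpa using this
  exact hunit (pow_ne_zero _ h2) hM

include hx hgx hφx hc hφ in
/-- Powers of the central elements `x_i ^ 2` lie in the ideal generated by the integral. -/
theorem exists_pow_mem {σ : G} (hσ : ∀ g, g ∈ Subgroup.zpowers σ) {d : ℕ} (hσd : σ ^ 2 ^ d = 1)
    (hinj : ∀ i : ι, ∀ a < 2 ^ d, ∀ b < 2 ^ d, σ ^ a • i = σ ^ b • i → a = b) (h2 : (2 : k) ≠ 0)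
    (hI : ∑ g : G, single g (1 : R) ∈ I) (i : ι) : ∃ N : ℕ, single 1 (φ (X i ^ N)) ∈ I := by
  suffices h : (X i : MvPolynomial ι k) ∈ (coeffIdeal φ I ⊥).radical by
    obtain ⟨N, hN⟩ := h
    exact ⟨N, single_mem_of_mem_coeffIdeal_bot hN⟩
  rw [Ideal.radical_eq_sInf, Ideal.mem_sInf]
  rintro Q ⟨hQ, hQ'⟩
  by_contra hX
  -- If `X i ∉ Q`, containment in `Q` climbs from the trivial subgroup at `j = 0` to all of `G` at
  -- `j = d`, where the ideal contains `1`.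
  have key (j : ℕ) (hj : j ≤ d) :
      coeffIdeal φ I (Subgroup.zpowers (σ ^ 2 ^ (d - j))) ≤ Q := by
    induction j with
    | zero => simpa [hσd] using hQ
    | succ j ih =>
      by_contra h
      have hd : d - j = d - (j + 1) + 1 := by omega
      have hd' : 2 ^ (d - (j + 1)) * 2 ^ (j + 1) = 2 ^ d := by
        rw [← pow_add]
        congr 1
        omega
      refine hX (X_mem_of_coeffIdeal_le hx hgx hφx hc hφ (s := σ ^ 2 ^ (d - (j + 1))) (e := j) ?_ ?_
        h2 ?_ h i)
      · rw [← pow_mul, hd', hσd]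
      · intro i a ha b hb hab
        rw [← pow_mul, ← pow_mul] at hab
        have hpos : 0 < 2 ^ (d - (j + 1)) := by positivity
        refine Nat.eq_of_mul_eq_mul_left hpos (hinj i _ ?_ _ ?_ hab)
        · rw [← hd']
          exact Nat.mul_lt_mul_of_pos_left ha hpos
        · rw [← hd']
          exact Nat.mul_lt_mul_of_pos_left hb hpos
      · have := ih (by omega)
        rwa [hd, pow_succ, pow_mul] at this
  have htop : Subgroup.zpowers σ = ⊤ := eq_top_iff.2 fun g _ => hσ g
  have h1 := key d le_rfl
  rw [Nat.sub_self, pow_zero, pow_one, htop] at h1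
  exact hQ'.ne_top ((Ideal.eq_top_iff_one _).2 (h1 (one_mem_coeffIdeal_top hI)))

end Prime

end

end Smash

end Pertinency
namespace Pertinency

/-! ### Symmetric polynomials -/

section Symmetric

open MvPolynomial

variable (σ : Type*) [Finite σ] (k : Type*) [Field k]

/-- Polynomials are integral over the invariants of the finite symmetric group, and finitely
generated as an algebra. -/
instance finite_symmetricSubalgebra :
    Module.Finite (symmetricSubalgebra σ k) (MvPolynomial σ k) := by
  classical
  have := Fintype.ofFinite σ
  let _ : MulSemiringAction (Equiv.Perm σ) (MvPolynomial σ k) :=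
    { smul e p := rename e p
      one_smul p := rename_id_apply p
      mul_smul e f p := (rename_rename f e p).symm
      smul_zero e := map_zero _
      smul_add e := map_add _
      smul_one e := map_one _
      smul_mul e := map_mul _ }
  have : Algebra.IsInvariant (symmetricSubalgebra σ k) (MvPolynomial σ k) (Equiv.Perm σ) :=
    ⟨fun p hp => ⟨⟨p, hp⟩, rfl⟩⟩
  have : SMulCommClass (Equiv.Perm σ) (symmetricSubalgebra σ k) (MvPolynomial σ k) :=
    ⟨fun e c p => by
      change rename e (c.1 * p) = c.1 * rename e p
      rw [map_mul, c.2 e]⟩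
  have := Algebra.IsInvariant.isIntegral (symmetricSubalgebra σ k) (MvPolynomial σ k)
    (Equiv.Perm σ)
  have : Algebra.FiniteType (symmetricSubalgebra σ k) (MvPolynomial σ k) :=
    Algebra.FiniteType.of_restrictScalars_finiteType k _ _
  exact Algebra.IsIntegral.finite

instance finiteType_symmetricSubalgebra : Algebra.FiniteType k (symmetricSubalgebra σ k) :=
  have := Fintype.ofFinite σ
  Algebra.FiniteType.equiv inferInstance (esymmAlgEquiv σ k (n := Fintype.card σ) rfl)

instance isNoetherianRing_symmetricSubalgebra : IsNoetherianRing (symmetricSubalgebra σ k) :=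
  have := Fintype.ofFinite σ
  isNoetherianRing_of_ringEquiv _ (esymmAlgEquiv σ k (n := Fintype.card σ) rfl).toRingEquiv

end Symmetric

/-! ### Algebras with anticommuting generators -/

/-- Anticommuting generators of an algebra. -/
structure SkewGenerators (k R : Type*) [Field k] [Ring R] [Algebra k R] (n : ℕ) where
  x : Fin n → R
  anticomm : ∀ i j, i ≠ j → x i * x j = -(x j * x i)
  adjoin_eq_top : Algebra.adjoin k (Set.range x) = ⊤

namespace SkewGenerators

noncomputable section

open MvPolynomial

variable {k R : Type*} [Field k] [Ring R] [Algebra k R] {n : ℕ} (D : SkewGenerators k R n)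

lemma sq_mem_center (i : Fin n) : D.x i * D.x i ∈ Subalgebra.center k R := by
  rw [Subalgebra.mem_center_iff]
  intro a
  have ha : a ∈ Algebra.adjoin k (Set.range D.x) := D.adjoin_eq_top ▸ Algebra.mem_top
  induction ha using Algebra.adjoin_induction with
  | mem _ h =>
    obtain ⟨j, rfl⟩ := h
    by_cases hij : i = j
    · rw [hij, mul_assoc]
    · rw [← mul_assoc, D.anticomm j i (Ne.symm hij), neg_mul, mul_assoc,
        D.anticomm j i (Ne.symm hij), mul_neg, neg_neg, mul_assoc]
  | algebraMap c => exact Algebra.commutes c _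
  | add a b _ _ h h' => rw [add_mul, mul_add, h, h']
  | mul a b _ _ h h' => rw [mul_assoc, h', ← mul_assoc, h, mul_assoc]

/-- The central elements given by polynomials in the squares of the generators. -/
def sqHom : MvPolynomial (Fin n) k →ₐ[k] R :=
  (Subalgebra.center k R).val.comp (aeval fun i => ⟨D.x i * D.x i, D.sq_mem_center i⟩)

@[simp]
lemma sqHom_X (i : Fin n) : D.sqHom (X i) = D.x i * D.x i := by
  simp [sqHom]

lemma sqHom_mul (f : MvPolynomial (Fin n) k) (r : R) : D.sqHom f * r = r * D.sqHom f :=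
  (Subalgebra.mem_center_iff.1 (aeval (fun i =>
    (⟨D.x i * D.x i, D.sq_mem_center i⟩ : Subalgebra.center k R)) f).2 r).symm

lemma smul_sqHom {G : Type*} [Group G] [MulSemiringAction G R] [SMulCommClass G k R] (g : G)
    (τ : Fin n → Fin n) (hτ : ∀ i, g • D.x i = D.x (τ i)) (f : MvPolynomial (Fin n) k) :
    g • D.sqHom f = D.sqHom (rename τ f) := by
  have : (MulSemiringAction.toAlgHom k R g).comp D.sqHom = D.sqHom.comp (rename τ) :=
    MvPolynomial.algHom_ext fun i => by
      simp [smul_mul', hτ]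
  exact congrArg (fun h => h f) this

/-- An algebra with anticommuting generators is an algebra over the polynomials in the squares. -/
abbrev algebraSq : Algebra (MvPolynomial (Fin n) k) R :=
  D.sqHom.toRingHom.toAlgebra' D.sqHom_mul

section Finite

/-- The span over the central polynomials of the ordered monomials in the first `j` generators. -/
def monomialSpan : ℕ → letI := D.algebraSq; Submodule (MvPolynomial (Fin n) k) R
  | 0 => letI := D.algebraSq; 1
  | j + 1 => letI := D.algebraSq
    if h : j < n then monomialSpan j ⊔ (monomialSpan j).map (LinearMap.mulRight _ (D.x ⟨j, h⟩))
    else monomialSpan j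

lemma fg_monomialSpan (j : ℕ) : letI := D.algebraSq; (D.monomialSpan j).FG := by
  let _ := D.algebraSq
  induction j with
  | zero => exact ⟨{1}, by rw [Finset.coe_singleton, ← Submodule.one_eq_span]; rfl⟩
  | succ j ih =>
    rw [monomialSpan]
    split_ifs
    · exact ih.sup (ih.map _)
    · exact ih

lemma one_mem_monomialSpan (j : ℕ) : letI := D.algebraSq; (1 : R) ∈ D.monomialSpan j := by
  let _ := D.algebraSq
  induction j with
  | zero => exact Submodule.one_le.1 le_rfl
  | succ j ih =>
    rw [monomialSpan]
    split_ifs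
    · exact Submodule.mem_sup_left ih
    · exact ih

/-- Moving `x_i` to its place costs only signs, and a repeated generator is a central square, that
is, a scalar. -/
lemma mul_mem_monomialSpan (j : ℕ) (i : Fin n) (hi : (i : ℕ) < j) {r : R} :
    letI := D.algebraSq; r ∈ D.monomialSpan j → r * D.x i ∈ D.monomialSpan j := by
  let _ := D.algebraSq
  change r ∈ D.monomialSpan j → r * D.x i ∈ D.monomialSpan j
  intro hr
  induction j generalizing r with
  | zero => omega
  | succ j ih =>
    rw [monomialSpan] at hr ⊢
    split_ifs at hr ⊢ with h
    · obtain ⟨a, ha, _, ⟨b, hb, rfl⟩, rfl⟩ := Submodule.mem_sup.1 hr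
      rw [LinearMap.mulRight_apply, add_mul]
      by_cases hij : (i : ℕ) = j
      · obtain rfl : i = ⟨j, h⟩ := Fin.ext hij
        refine add_mem (Submodule.mem_sup_right ⟨a, ha, rfl⟩) (Submodule.mem_sup_left ?_)
        have : b * D.x ⟨j, h⟩ * D.x ⟨j, h⟩ = (X ⟨j, h⟩ : MvPolynomial (Fin n) k) • b := by
          rw [Algebra.smul_def, mul_assoc, ← D.sqHom_X]
          exact (D.sqHom_mul _ _).symm
        rw [this]
        exact Submodule.smul_mem _ _ hb
      · refine add_mem (Submodule.mem_sup_left (ih (by omega) ha)) (Submodule.mem_sup_right ?_)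
        refine ⟨-(b * D.x i), neg_mem (ih (by omega) hb), ?_⟩
        rw [LinearMap.mulRight_apply, mul_assoc, D.anticomm ⟨j, h⟩ i
          (fun e => hij (congrArg Fin.val e).symm), neg_mul, mul_neg, mul_assoc]
    · exact ih (by have := i.isLt; omega) hr

lemma finite_sq : letI := D.algebraSq; Module.Finite (MvPolynomial (Fin n) k) R := by
  let _ := D.algebraSq
  have h : D.monomialSpan n = ⊤ := by
    refine Submodule.eq_top_iff'.2 fun a => ?_
    have key (b : R) (hb : b ∈ D.monomialSpan n) : b * a ∈ D.monomialSpan n := by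
      have ha : a ∈ Algebra.adjoin k (Set.range D.x) := D.adjoin_eq_top ▸ Algebra.mem_top
      induction ha using Algebra.adjoin_induction generalizing b with
      | mem _ h =>
        obtain ⟨j, rfl⟩ := h
        exact D.mul_mem_monomialSpan n j j.2 hb
      | algebraMap c =>
        have : b * algebraMap k R c = (C c : MvPolynomial (Fin n) k) • b := by
          rw [Algebra.smul_def, ← Algebra.commutes]
          congr 1
          exact (D.sqHom.commutes c).symm
        rw [this]
        exact Submodule.smul_mem _ _ hb
      | add a a' _ _ h h' => rw [mul_add]; exact add_mem (h b hb) (h' b hb)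
      | mul a a' _ _ h h' => rw [← mul_assoc]; exact h' _ (h b hb)
    simpa using key 1 (D.one_mem_monomialSpan n)
  exact ⟨h ▸ D.fg_monomialSpan n⟩

end Finite

end

end SkewGenerators

end Pertinency
namespace Pertinency

/-! ### The gradings of the skew polynomial ring, the smash product and the invariants -/

namespace SkewRing

noncomputable section

variable {k : Type u} [Field k] {n : ℕ}

variable (k n) in
/-- The component of degree `m`. -/
def grading (m : ℕ) : Submodule k (SkewRing k n) := Submodule.span k (Set.range (X k n)) ^ m

variable (k n) in
/-- The generators, as anticommuting generators. -/
def generators : SkewGenerators k (SkewRing k n) n where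
  x := X k n
  anticomm _ _ h := X_mul_X h
  adjoin_eq_top := adjoin_range_X

variable (k n) in
/-- The homomorphism `a ↦ a T ^ m` for `a` of degree `m`. -/
def toPolynomial : SkewRing k n →ₐ[k] Polynomial (SkewRing k n) :=
  lift (fun i => Polynomial.monomial 1 (X k n i)) fun i j h => by
    rw [Polynomial.monomial_mul_monomial, Polynomial.monomial_mul_monomial, X_mul_X h,
      Polynomial.monomial_neg]

lemma toPolynomial_X (i : Fin n) :
    toPolynomial k n (X k n i) = Polynomial.monomial 1 (X k n i) :=
  lift_X ..

lemma toPolynomial_of_mem {m : ℕ} {a : SkewRing k n} (ha : a ∈ grading k n m) :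
    toPolynomial k n a = Polynomial.monomial m a := by
  let T (m : ℕ) : Submodule k (SkewRing k n) :=
    LinearMap.eqLocus (toPolynomial k n).toLinearMap
      ((Polynomial.monomial (R := SkewRing k n) m).restrictScalars k)
  suffices h : ∀ m, grading k n m ≤ T m from h m ha
  intro m
  induction m with
  | zero =>
    rw [grading, pow_zero, Submodule.one_le]
    exact map_one (toPolynomial k n)
  | succ m ih =>
    rw [grading, pow_succ, Submodule.mul_le]
    intro a ha b hb
    have hb' : b ∈ T 1 := by
      refine Submodule.span_le.2 ?_ hb
      rintro _ ⟨i, rfl⟩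
      exact toPolynomial_X i
    have ha' := ih ha
    change toPolynomial k n (a * b) = Polynomial.monomial (m + 1) (a * b)
    change toPolynomial k n a = Polynomial.monomial m a at ha'
    change toPolynomial k n b = Polynomial.monomial 1 b at hb'
    rw [map_mul, ha', hb', Polynomial.monomial_mul_monomial]

instance : SetLike.GradedMonoid (grading k n) where
  one_mem := by
    rw [grading, pow_zero]
    exact Submodule.one_le.1 le_rfl
  mul_mem i j a b ha hb := by
    rw [grading, pow_add]
    exact Submodule.mul_mem_mul ha hb

/-- The coefficients of `toPolynomial` serve as the projections. -/
lemma isInternal_grading : DirectSum.IsInternal (grading k n) := by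
  refine isInternal_of_projections _
    (fun m => (Polynomial.lcoeff (SkewRing k n) m).restrictScalars k ∘ₗ
      (toPolynomial k n).toLinearMap) ?_ ?_ ?_
  · intro i v hv
    change (toPolynomial k n v).coeff i = v
    rw [toPolynomial_of_mem hv, Polynomial.coeff_monomial_same]
  · intro i j v hv hij
    change (toPolynomial k n v).coeff j = 0
    rw [toPolynomial_of_mem hv, Polynomial.coeff_monomial_of_ne _ hij]
  · intro v
    have hmem {i : ℕ} {a : SkewRing k n} (ha : a ∈ grading k n i) : a ∈ ⨆ i, grading k n i :=
      Submodule.mem_iSup_of_mem i ha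
    induction v using induction_X with
    | hk c =>
      refine hmem (i := 0) ?_
      rw [Algebra.algebraMap_eq_smul_one]
      exact Submodule.smul_mem _ _ (SetLike.GradedOne.one_mem)
    | hX i =>
      refine hmem (i := 1) ?_
      rw [grading, pow_one]
      exact Submodule.subset_span ⟨i, rfl⟩
    | hadd a b ha hb => exact add_mem ha hb
    | hmul a b ha hb =>
      induction ha using Submodule.iSup_induction' with
      | zero => rw [zero_mul]; exact zero_mem _
      | add a a' _ _ h h' => rw [add_mul]; exact add_mem h h'
      | mem i a ha =>
        induction hb using Submodule.iSup_induction' with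
        | zero => rw [mul_zero]; exact zero_mem _
        | add b b' _ _ h h' => rw [mul_add]; exact add_mem h h'
        | mem j b hb => exact hmem (SetLike.GradedMul.mul_mem ha hb)

instance (m : ℕ) : Module.Finite k (grading k n m) :=
  Module.Finite.iff_fg.2 ((Submodule.fg_span (Set.finite_range _)).pow m)

end

end SkewRing

section Component

variable {k : Type*} [Field k] {V : Type*} [AddCommGroup V] [Module k V] {𝒱 : ℕ → Submodule k V}
  (h𝒱 : DirectSum.IsInternal 𝒱)

/-- The homogeneous components. -/
noncomputable def component (i : ℕ) : V →ₗ[k] V :=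
  letI := h𝒱.chooseDecomposition
  (𝒱 i).subtype ∘ₗ DirectSum.component k ℕ _ i ∘ₗ (DirectSum.decomposeLinearEquiv 𝒱).toLinearMap

lemma component_same {i : ℕ} {v : V} (hv : v ∈ 𝒱 i) : component h𝒱 i v = v :=
  letI := h𝒱.chooseDecomposition
  DirectSum.decompose_of_mem_same 𝒱 hv

lemma component_ne {i j : ℕ} {v : V} (hv : v ∈ 𝒱 i) (h : j ≠ i) : component h𝒱 j v = 0 :=
  letI := h𝒱.chooseDecomposition
  DirectSum.decompose_of_mem_ne 𝒱 hv h.symm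

lemma component_mem (i : ℕ) (v : V) : component h𝒱 i v ∈ 𝒱 i :=
  letI := h𝒱.chooseDecomposition
  (DirectSum.decompose 𝒱 v i).2

lemma exists_sum_component (v : V) : ∃ s : Finset ℕ, ∑ i ∈ s, component h𝒱 i v = v := by
  classical
  let _ := h𝒱.chooseDecomposition
  exact ⟨_, DirectSum.sum_support_decompose 𝒱 v⟩

lemma component_comm (f : V →ₗ[k] V) (hf : ∀ i, ∀ v ∈ 𝒱 i, f v ∈ 𝒱 i) (i : ℕ) (v : V) :
    component h𝒱 i (f v) = f (component h𝒱 i v) := by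
  have hv : v ∈ ⨆ i, 𝒱 i := h𝒱.submodule_iSup_eq_top ▸ Submodule.mem_top
  induction hv using Submodule.iSup_induction' with
  | zero => simp
  | add v w _ _ h h' => simp [h, h']
  | mem j v hv =>
    by_cases hij : i = j
    · subst hij
      rw [component_same h𝒱 hv, component_same h𝒱 (hf i v hv)]
    · rw [component_ne h𝒱 hv hij, component_ne h𝒱 (hf j v hv) hij, map_zero]

end Component

section Action

variable {k : Type u} [Field k] {R : Type u} [Ring R] [Algebra k R] {G : Type u} [Group G]
  [MulSemiringAction G R] [SMulCommClass G k R] {ℛ : ℕ → Submodule k R}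

omit [Group G] [MulSemiringAction G R] [SMulCommClass G k R] in
open SkewMonoidAlgebra in
lemma single_mem_smashGrading {m : ℕ} {r : R} (hr : r ∈ ℛ m) (g : G) :
    single g r ∈ smashGrading G ℛ m := by
  classical
  intro h
  rw [coeff_single_apply]
  split_ifs
  · exact hr
  · exact zero_mem _

variable (k) in
/-- The coefficients of elements of the smash product. -/
noncomputable def Smash.coeffLinear (g : G) : Smash R G →ₗ[k] R :=
  Finsupp.lapply g ∘ₗ SkewMonoidAlgebra.coeffLinearEquiv.toLinearMap

instance [Finite G] (m : ℕ) [Module.Finite k (ℛ m)] : Module.Finite k (smashGrading G ℛ m) :=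
  Module.Finite.of_injective
    (LinearMap.pi fun g => (Smash.coeffLinear k g ∘ₗ (smashGrading G ℛ m).subtype).codRestrict
      (ℛ m) fun a => a.2 g)
    fun _ _ h => Subtype.ext (SkewMonoidAlgebra.ext fun g =>
      congrArg Subtype.val (congrFun h g))

instance [SetLike.GradedMonoid ℛ] : SetLike.GradedMonoid (invariantGrading G ℛ) where
  one_mem := SetLike.GradedOne.one_mem (A := ℛ)
  mul_mem _ _ _ _ ha hb := SetLike.GradedMul.mul_mem (A := ℛ) ha hb

variable (hG : ∀ (g : G) m, ∀ r ∈ ℛ m, g • r ∈ ℛ m)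

include hG in
lemma isInternal_invariantGrading (hℛ : DirectSum.IsInternal ℛ) :
    DirectSum.IsInternal (invariantGrading G ℛ) := by
  have hmem (m : ℕ) (b : Invariants k R G) : component hℛ m b.1 ∈ FixedPoints.subalgebra k R G :=
    fun g => by
      have := component_comm hℛ (DistribSMul.toLinearMap k R g) (hG g) m b.1
      change component hℛ m (g • b.1) = g • component hℛ m b.1 at this
      rw [← this, b.2 g]
  refine isInternal_of_projections _ (fun m => (component hℛ m ∘ₗ
    (FixedPoints.subalgebra k R G).val.toLinearMap).codRestrict
      (Subalgebra.toSubmodule (FixedPoints.subalgebra k R G)) (hmem m)) ?_ ?_ ?_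
  · exact fun i v hv => Subtype.ext (component_same hℛ hv)
  · exact fun i j v hv hij => Subtype.ext (component_ne hℛ hv hij)
  · intro v
    obtain ⟨s, hs⟩ := exists_sum_component hℛ v.1
    have : v = ∑ i ∈ s, (⟨component hℛ i v.1, hmem i v⟩ : Invariants k R G) := by
      apply Subtype.ext
      refine hs.symm.trans ?_
      exact (map_sum (FixedPoints.subalgebra k R G).val
        (fun i => (⟨component hℛ i v.1, hmem i v⟩ : Invariants k R G)) s).symm
    rw [this]
    exact Submodule.sum_mem _ fun i _ => Submodule.mem_iSup_of_mem i (component_mem hℛ i v.1)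

variable [Fintype G]

omit [SMulCommClass G k R] in
include hG in
lemma gradedMonoid_smashGrading [SetLike.GradedMonoid ℛ] :
    SetLike.GradedMonoid (smashGrading G ℛ) where
  one_mem := single_mem_smashGrading SetLike.GradedOne.one_mem 1
  mul_mem i j a b ha hb := by
    rw [← Smash.sum_single_coeff a, ← Smash.sum_single_coeff b, Finset.sum_mul]
    refine Submodule.sum_mem _ fun g _ => ?_
    rw [Finset.mul_sum]
    refine Submodule.sum_mem _ fun h _ => ?_
    rw [SkewMonoidAlgebra.single_mul_single]
    exact single_mem_smashGrading (SetLike.GradedMul.mul_mem (ha g) (hG g j _ (hb h))) _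

omit [Group G] [MulSemiringAction G R] [SMulCommClass G k R] in
open SkewMonoidAlgebra in
lemma isInternal_smashGrading (hℛ : DirectSum.IsInternal ℛ) :
    DirectSum.IsInternal (smashGrading G ℛ) := by
  have hc (m : ℕ) (a : Smash R G) (g : G) :
      ((∑ g, lsingle k g ∘ₗ component hℛ m ∘ₗ Smash.coeffLinear k g : Smash R G →ₗ[k] Smash R G)
        a).coeff g = component hℛ m (a.coeff g) := by
    rw [LinearMap.sum_apply]
    exact Smash.coeff_sum_single _ _
  refine isInternal_of_projections _
    (fun m => ∑ g, lsingle k g ∘ₗ component hℛ m ∘ₗ Smash.coeffLinear k g) ?_ ?_ ?_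
  · intro i a ha
    ext g
    exact (hc i a g).trans (component_same hℛ (ha g))
  · intro i j a ha hij
    ext g
    exact (hc j a g).trans (component_ne hℛ (ha g) hij)
  · intro a
    rw [← Smash.sum_single_coeff a]
    refine Submodule.sum_mem _ fun g _ => ?_
    obtain ⟨s, hs⟩ := exists_sum_component hℛ (a.coeff g)
    rw [← hs, ← lsingle_apply (R := k), _root_.map_sum]
    exact Submodule.sum_mem _ fun i _ => Submodule.mem_iSup_of_mem i
      (single_mem_smashGrading (component_mem hℛ i _) g)

end Action

end Pertinency
namespace Pertinency

/-! ### The invariant ring as a corner of the smash product -/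

namespace Smash

noncomputable section

open SkewMonoidAlgebra

variable (k : Type u) [Field k] (R : Type u) [Ring R] [Algebra k R] (G : Type u) [Group G]
  [MulSemiringAction G R] [SMulCommClass G k R]

/-- The inclusion of `R` in the smash product. -/
def incl : R →ₐ[k] Smash R G :=
  { singleOneRingHom (k := R) (G := G) with commutes' := fun _ => rfl }

variable {R G} in
lemma incl_apply (r : R) : incl k R G r = single 1 r := rfl

variable [Fintype G]

/-- The sum of the coefficients. -/
def aug : Smash R G →ₗ[k] R := ∑ g, coeffLinear k g

/-- The projection to the invariants. -/
def average : R →ₗ[k] Invariants k R G :=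
  ((Fintype.card G : k)⁻¹ • ∑ g : G, DistribSMul.toLinearMap k R g).codRestrict
    (Subalgebra.toSubmodule (FixedPoints.subalgebra k R G)) fun r h => by
      rw [LinearMap.smul_apply, LinearMap.sum_apply, smul_comm, Finset.smul_sum,
        ← Equiv.sum_comp (Equiv.mulLeft h⁻¹)]
      simp [mul_smul]

variable {k R G}

omit [Group G] [MulSemiringAction G R] [SMulCommClass G k R] in
lemma aug_apply (a : Smash R G) : aug k R G a = ∑ g, a.coeff g := LinearMap.sum_apply ..

lemma coe_average (r : R) :
    (average k R G r : R) = (Fintype.card G : k)⁻¹ • ∑ g : G, g • r := by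
  change ((Fintype.card G : k)⁻¹ • ∑ g : G, DistribSMul.toLinearMap k R g : R →ₗ[k] R) r = _
  rw [LinearMap.smul_apply, LinearMap.sum_apply]
  rfl

omit [Group G] [MulSemiringAction G R] [SMulCommClass G k R] in
lemma aug_single (g : G) (r : R) : aug k R G (single g r) = r := by
  classical
  rw [aug_apply, Finset.sum_eq_single g]
  · simp
  · intro h _ hh
    simp [hh.symm]
  · simp

omit [MulSemiringAction G R] [SMulCommClass G k R] [Fintype G] in
lemma induction_single {p : Smash R G → Prop} (hs : ∀ g r, p (single g r))
    (ha : ∀ a b, p a → p b → p (a + b)) (a : Smash R G) : p a :=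
  SkewMonoidAlgebra.induction_on a (by simpa using hs 1 0) hs ha

omit [SMulCommClass G k R] in
lemma aug_mul_single_one (a : Smash R G) (h : G) :
    aug k R G (a * single h 1) = aug k R G a := by
  induction a using induction_single with
  | hs g r => rw [single_mul_single, aug_single, aug_single, smul_one, mul_one]
  | ha a b h h' => rw [add_mul, map_add, h, h', map_add]

omit [SMulCommClass G k R] in
lemma aug_single_one_mul (a : Smash R G) (h : G) :
    aug k R G (single h 1 * a) = h • aug k R G a := by
  induction a using induction_single with
  | hs g r => rw [single_mul_single, aug_single, aug_single, one_mul]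
  | ha a b h h' => rw [mul_add, map_add, h, h', map_add, smul_add]

lemma aug_mul_incl (a : Smash R G) (b : Invariants k R G) :
    aug k R G (a * incl k R G b) = aug k R G a * b := by
  induction a using induction_single with
  | hs g r => rw [incl_apply, single_mul_single, aug_single, aug_single, b.2 g]
  | ha a b h h' => rw [add_mul, map_add, h, h', map_add, add_mul]

lemma mul_smashIntegral (a : Smash R G) :
    a * smashIntegral k R G = incl k R G (aug k R G a) * smashIntegral k R G := by
  induction a using induction_single with
  | hs g r =>
    rw [aug_single, incl_apply, smashIntegral, mul_smul_comm, mul_smul_comm, Finset.mul_sum,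
      Finset.mul_sum]
    simp only [single_mul_single, smul_one, mul_one, one_mul]
    exact congrArg _ (Equiv.sum_comp (Equiv.mulLeft g) fun h => (single h r : Smash R G))
  | ha a b h h' => rw [add_mul, h, h', map_add, map_add, add_mul]

lemma smashIntegral_mul_incl (r : R) :
    smashIntegral k R G * incl k R G r = (Fintype.card G : k)⁻¹ • ∑ g : G, single g (g • r) := by
  rw [incl_apply, smashIntegral, smul_mul_assoc, Finset.sum_mul]
  simp only [single_mul_single, mul_one, one_mul]

lemma commute_smashIntegral (b : Invariants k R G) :
    smashIntegral k R G * incl k R G b = incl k R G b * smashIntegral k R G := by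
  have (g : G) : g • (b : R) = b := b.2 g
  rw [smashIntegral_mul_incl, smashIntegral, mul_smul_comm, Finset.mul_sum]
  simp only [incl_apply, single_mul_single, one_smul, mul_one, one_mul, this]

lemma aug_smashIntegral_mul (a : Smash R G) :
    aug k R G (smashIntegral k R G * a) = average k R G (aug k R G a) := by
  rw [smashIntegral, smul_mul_assoc, Finset.sum_mul, map_smul, _root_.map_sum, coe_average]
  simp only [aug_single_one_mul]

section

variable (hG : (Fintype.card G : k) ≠ 0)

include hG

lemma average_coe (b : Invariants k R G) : average k R G (b : R) = b := by
  have (g : G) : g • (b : R) = b := b.2 g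
  apply Subtype.ext
  rw [coe_average]
  simp only [this]
  rw [Finset.sum_const, Finset.card_univ, ← Nat.cast_smul_eq_nsmul k, smul_smul,
    inv_mul_cancel₀ hG, one_smul]

lemma aug_mul_smashIntegral (a : Smash R G) :
    aug k R G (a * smashIntegral k R G) = aug k R G a := by
  rw [smashIntegral, mul_smul_comm, Finset.mul_sum, map_smul, _root_.map_sum]
  simp only [aug_mul_single_one]
  rw [Finset.sum_const, Finset.card_univ, ← Nat.cast_smul_eq_nsmul k, smul_smul,
    inv_mul_cancel₀ hG, one_smul]

end

variable {ℛ : ℕ → Submodule k R}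

/-- The corner of the smash product given by the integral. -/
def corner [SetLike.GradedMonoid ℛ] (hG : (Fintype.card G : k) ≠ 0)
    (hℛ : ∀ (g : G) m, ∀ r ∈ ℛ m, g • r ∈ ℛ m) :
    Corner (smashGrading G ℛ) (invariantGrading G ℛ) where
  ι := (incl k R G).comp (FixedPoints.subalgebra k R G).val
  e := smashIntegral k R G
  -- `a e = aug(a) e`, and applying `aug` to `e a` averages `aug a`; hence `e a e = average (aug a)
  -- e`.
  tr := average k R G ∘ₗ aug k R G
  e_mul_e := by
    have h := aug_mul_smashIntegral hG (1 : Smash R G)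
    rw [one_mul] at h
    rw [mul_smashIntegral, h, one_def, aug_single, map_one, one_mul]
  commute b := commute_smashIntegral b
  e_mul_mul_e a := by
    change _ = incl k R G (average k R G (aug k R G a)) * _
    rw [mul_smashIntegral, aug_smashIntegral_mul]
  tr_mul a b := by
    change average k R G (aug k R G (a * incl k R G b)) = average k R G (aug k R G a) * b
    rw [aug_mul_incl]
    apply Subtype.ext
    change (average k R G _ : R) = (average k R G _ : R) * b
    rw [coe_average, coe_average, smul_mul_assoc, Finset.sum_mul]
    congr 1
    refine Finset.sum_congr rfl fun g _ => ?_
    rw [smul_mul', b.2 g]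
  tr_e_mul a := by
    rw [LinearMap.comp_apply, aug_smashIntegral_mul, average_coe hG]
    rfl
  tr_mul_e a := by
    rw [LinearMap.comp_apply, aug_mul_smashIntegral hG]
    rfl
  tr_one := by
    rw [LinearMap.comp_apply, one_def, aug_single]
    exact average_coe hG 1
  ι_mem i b hb := single_mem_smashGrading (R := R) (r := b.1) hb 1
  tr_mem i a ha := by
    change (average k R G (aug k R G a) : R) ∈ ℛ i
    rw [coe_average, aug_apply]
    exact Submodule.smul_mem _ _ (Submodule.sum_mem _ fun g _ =>
      hℛ g i _ (Submodule.sum_mem _ fun h _ => ha h))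
  e_mem := Submodule.smul_mem _ _ (Submodule.sum_mem _ fun g _ =>
    single_mem_smashGrading SetLike.GradedOne.one_mem g)

end

end Smash

end Pertinency
-- Symmetric polynomials in the squares, as a common central subring.
namespace Pertinency

section FiniteOverCentral

variable (k C T : Type*) [Field k] [CommRing C] [Ring T] [Algebra k C] [Algebra k T] [Algebra C T]
  [IsScalarTower k C T] [Module.Finite C T]

omit [Algebra k C] [IsScalarTower k C T] [Field k] [Algebra k T] in
include C in
lemma isNoetherianRing_of_finite [IsNoetherianRing C] : IsNoetherianRing T :=
  isNoetherian_of_tower C (isNoetherian_of_isNoetherianRing_of_finite C T)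

omit [Algebra k C] [IsScalarTower k C T] [Field k] [Algebra k T] in
include C in
lemma isNoetherianRing_op_of_finite [IsNoetherianRing C] : IsNoetherianRing Tᵐᵒᵖ :=
  have := Corner.finite_op (A := T) C
  isNoetherianRing_of_finite C Tᵐᵒᵖ

include C in
lemma finiteType_op_of_finite [Algebra.FiniteType k C] : Algebra.FiniteType k Tᵐᵒᵖ :=
  have := Corner.finite_op (A := T) C
  have : IsScalarTower k C Tᵐᵒᵖ := .of_algebraMap_eq fun c => by
    rw [MulOpposite.algebraMap_apply, MulOpposite.algebraMap_apply,
      IsScalarTower.algebraMap_apply k C T]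
  Algebra.FiniteType.trans (S := C) inferInstance inferInstance

end FiniteOverCentral

namespace SkewGenerators

noncomputable section

open MvPolynomial

variable {k R : Type u} [Field k] [Ring R] [Algebra k R] {n : ℕ} (D : SkewGenerators k R n)
  {G : Type u} [Group G] [MulSemiringAction G R] [SMulCommClass G k R] [MulAction G (Fin n)]

/-- The central elements given by symmetric polynomials in the squares of the generators. -/
def symHom : symmetricSubalgebra (Fin n) k →ₐ[k] R :=
  D.sqHom.comp (symmetricSubalgebra (Fin n) k).val

lemma symHom_mul (c : symmetricSubalgebra (Fin n) k) (r : R) : D.symHom c * r = r * D.symHom c :=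
  D.sqHom_mul _ _

/-- An algebra with anticommuting generators is an algebra over the symmetric polynomials. -/
abbrev algebraSym : Algebra (symmetricSubalgebra (Fin n) k) R :=
  D.symHom.toRingHom.toAlgebra' D.symHom_mul

lemma finite_sym : letI := D.algebraSym; Module.Finite (symmetricSubalgebra (Fin n) k) R := by
  let _ := D.algebraSq
  let _ := D.algebraSym
  have := D.finite_sq
  refine @Module.Finite.trans (symmetricSubalgebra (Fin n) k) (MvPolynomial (Fin n) k) R
    _ _ _ _ D.algebraSym.toModule _ ⟨fun c f r => ?_⟩ _ this
  change D.sqHom (c.1 * f) * r = D.sqHom c.1 * (D.sqHom f * r)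
  rw [map_mul, mul_assoc]

variable (hgx : ∀ (g : G) i, g • D.x i = D.x (g • i))

include hgx

/-- This is why symmetric polynomials are used: polynomials in the squares are central in `R`, but
invariance under `G` is needed for centrality in the smash product and membership in `R^G`. -/
lemma smul_symHom (g : G) (c : symmetricSubalgebra (Fin n) k) : g • D.symHom c = D.symHom c := by
  change g • D.sqHom c = D.sqHom c
  rw [D.smul_sqHom g (MulAction.toPerm g) (hgx g)]
  exact congrArg D.sqHom (c.2 _)

lemma smulCommClass_sym : letI := D.algebraSym
    SMulCommClass G (symmetricSubalgebra (Fin n) k) R :=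
  letI := D.algebraSym
  ⟨fun g c r => by
    change g • (D.symHom c * r) = D.symHom c * g • r
    rw [smul_mul', D.smul_symHom hgx]⟩

/-- The smash product is an algebra over the symmetric polynomials. -/
abbrev algebraSymSmash : Algebra (symmetricSubalgebra (Fin n) k) (Smash R G) :=
  letI := D.algebraSym
  have := D.smulCommClass_sym hgx
  inferInstance

/-- The invariant ring is an algebra over the symmetric polynomials. -/
abbrev algebraSymInvariants :
    Algebra (symmetricSubalgebra (Fin n) k) (Invariants k R G) :=
  (D.symHom.codRestrict (FixedPoints.subalgebra k R G)
    fun c g => D.smul_symHom hgx g c).toRingHom.toAlgebra' fun c r =>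
      Subtype.ext (D.symHom_mul c r)

lemma isScalarTower_symSmash : letI := D.algebraSymSmash hgx
    IsScalarTower k (symmetricSubalgebra (Fin n) k) (Smash R G) :=
  letI := D.algebraSymSmash hgx
  .of_algebraMap_eq fun c => congrArg (SkewMonoidAlgebra.single 1) (D.symHom.commutes c).symm

lemma isScalarTower_symInvariants : letI := D.algebraSymInvariants hgx
    IsScalarTower k (symmetricSubalgebra (Fin n) k) (Invariants k R G) :=
  letI := D.algebraSymInvariants hgx
  .of_algebraMap_eq fun c => Subtype.ext (D.symHom.commutes c).symm

lemma finite_symSmash [Finite G] : letI := D.algebraSymSmash hgx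
    Module.Finite (symmetricSubalgebra (Fin n) k) (Smash R G) := by
  let _ := D.algebraSym
  have := D.finite_sym
  exact Module.Finite.equiv (SkewMonoidAlgebra.coeffLinearEquiv (S := symmetricSubalgebra (Fin n) k)
    (k := R) (G := G)).symm

lemma finite_symInvariants : letI := D.algebraSymInvariants hgx
    Module.Finite (symmetricSubalgebra (Fin n) k) (Invariants k R G) := by
  let _ := D.algebraSym
  let _ := D.algebraSymInvariants hgx
  have := D.finite_sym
  have := isNoetherian_of_isNoetherianRing_of_finite (symmetricSubalgebra (Fin n) k) R
  exact Module.Finite.of_injective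
    { (FixedPoints.subalgebra k R G).val with
      map_smul' := fun _ _ => rfl : Invariants k R G →ₗ[symmetricSubalgebra (Fin n) k] R }
    Subtype.val_injective

end

end SkewGenerators

end Pertinency
-- Ideals of finite codimension in the smash product.
namespace Pertinency

namespace SkewGenerators

noncomputable section

open MvPolynomial

variable {k R : Type*} [Field k] [Ring R] [Algebra k R] {n : ℕ} (D : SkewGenerators k R n)
  {G : Type*} [Group G] [Fintype G] [MulSemiringAction G R] [SMulCommClass G k R]

/-- A two-sided ideal as a linear subspace. -/
def _root_.Pertinency.idealToSubmodule {A : Type*} [Ring A] [Algebra k A] (I : TwoSidedIdeal A) :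
    Submodule k A where
  carrier := {a | a ∈ I}
  add_mem' ha hb := I.add_mem ha hb
  zero_mem' := I.zero_mem
  smul_mem' c a ha := by
    change c • a ∈ I
    rw [Algebra.smul_def]
    exact I.mul_mem_left _ _ ha

open SkewMonoidAlgebra in
/-- If an ideal of the smash product contains powers of the squares of the generators, then it
has a finite dimensional complement. -/
lemma exists_fg_add_mem (I : TwoSidedIdeal (Smash R G))
    (hI : ∀ i, ∃ N : ℕ, single 1 (D.sqHom (MvPolynomial.X i ^ N)) ∈ I) :
    ∃ U : Submodule k (Smash R G), U.FG ∧ ∀ a, ∃ u ∈ U, a - u ∈ I := by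
  classical
  choose N' hN' using hI
  -- One exponent that works for all generators.
  let N := ∑ i, N' i
  have hN (i : Fin n) (f : MvPolynomial (Fin n) k) (r : R) (g : G) :
      single g (D.sqHom (MvPolynomial.X i ^ N * f) * r) ∈ I := by
    have h : N = N' i + (N - N' i) :=
      (Nat.add_sub_cancel' (Finset.single_le_sum (fun _ _ => Nat.zero_le _) (Finset.mem_univ i))).symm
    have : single g (D.sqHom (MvPolynomial.X i ^ N * f) * r) =
        single 1 (D.sqHom (MvPolynomial.X i ^ N' i)) *
          single g (D.sqHom (MvPolynomial.X i ^ (N - N' i) * f) * r) := by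
      rw [single_mul_single, one_mul, one_smul, ← mul_assoc, ← map_mul, ← mul_assoc, ← pow_add, ← h]
    rw [this]
    exact I.mul_mem_right _ _ (hN' i)
  let _ := D.algebraSq
  obtain ⟨T, hT⟩ := D.finite_sq.1
  let mon (e : Fin n → Fin N) : MvPolynomial (Fin n) k :=
    monomial (Finsupp.equivFunOnFinite.symm fun i => (e i : ℕ)) 1
  -- Only monomials with all exponents below `N`, times generators of `R` over the squares and group
  -- elements, survive modulo `I`.
  let U : Submodule k (Smash R G) := Submodule.span k
    (Set.range fun p : (Fin n → Fin N) × G × T => single p.2.1 (D.sqHom (mon p.1) * p.2.2.1))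
  refine ⟨U, Submodule.fg_span (Set.finite_range _), ?_⟩
  suffices h : ∀ a, a ∈ U ⊔ idealToSubmodule I by
    intro a
    obtain ⟨u, hu, v, hv, rfl⟩ := Submodule.mem_sup.1 (h a)
    exact ⟨u, hu, by rwa [add_sub_cancel_left]⟩
  have hlin (g : G) (r : R) (c : k) : single g (c • r) = c • (single g r : Smash R G) :=
    (smul_single c g r).symm
  have key (g : G) (r : R) : ∀ f, single g (D.sqHom f * r) ∈ U ⊔ idealToSubmodule I := by
    have hr : r ∈ Submodule.span (MvPolynomial (Fin n) k) (T : Set R) := hT ▸ Submodule.mem_top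
    induction hr using Submodule.span_induction with
    | zero =>
      intro f
      rw [mul_zero, single_zero]
      exact zero_mem _
    | add r s _ _ hr hs =>
      intro f
      rw [mul_add, single_add]
      exact add_mem (hr f) (hs f)
    | smul f' r _ hr =>
      intro f
      have : D.sqHom f * (f' • r) = D.sqHom (f * f') * r := by
        rw [map_mul, mul_assoc]
        rfl
      rw [this]
      exact hr _
    | mem t ht =>
      intro f
      induction f using MvPolynomial.induction_on' with
      | add p q hp hq =>
        rw [map_add, add_mul, single_add]
        exact add_mem hp hq
      | monomial s c =>
        have hs : monomial s c = c • (monomial s 1 : MvPolynomial (Fin n) k) := by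
          rw [smul_monomial, smul_eq_mul, mul_one]
        rw [hs, map_smul, smul_mul_assoc, hlin]
        refine Submodule.smul_mem _ _ ?_
        by_cases hlt : ∀ i, s i < N
        · refine Submodule.mem_sup_left (Submodule.subset_span
            ⟨(fun i => ⟨s i, hlt i⟩, g, ⟨t, ht⟩), ?_⟩)
          have : mon (fun i => ⟨s i, hlt i⟩) = monomial s 1 := by
            simp only [mon]
            congr 1
            ext i
            simp
          simp only [this]
        · push Not at hlt
          obtain ⟨i, hi⟩ := hlt
          refine Submodule.mem_sup_right ?_
          have : (monomial s 1 : MvPolynomial (Fin n) k) =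
              MvPolynomial.X i ^ N * monomial (s - Finsupp.single i N) 1 := by
            rw [X_pow_eq_monomial, monomial_mul, mul_one, add_tsub_cancel_of_le]
            rwa [Finsupp.single_le_iff]
          rw [this]
          exact hN i _ t g
  intro a
  rw [← Smash.sum_single_coeff a]
  refine Submodule.sum_mem _ fun g _ => ?_
  simpa using key g (a.coeff g) 1

end

end SkewGenerators

end Pertinency
namespace Pertinency

/-! ### The Gelfand-Kirillov dimension of an algebra with anticommuting generators -/

section RestrictDegree

open MvPolynomial

variable (k : Type*) [Field k] (n : ℕ)

lemma finrank_restrictDegree (m : ℕ) :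
    Module.finrank k (restrictDegree (Fin n) k m) = (m + 1) ^ n := by
  let e : {s : Fin n →₀ ℕ | ∀ i, s i ≤ m} ≃ (Fin n → Fin (m + 1)) :=
    { toFun s i := ⟨s.1 i, Nat.lt_succ_of_le (s.2 i)⟩
      invFun f := ⟨Finsupp.equivFunOnFinite.symm fun i => f i, fun i => Nat.le_of_lt_succ (f i).2⟩
      left_inv s := by ext i; simp
      right_inv f := by ext i; simp }
  rw [restrictDegree, Module.finrank_eq_nat_card_basis (basisRestrictSupport k _), Nat.card_congr e]
  simp

variable {k n}

lemma restrictDegree_mono {a b : ℕ} (h : a ≤ b) :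
    restrictDegree (Fin n) k a ≤ restrictDegree (Fin n) k b := by
  intro p hp
  rw [mem_restrictDegree] at hp ⊢
  exact fun s hs i => (hp s hs i).trans h

lemma exists_mem_restrictDegree (p : MvPolynomial (Fin n) k) :
    ∃ a, p ∈ restrictDegree (Fin n) k a :=
  ⟨p.totalDegree, restrictTotalDegree_le_restrictDegree _ _ _
    ((mem_restrictTotalDegree _ _ _).2 le_rfl)⟩

lemma restrictDegree_mul_le (a b : ℕ) :
    restrictDegree (Fin n) k a * restrictDegree (Fin n) k b ≤ restrictDegree (Fin n) k (a + b) := by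
  rw [Submodule.mul_le]
  intro p hp q hq
  rw [mem_restrictDegree] at hp hq ⊢
  intro s hs i
  have hp' := degreeOf_le_iff.2 fun s hs => hp s hs i
  have hq' := degreeOf_le_iff.2 fun s hs => hq s hs i
  exact degreeOf_le_iff.1 ((degreeOf_mul_le i p q).trans (add_le_add hp' hq')) s hs

lemma monomial_mem_restrictDegree {s : Fin n →₀ ℕ} {a : ℕ} (h : ∀ i, s i ≤ a) (c : k) :
    monomial s c ∈ restrictDegree (Fin n) k a := by
  rw [mem_restrictDegree]
  intro t ht
  rw [Finset.mem_singleton.1 (support_monomial_subset ht)]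
  exact h

lemma restrictDegree_le_pow (m : ℕ) :
    restrictDegree (Fin n) k m ≤ restrictDegree (Fin n) k 1 ^ m := by
  induction m with
  | zero =>
    intro p hp
    rw [mem_restrictDegree] at hp
    rw [pow_zero, p.as_sum]
    refine Submodule.sum_mem _ fun s hs => ?_
    have : s = 0 := by
      ext i
      simpa using hp s hs i
    rw [this, Submodule.mem_one]
    exact ⟨_, rfl⟩
  | succ m ih =>
    intro p hp
    rw [mem_restrictDegree] at hp
    rw [pow_succ, p.as_sum]
    refine Submodule.sum_mem _ fun s hs => ?_
    -- Splitting off one factor of every variable that occurs lowers all nonzero exponents at once.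
    let t : Fin n →₀ ℕ := Finsupp.equivFunOnFinite.symm fun i => min (s i) 1
    have h : monomial s (p.coeff s) = monomial (s - t) (p.coeff s) * monomial t 1 := by
      rw [monomial_mul, mul_one, tsub_add_cancel_of_le]
      intro i
      simp [t]
    rw [h]
    refine Submodule.mul_mem_mul (ih (monomial_mem_restrictDegree (fun i => ?_) _))
      (monomial_mem_restrictDegree (fun i => ?_) _)
    · have := hp s hs i
      simp only [Finsupp.tsub_apply, t, Finsupp.equivFunOnFinite_symm_apply_apply]
      omega
    · simp [t]

end RestrictDegree

namespace SkewGenerators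

open MvPolynomial Filter Topology

variable {k : Type u} {R : Type v} [Field k] [Ring R] [Algebra k R] {n : ℕ}
  (D : SkewGenerators k R n)

/-- The elements `∑ φ(f_i) t_i` with `t_i ∈ T` and `f_i` of degree at most `a` in every variable. -/
noncomputable def filtration (T : Submodule k R) (a : ℕ) : Submodule k R :=
  (restrictDegree (Fin n) k a).map D.sqHom.toLinearMap * T

lemma filtration_mono (T : Submodule k R) : Monotone (D.filtration T) := fun _ _ h =>
  mul_le_mul' (Submodule.map_mono (restrictDegree_mono h)) le_rfl

lemma exists_filtration : ∃ T : Submodule k R, T.FG ∧ 1 ∈ T ∧ ∀ r, ∃ a, r ∈ D.filtration T a := by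
  classical
  let _ := D.algebraSq
  obtain ⟨T, hT⟩ := D.finite_sq.1
  refine ⟨Submodule.span k (insert 1 T : Finset R), ⟨_, rfl⟩, Submodule.subset_span (by simp),
    fun r => ?_⟩
  have hr : r ∈ Submodule.span (MvPolynomial (Fin n) k) (T : Set R) := hT ▸ Submodule.mem_top
  rw [Submodule.mem_span_finset] at hr
  obtain ⟨f, _, rfl⟩ := hr
  choose a ha using fun t => exists_mem_restrictDegree (f t)
  refine ⟨T.sup a, Submodule.sum_mem _ fun t ht => ?_⟩
  refine Submodule.mul_mem_mul ⟨f t, restrictDegree_mono (Finset.le_sup ht) (ha t), rfl⟩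
    (Submodule.subset_span (by simp [ht]))

lemma exists_le_filtration {T : Submodule k R} (hT : ∀ r, ∃ a, r ∈ D.filtration T a)
    {W : Submodule k R} (hW : W.FG) : ∃ a, W ≤ D.filtration T a := by
  obtain ⟨F, rfl⟩ := hW
  choose a ha using hT
  refine ⟨F.sup a, Submodule.span_le.2 fun r hr => ?_⟩
  exact D.filtration_mono T (Finset.le_sup hr) (ha r)

lemma map_sqHom_mul (P : Submodule k (MvPolynomial (Fin n) k)) (W : Submodule k R) :
    P.map D.sqHom.toLinearMap * W = W * P.map D.sqHom.toLinearMap := by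
  refine le_antisymm (Submodule.mul_le.2 ?_) (Submodule.mul_le.2 ?_)
  · rintro _ ⟨f, hf, rfl⟩ w hw
    change D.sqHom f * w ∈ _
    rw [D.sqHom_mul]
    exact Submodule.mul_mem_mul hw ⟨f, hf, rfl⟩
  · rintro w hw _ ⟨f, hf, rfl⟩
    change w * D.sqHom f ∈ _
    rw [← D.sqHom_mul]
    exact Submodule.mul_mem_mul ⟨f, hf, rfl⟩ hw

/-- The coefficients are central, so the bound for one factor `V` iterates and the degrees add up.
-/
lemma pow_mul_le_filtration {T V : Submodule k R} {c : ℕ} (h : V * T ≤ D.filtration T c) (m : ℕ) :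
    V ^ m * T ≤ D.filtration T (c * m) := by
  induction m with
  | zero =>
    rw [pow_zero, filtration]
    refine mul_le_mul' ?_ le_rfl
    rw [Submodule.one_le]
    refine ⟨1, ?_, map_one D.sqHom⟩
    exact monomial_mem_restrictDegree (s := 0) (by simp) 1
  | succ m ih =>
    calc V ^ (m + 1) * T = V ^ m * (V * T) := by rw [pow_succ, mul_assoc]
      _ ≤ V ^ m * D.filtration T c := mul_le_mul' le_rfl h
      _ = (restrictDegree (Fin n) k c).map D.sqHom.toLinearMap * (V ^ m * T) := by
        rw [filtration, ← mul_assoc, ← mul_assoc, D.map_sqHom_mul]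
      _ ≤ (restrictDegree (Fin n) k c).map D.sqHom.toLinearMap * D.filtration T (c * m) :=
        mul_le_mul' le_rfl ih
      _ ≤ D.filtration T (c * (m + 1)) := by
        rw [filtration, filtration, ← mul_assoc, mul_add_one, add_comm (c * m)]
        refine mul_le_mul' ?_ le_rfl
        rw [← Submodule.map_mul]
        exact Submodule.map_mono (restrictDegree_mul_le _ _)

lemma finrank_filtration_le {T : Submodule k R} (hT : T.FG) (a : ℕ) :
    Module.finrank k (D.filtration T a) ≤ (a + 1) ^ n * Module.finrank k T := by
  have := Module.Finite.iff_fg.2 hT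
  let P := (restrictDegree (Fin n) k a).map D.sqHom.toLinearMap
  have hP : Module.finrank k P ≤ (a + 1) ^ n :=
    (Submodule.finrank_map_le _ _).trans (finrank_restrictDegree k n a).le
  have : Module.Finite k P := inferInstance
  rw [filtration, ← Submodule.mulMap_range]
  refine (LinearMap.finrank_range_le _).trans ?_
  rw [Module.finrank_tensorProduct]
  exact Nat.mul_le_mul_right _ hP

lemma fg_filtration {T : Submodule k R} (hT : T.FG) (a : ℕ) : (D.filtration T a).FG :=
  ((Module.Finite.iff_fg.1 inferInstance).map _).mul hT

lemma _root_.Pertinency.tendsto_log_mul_pow_div {K : ℝ} (hK : 0 < K) (n : ℕ) :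
    Tendsto (fun m : ℕ => Real.log (K * (m : ℝ) ^ n) / Real.log m) atTop (𝓝 n) := by
  have h : Tendsto (fun m : ℕ => Real.log K / Real.log m + n) atTop (𝓝 (0 + n)) :=
    (tendsto_const_nhds.div_atTop
      (Real.tendsto_log_atTop.comp tendsto_natCast_atTop_atTop)).add_const _
  rw [zero_add] at h
  refine h.congr' ?_
  filter_upwards [eventually_ge_atTop 2] with m hm
  have hm' : (1 : ℝ) < m := by exact_mod_cast hm
  have hlog : Real.log m ≠ 0 := (Real.log_pos hm').ne'
  rw [Real.log_mul hK.ne' (by positivity), Real.log_pow]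
  field_simp

include D in
-- `V ^ m` lies in the filtration step `c m`, whose dimension is at most `(c m + 1) ^ n` times a
-- constant.
lemma gkdim_le : GKdim k R ≤ ((n : ℝ) : EReal) := by
  obtain ⟨T, hT, h1, hR⟩ := D.exists_filtration
  refine iSup_le fun V => iSup_le fun hV => ?_
  obtain ⟨c, hc⟩ := D.exists_le_filtration hR (hV.mul hT)
  let K := (c + 1) ^ n * (Module.finrank k T + 1)
  have hK : 0 < K := by positivity
  -- `max m 1` keeps the bound positive at `m = 0`.
  refine limsup_log_div_le (D := fun m => K * (max m 1) ^ n) (fun m => ?_) (fun m => ?_) ?_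
  · exact Nat.mul_pos hK (pow_pos (by omega) _)
  · have hle : V ^ m ≤ D.filtration T (c * m) := by
      refine le_trans ?_ (D.pow_mul_le_filtration hc m)
      intro v hv
      simpa using Submodule.mul_mem_mul hv h1
    have := Module.Finite.iff_fg.2 (D.fg_filtration hT (c * m))
    refine (Submodule.finrank_mono hle).trans ((D.finrank_filtration_le hT _).trans ?_)
    have hcm : c * m + 1 ≤ (c + 1) * max m 1 := by
      have := Nat.mul_le_mul_left c (le_max_left m 1)
      rw [add_mul]
      omega
    calc (c * m + 1) ^ n * Module.finrank k T
        ≤ ((c + 1) * max m 1) ^ n * (Module.finrank k T + 1) :=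
          Nat.mul_le_mul (Nat.pow_le_pow_left hcm n) (Nat.le_succ _)
      _ = K * max m 1 ^ n := by rw [mul_pow]; simp only [K]; ring
  · refine (tendsto_log_mul_pow_div (K := K) (by exact_mod_cast hK) n).congr' ?_
    filter_upwards [eventually_ge_atTop 1] with m hm
    rw [max_eq_left hm]
    push_cast
    rfl

lemma le_gkdim (hD : Function.Injective D.sqHom) : ((n : ℝ) : EReal) ≤ GKdim k R := by
  let V := (restrictDegree (Fin n) k 1).map D.sqHom.toLinearMap
  have hV : V.FG := (Module.Finite.iff_fg.1 inferInstance).map _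
  refine le_iSup₂_of_le (f := fun (V : Submodule k R) (_ : V.FG) => Filter.limsup
      (fun m : ℕ => ENNReal.log (Module.finrank k ↥(V ^ m) : ENNReal) /
        ((Real.log (m : ℝ) : ℝ) : EReal)) Filter.atTop) V hV ?_
  refine le_limsup_log_div (D := fun m => m ^ n) (fun m hm => Nat.pow_pos hm) (fun m => ?_) ?_
  · have hle : (restrictDegree (Fin n) k m).map D.sqHom.toLinearMap ≤ V ^ m := by
      rw [← Submodule.map_pow]
      exact Submodule.map_mono (restrictDegree_le_pow m)
    have := Module.Finite.iff_fg.2 (hV.pow m)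
    refine le_trans ?_ (Submodule.finrank_mono hle)
    rw [← (Submodule.equivMapOfInjective D.sqHom.toLinearMap hD _).finrank_eq,
      finrank_restrictDegree]
    exact Nat.pow_le_pow_left (Nat.le_succ m) n
  · simpa using tendsto_log_mul_pow_div one_pos n

theorem gkdim_eq (hD : Function.Injective D.sqHom) : GKdim k R = ((n : ℝ) : EReal) :=
  le_antisymm D.gkdim_le (D.le_gkdim hD)

end SkewGenerators

namespace SkewRing

noncomputable section

open MvPolynomial

variable (k : Type u) [Field k] (n : ℕ)

/-- The automorphism of the polynomial ring that changes the signs of the variables before the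
`i`-th one. -/
def sign (i : Fin n) : MvPolynomial (Fin n) k →ₐ[k] MvPolynomial (Fin n) k :=
  aeval fun j => if j < i then -MvPolynomial.X j else MvPolynomial.X j

/-- The representation of the skew polynomial ring on the polynomial ring. -/
def signRep (i : Fin n) : Module.End k (MvPolynomial (Fin n) k) :=
  LinearMap.mulLeft k (MvPolynomial.X i) ∘ₗ (sign k n i).toLinearMap

lemma sign_X (i j : Fin n) :
    sign k n i (MvPolynomial.X j) = if j < i then -MvPolynomial.X j else MvPolynomial.X j := by
  simp [sign]

lemma signRep_mul (i j : Fin n) (f : MvPolynomial (Fin n) k) :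
    signRep k n i (signRep k n j f) =
      (if j < i then -1 else 1) * (MvPolynomial.X i * MvPolynomial.X j * sign k n i (sign k n j f)) := by
  change MvPolynomial.X i * sign k n i (MvPolynomial.X j * sign k n j f) = _
  rw [map_mul, sign_X]
  split_ifs <;> ring

lemma sign_comm (i j : Fin n) (f : MvPolynomial (Fin n) k) :
    sign k n i (sign k n j f) = sign k n j (sign k n i f) := by
  have : (sign k n i).comp (sign k n j) = (sign k n j).comp (sign k n i) :=
    MvPolynomial.algHom_ext fun l => by
      simp only [AlgHom.comp_apply, sign_X]
      split_ifs <;> simp [sign_X, *]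
  exact congrArg (fun h => h f) this

lemma sign_sign (i : Fin n) (f : MvPolynomial (Fin n) k) : sign k n i (sign k n i f) = f := by
  have : (sign k n i).comp (sign k n i) = AlgHom.id k _ :=
    MvPolynomial.algHom_ext fun l => by
      simp only [AlgHom.comp_apply, sign_X]
      split_ifs <;> simp [sign_X, *]
  exact congrArg (fun h => h f) this

/-- The representation of the skew polynomial ring on the polynomial ring. -/
def rep : SkewRing k n →ₐ[k] Module.End k (MvPolynomial (Fin n) k) :=
  lift (signRep k n) fun i j h => LinearMap.ext fun f => by
    rw [LinearMap.neg_apply, Module.End.mul_apply, Module.End.mul_apply, signRep_mul, signRep_mul,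
      sign_comm k n j i]
    rcases lt_or_gt_of_ne h with h | h
    · rw [if_neg h.not_gt, if_pos h]
      ring
    · rw [if_pos h, if_neg h.not_gt]
      ring

lemma rep_X (i : Fin n) : rep k n (X k n i) = signRep k n i := lift_X ..

/-- `sign i` is an involution that fixes `X_i`, so `x_i²` acts as multiplication by `X_i²`.
Evaluating at `1` then shows that the squares are algebraically independent. -/
lemma rep_sqHom (f : MvPolynomial (Fin n) k) :
    rep k n ((generators k n).sqHom f) = LinearMap.mulLeft k (expand 2 f) := by
  have : (rep k n).comp (generators k n).sqHom =
      (Algebra.lmul k (MvPolynomial (Fin n) k)).comp (expand 2) :=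
    MvPolynomial.algHom_ext fun i => LinearMap.ext fun g => by
      rw [AlgHom.comp_apply, SkewGenerators.sqHom_X]
      change rep k n (X k n i * X k n i) g = expand 2 (MvPolynomial.X i) * g
      rw [map_mul, rep_X, Module.End.mul_apply, signRep_mul, sign_sign, if_neg (lt_irrefl i),
        expand_X]
      ring
  exact congrArg (fun h => h f) this

lemma sqHom_injective : Function.Injective (generators k n).sqHom := by
  intro f g h
  apply expand_injective (n := 2) (by norm_num)
  have := congrArg (fun a => rep k n a 1) h
  simp only [rep_sqHom, LinearMap.mulLeft_apply, mul_one] at this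
  exact this

end

end SkewRing

end Pertinency
namespace Pertinency

/-! ### The quotient of the smash product by the ideal of the integral -/

/-- Nontriviality matters: the zero algebra has GK-dimension `⊥`. The lower bound comes from the
subspace of scalars. -/
lemma GKdim_eq_zero_of_finite {k : Type u} [Field k] {A : Type v} [Ring A] [Algebra k A]
    [Module.Finite k A] [Nontrivial A] : GKdim k A = 0 := by
  refine le_antisymm (iSup₂_le fun V _ => ?_) (le_iSup₂_of_le (1 : Submodule k A)
    (Submodule.one_eq_span (R := k) (A := A) ▸ Submodule.fg_span_singleton _) ?_)
  · rw [← EReal.coe_zero]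
    refine limsup_log_div_le (D := fun _ => Module.finrank k A + 1) (by simp) (fun m => ?_)
      (tendsto_log_const_div _)
    exact (Submodule.finrank_le _).trans (Nat.le_succ _)
  · rw [← EReal.coe_zero]
    refine le_limsup_log_div (D := fun _ => 1) (fun _ _ => le_rfl) (fun m => ?_)
      (tendsto_log_const_div _)
    rw [one_pow, Submodule.one_eq_span, finrank_span_singleton one_ne_zero]

lemma GKdim_quotient_eq_zero {k : Type u} [Field k] {A : Type v} [Ring A] [Algebra k A]
    (I : TwoSidedIdeal A) {U : Submodule k A} (hU : U.FG) (h : ∀ a, ∃ u ∈ U, a - u ∈ I)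
    (h1 : (1 : A) ∉ I) : GKdim k I.ringCon.Quotient = 0 := by
  have : Module.Finite k U := Module.Finite.iff_fg.2 hU
  let π : A →ₐ[k] I.ringCon.Quotient := { I.ringCon.mk' with commutes' := fun _ => rfl }
  have : Module.Finite k I.ringCon.Quotient := by
    refine Module.Finite.of_surjective (π.toLinearMap ∘ₗ U.subtype) fun q => ?_
    obtain ⟨a, rfl⟩ := I.ringCon.mk'_surjective q
    obtain ⟨u, hu, hau⟩ := h a
    refine ⟨⟨u, hu⟩, (RingCon.eq _).2 ?_⟩
    exact I.ringCon.symm ((I.rel_iff _ _).2 hau)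
  have : Nontrivial I.ringCon.Quotient := by
    refine ⟨π 1, π 0, fun e => h1 ?_⟩
    have := (I.rel_iff _ _).1 ((RingCon.eq I.ringCon).1 e)
    rwa [sub_zero] at this
  exact GKdim_eq_zero_of_finite

namespace Smash

open SkewMonoidAlgebra

variable {k : Type u} [Field k] {R : Type u} [Ring R] [Algebra k R] {G : Type u} [Group G]
  [Fintype G] [MulSemiringAction G R] [SMulCommClass G k R]

/-- The elements of the smash product whose coefficients have the same image under an invariant
character. -/
noncomputable def constIdeal (ε : R →ₐ[k] k) (hε : ∀ (g : G) r, ε (g • r) = ε r) : TwoSidedIdeal (Smash R G) :=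
  .mk' {a | ∀ g h, ε (a.coeff g) = ε (a.coeff h)} (fun g h => by simp)
    (fun ha hb g h => by simp [ha g h, hb g h])
    (fun {a} ha g h => by
      have (g : G) : (-a).coeff g = -a.coeff g := rfl
      rw [this, this, map_neg, map_neg, ha g h])
    (fun {a b} hb => by
      induction a using induction_single with
      | hs g r =>
        intro h h'
        rw [coeff_single_mul, coeff_single_mul, map_mul ε, map_mul ε, hε, hε, hb _ (g⁻¹ * h')]
      | ha a a' h h' =>
        intro g g'
        rw [add_mul, coeff_add, Finsupp.add_apply, Finsupp.add_apply, map_add, map_add, h g g',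
          h' g g'])
    (fun {a b} ha => by
      induction b using induction_single with
      | hs g r =>
        intro h h'
        rw [coeff_mul_single, coeff_mul_single, map_mul ε, map_mul ε, hε, hε, ha _ (h' * g⁻¹)]
      | ha b b' h h' =>
        intro g g'
        rw [mul_add, coeff_add, Finsupp.add_apply, Finsupp.add_apply, map_add, map_add, h g g',
          h' g g'])

/-- Under `ε` the smash product maps to `kG`, and `constIdeal` is the preimage of the multiples of
`∑ g`. It contains the integral but not `1`, because `G` has a second element. -/
lemma one_notMem_integralIdeal [Nontrivial G] (ε : R →ₐ[k] k)
    (hε : ∀ (g : G) r, ε (g • r) = ε r) : (1 : Smash R G) ∉ integralIdeal k R G := by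
  classical
  have hle : integralIdeal k R G ≤ constIdeal ε hε := by
    rw [integralIdeal, TwoSidedIdeal.span_le, Set.singleton_subset_iff, constIdeal,
      TwoSidedIdeal.coe_mk']
    intro g h
    have (g : G) : (smashIntegral k R G).coeff g = (Fintype.card G : k)⁻¹ • (1 : R) := by
      rw [smashIntegral, coeff_smul, Finsupp.smul_apply, coeff_sum_single]
    rw [this, this]
  intro h1
  obtain ⟨g, hg⟩ := exists_ne (1 : G)
  have h := (TwoSidedIdeal.mem_mk' ..).1 (hle h1) 1 g
  rw [one_def, coeff_single_apply, coeff_single_apply, if_pos rfl, if_neg hg.symm, map_one,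
    map_zero] at h
  exact one_ne_zero h

end Smash

end Pertinency
namespace Pertinency

/-! ### Actions permuting anticommuting generators -/

namespace SkewGenerators

open SkewMonoidAlgebra

variable {k R : Type u} [Field k] [Ring R] [Algebra k R] {n : ℕ} (D : SkewGenerators k R n)
  {G : Type u} [Group G] [Fintype G] [MulSemiringAction G R] [SMulCommClass G k R]
  [MulAction G (Fin n)] (hgx : ∀ (g : G) i, g • D.x i = D.x (g • i))
  {ℛ : ℕ → Submodule k R}

omit [Fintype G] in
lemma smul_mem_pow_span (hgx : ∀ (g : G) i, g • D.x i = D.x (g • i)) (g : G) (m : ℕ) (r : R)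
    (hr : r ∈ Submodule.span k (Set.range D.x) ^ m) :
    g • r ∈ Submodule.span k (Set.range D.x) ^ m := by
  have hle : (Submodule.span k (Set.range D.x) ^ m).map
      (MulSemiringAction.toAlgHom k R g).toLinearMap ≤ Submodule.span k (Set.range D.x) ^ m := by
    rw [Submodule.map_pow, Submodule.map_span]
    refine pow_le_pow_left' (Submodule.span_mono ?_) m
    rintro _ ⟨_, ⟨i, rfl⟩, rfl⟩
    exact ⟨g • i, (hgx g i).symm⟩
  exact hle ⟨r, hr, rfl⟩

omit [Fintype G] in
include hgx in
lemma character_smul (ε : R →ₐ[k] k) (hε : ∀ i, ε (D.x i) = 0) (g : G) (r : R) :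
    ε (g • r) = ε r := by
  have : ε.comp (MulSemiringAction.toAlgHom k R g) = ε := by
    refine AlgHom.ext_of_adjoin_eq_top D.adjoin_eq_top ?_
    rintro _ ⟨i, rfl⟩
    change ε (g • D.x i) = ε (D.x i)
    rw [hgx, hε, hε]
  exact congrArg (fun f => f r) this

include hgx in
lemma pertinency_eq_GKdim [Nontrivial G]
    (hI : ∀ i, ∃ N : ℕ, single 1 (D.sqHom (MvPolynomial.X i ^ N)) ∈ integralIdeal k R G)
    (ε : R →ₐ[k] k) (hε : ∀ i, ε (D.x i) = 0) : pertinency k R G = GKdim k R := by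
  obtain ⟨U, hU, hUe⟩ := D.exists_fg_add_mem (integralIdeal k R G) hI
  rw [pertinency, GKdim_quotient_eq_zero _ hU hUe
    (Smash.one_notMem_integralIdeal ε (D.character_smul hgx ε hε)), sub_zero]

include hgx in
lemma exists_pow_mem_integralIdeal (hG : (Fintype.card G : k) ≠ 0) {σ : G}
    (hσ : ∀ g, g ∈ Subgroup.zpowers σ) {d : ℕ} (hσd : σ ^ 2 ^ d = 1)
    (hinj : ∀ i : Fin n, ∀ a < 2 ^ d, ∀ b < 2 ^ d, σ ^ a • i = σ ^ b • i → a = b)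
    (h2 : (2 : k) ≠ 0) (i : Fin n) :
    ∃ N : ℕ, single 1 (D.sqHom (MvPolynomial.X i ^ N)) ∈ integralIdeal k R G := by
  refine Smash.exists_pow_mem (φ := D.sqHom.toRingHom) D.anticomm hgx D.sqHom_X D.sqHom_mul
    (fun g f => D.smul_sqHom g _ (hgx g) f) hσ hσd hinj h2 ?_ i
  -- Scaling the integral by `|G|` gives the sum of the group elements.
  have h : smashIntegral k R G ∈ integralIdeal k R G := TwoSidedIdeal.subset_span rfl
  have := (idealToSubmodule (k := k) (integralIdeal k R G)).smul_mem (Fintype.card G : k) h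
  rwa [smashIntegral, smul_smul, mul_inv_cancel₀ hG, one_smul] at this

section Equivalence

variable [SetLike.GradedMonoid ℛ] (hint : DirectSum.IsInternal ℛ)
  (hℛ : ∀ (g : G) m, ∀ r ∈ ℛ m, g • r ∈ ℛ m) (hG : (Fintype.card G : k) ≠ 0)
  (hI : ∀ i, ∃ N : ℕ, single 1 (D.sqHom (MvPolynomial.X i ^ N)) ∈ integralIdeal k R G)

include hgx hint hℛ hG hI

theorem nonempty_qgr_equivalence :
    Nonempty (qgr k (Smash R G) (smashGrading G ℛ) 0 ≌
      qgr k (Invariants k R G) (invariantGrading G ℛ) 0) := by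
  let C := MvPolynomial.symmetricSubalgebra (Fin n) k
  let _ := D.algebraSymSmash hgx
  let _ := D.algebraSymInvariants hgx
  have := D.isScalarTower_symSmash hgx
  have := D.isScalarTower_symInvariants hgx
  have := D.finite_symSmash hgx
  have := D.finite_symInvariants hgx
  have := isNoetherianRing_op_of_finite C (Smash R G)
  have := isNoetherianRing_op_of_finite C (Invariants k R G)
  have := finiteType_op_of_finite k C (Smash R G)
  have := finiteType_op_of_finite k C (Invariants k R G)
  have := gradedMonoid_smashGrading hℛ
  obtain ⟨U, hU, hUe⟩ := D.exists_fg_add_mem (integralIdeal k R G) hI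
  exact (Smash.corner hG hℛ).nonempty_qgr_equivalence C (fun _ => rfl) hU hUe
    (isInternal_smashGrading hint).submodule_iSup_eq_top

theorem isGradedIsolatedSingularity [∀ m, Module.Finite k (ℛ m)] [Nontrivial R] (hℛ0 : ℛ 0 = 1)
    {c : ℕ} (hpd : ∀ (M : Type u) [AddCommGroup M] [Module (Smash R G)ᵐᵒᵖ M],
      PdLE (Smash R G)ᵐᵒᵖ M c) :
    IsGradedIsolatedSingularity k (Invariants k R G) (invariantGrading G ℛ) := by
  let C := MvPolynomial.symmetricSubalgebra (Fin n) k
  let _ := D.algebraSymSmash hgx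
  let _ := D.algebraSymInvariants hgx
  have := D.isScalarTower_symSmash hgx
  have := D.isScalarTower_symInvariants hgx
  have := D.finite_symSmash hgx
  have := D.finite_symInvariants hgx
  have := isNoetherianRing_op_of_finite C (Smash R G)
  have := isNoetherianRing_op_of_finite C (Invariants k R G)
  have := finiteType_op_of_finite k C (Smash R G)
  have := finiteType_op_of_finite k C (Invariants k R G)
  have := gradedMonoid_smashGrading hℛ
  have hsm := isInternal_smashGrading (G := G) hint
  obtain ⟨U, hU, hUe⟩ := D.exists_fg_add_mem (integralIdeal k R G) hI
  refine ⟨⟨inferInstance, inferInstance, isInternal_invariantGrading hℛ hint, ?_⟩,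
    isNoetherianRing_of_finite C _, inferInstance, ?_⟩
  · ext b
    rw [invariantGrading, hℛ0, Submodule.mem_comap, Submodule.mem_one, Submodule.mem_one]
    exact exists_congr fun c => ⟨fun h => Subtype.ext h, fun h => congrArg Subtype.val h⟩
  · exact (Smash.corner hG hℛ).hasFiniteGlobalDimension_qgr C (fun _ => rfl) hU hUe
      hsm.submodule_iSup_eq_top fun M => GrMod.hasProjectiveDimensionLE hsm M c (hpd M.carrier)

end Equivalence

end SkewGenerators

end Pertinency
namespace Pertinency

/-! ### The cyclic permutation of the generators -/

namespace SkewRing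

variable (k : Type u) [Field k] (n : ℕ)

/-- The character with `x_i ↦ c` for one `i` and `x_j ↦ 0` for `j ≠ i`. -/
noncomputable def axisChar (i : Fin n) (c : k) : SkewRing k n →ₐ[k] k :=
  lift (Pi.single i c) fun j l h => by
    by_cases hj : j = i
    · subst hj
      rw [Pi.single_eq_of_ne h.symm, mul_zero, zero_mul, neg_zero]
    · rw [Pi.single_eq_of_ne hj, mul_zero, zero_mul, neg_zero]

lemma axisChar_X (i : Fin n) (c : k) (j : Fin n) :
    axisChar k n i c (X k n j) = Pi.single (M := fun _ => k) i c j :=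
  lift_X ..

lemma X_injective : Function.Injective (X k n) := fun i j h => by
  by_contra hij
  have := congrArg (axisChar k n i 1) h
  rw [axisChar_X, axisChar_X, Pi.single_eq_same, Pi.single_eq_of_ne (Ne.symm hij)] at this
  exact one_ne_zero this

/-- The character with `x_i ↦ 0`. -/
noncomputable def zeroChar : SkewRing k n →ₐ[k] k := lift (fun _ => 0) (by simp)

lemma zeroChar_X (i : Fin n) : zeroChar k n (X k n i) = 0 := lift_X ..

instance : Nontrivial (SkewRing k n) :=
  Function.Surjective.nontrivial (f := zeroChar k n) fun c =>
    ⟨algebraMap k _ c, AlgHom.commutes _ c⟩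

end SkewRing

namespace SkewPoly

variable (k : Type u) [Field k] (n : ℕ)

/-- The generators, as anticommuting generators. -/
noncomputable def generators : SkewGenerators k (SkewPoly k n) n := SkewRing.generators k n

instance : SetLike.GradedMonoid (grading k n) :=
  inferInstanceAs (SetLike.GradedMonoid (SkewRing.grading k n))

instance (m : ℕ) : Module.Finite k (grading k n m) :=
  inferInstanceAs (Module.Finite k (SkewRing.grading k n m))

instance : Nontrivial (SkewPoly k n) := inferInstanceAs (Nontrivial (SkewRing k n))

lemma isInternal_grading : DirectSum.IsInternal (grading k n) := SkewRing.isInternal_grading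

lemma GKdim_eq : GKdim k (SkewPoly k n) = ((n : ℝ) : EReal) :=
  (generators k n).gkdim_eq (SkewRing.sqHom_injective k n)

lemma permAut_injective : Function.Injective (permAut k n) := fun π τ h => by
  ext1 i
  have := congrArg (fun f : SkewPoly k n ≃ₐ[k] SkewPoly k n => f (X k n i)) h
  rw [permAut_X, permAut_X] at this
  exact SkewRing.X_injective k n this

/-- The permutations of the generators given by the elements of the cyclic group. -/
noncomputable def cyclicGroupPerm : cyclicGroup k n →* Equiv.Perm (Fin n) :=
  (MonoidHom.ofInjective (permAut_injective k n)).symm.toMonoidHom.comp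
    (Subgroup.inclusion ((Subgroup.zpowers_le (H := (permAut k n).range)).2 ⟨_, rfl⟩))

lemma permAut_cyclicGroupPerm (g : cyclicGroup k n) : permAut k n (cyclicGroupPerm k n g) = g :=
  congrArg Subtype.val ((MonoidHom.ofInjective (permAut_injective k n)).apply_symm_apply _)

noncomputable instance : MulAction (cyclicGroup k n) (Fin n) :=
  MulAction.compHom (Fin n) (cyclicGroupPerm k n)

lemma smul_X (g : cyclicGroup k n) (i : Fin n) : g • X k n i = X k n (g • i) := by
  have : g • X k n i = permAut k n (cyclicGroupPerm k n g) (X k n i) := by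
    rw [permAut_cyclicGroupPerm]
    rfl
  rw [this, permAut_X]
  rfl

/-- The generator of the cyclic group. -/
noncomputable def rotation : cyclicGroup k n :=
  ⟨permAut k n (finRotate n), Subgroup.mem_zpowers _⟩

lemma mem_zpowers_rotation (g : cyclicGroup k n) : g ∈ Subgroup.zpowers (rotation k n) := by
  obtain ⟨m, hm⟩ := g.2
  exact ⟨m, Subtype.ext hm⟩

lemma val_rotation_pow_smul (a : ℕ) (i : Fin n) :
    ((rotation k n ^ a • i : Fin n) : ℕ) = (i + a) % n := by
  obtain _ | n := n
  · exact i.elim0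
  induction a with
  | zero => simp [Nat.mod_eq_of_lt i.2]
  | succ a ih =>
    have (j : Fin (n + 1)) : rotation k (n + 1) • j = j + 1 := by
      rw [← finRotate_apply]
      refine congrFun (congrArg DFunLike.coe (permAut_injective k (n + 1) ?_)) j
      exact permAut_cyclicGroupPerm ..
    rw [pow_succ', mul_smul, this, Fin.val_add, ih, Fin.val_one', ← Nat.add_mod, add_assoc]

lemma rotation_pow_eq_one : rotation k n ^ n = 1 := by
  apply Subtype.ext
  apply AlgEquiv.coe_toAlgHom_injective
  refine algHom_ext fun i => ?_
  change (rotation k n ^ n) • X k n i = X k n i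
  rw [smul_X]
  congr 1
  apply Fin.ext
  rw [val_rotation_pow_smul, Nat.add_mod_right, Nat.mod_eq_of_lt i.2]

lemma rotation_pow_smul_inj (i : Fin n) {a b : ℕ} (ha : a < n) (hb : b < n)
    (h : rotation k n ^ a • i = rotation k n ^ b • i) : a = b := by
  have h := congrArg Fin.val h
  rw [val_rotation_pow_smul, val_rotation_pow_smul] at h
  exact (Nat.ModEq.add_left_cancel' (i : ℕ) h).eq_of_lt_of_lt ha hb

/-- Divisibility suffices to make `|W|` invertible in `k` when `n` is. -/
lemma card_cyclicGroup_dvd : Fintype.card (cyclicGroup k n) ∣ n := by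
  rw [← Nat.card_eq_fintype_card, Nat.card_zpowers]
  exact orderOf_dvd_of_pow_eq_one (congrArg Subtype.val (rotation_pow_eq_one k n))

lemma nontrivial_cyclicGroup (hn : 2 ≤ n) : Nontrivial (cyclicGroup k n) := by
  refine ⟨rotation k n, 1, fun h => ?_⟩
  have := rotation_pow_smul_inj k n ⟨0, by omega⟩ (a := 0) (b := 1) (by omega) (by omega) (by rw [h]; simp)
  omega

end SkewPoly

end Pertinency

theorem proposition5p4 (k : Type u) [Field k] (n d : ℕ) (hd : 1 ≤ d) (hn : n = 2 ^ d)
    (hchar : ((2 * n : ℕ) : k) ≠ 0) :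
    (Pertinency.pertinency k (Pertinency.SkewPoly k n) (Pertinency.SkewPoly.cyclicGroup k n) =
        Pertinency.GKdim k (Pertinency.SkewPoly k n) ∧
      Pertinency.GKdim k (Pertinency.SkewPoly k n) = ((n : ℝ) : EReal) ∧
      2 ≤ n) ∧
    Nonempty
      (Pertinency.qgr k
          (Pertinency.Smash (Pertinency.SkewPoly k n) (Pertinency.SkewPoly.cyclicGroup k n))
          (Pertinency.smashGrading (Pertinency.SkewPoly.cyclicGroup k n)
            (Pertinency.SkewPoly.grading k n)) 0 ≌
        Pertinency.qgr k
          (Pertinency.Invariants k (Pertinency.SkewPoly k n) (Pertinency.SkewPoly.cyclicGroup k n))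
          (Pertinency.invariantGrading (Pertinency.SkewPoly.cyclicGroup k n)
            (Pertinency.SkewPoly.grading k n)) 0) ∧
    Pertinency.IsGradedIsolatedSingularity k
      (Pertinency.Invariants k (Pertinency.SkewPoly k n) (Pertinency.SkewPoly.cyclicGroup k n))
      (Pertinency.invariantGrading (Pertinency.SkewPoly.cyclicGroup k n)
        (Pertinency.SkewPoly.grading k n)) := by
  have hn2 : 2 ≤ n := hn ▸ Nat.le_self_pow (by omega) 2
  have h2 : (2 : k) ≠ 0 := fun h => hchar (by rw [Nat.cast_mul, Nat.cast_ofNat, h, zero_mul])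
  have hG : (Fintype.card (Pertinency.SkewPoly.cyclicGroup k n) : k) ≠ 0 := fun h => hchar <| by
    obtain ⟨c, hc⟩ := Pertinency.SkewPoly.card_cyclicGroup_dvd k n
    have : (n : k) = 0 := by rw [hc, Nat.cast_mul, h, zero_mul]
    rw [Nat.cast_mul, this, mul_zero]
  have := Pertinency.SkewPoly.nontrivial_cyclicGroup k n hn2
  have hI := (Pertinency.SkewPoly.generators k n).exists_pow_mem_integralIdeal (Pertinency.SkewPoly.smul_X k n) hG
    (Pertinency.SkewPoly.mem_zpowers_rotation k n) (d := d) (hn ▸ Pertinency.SkewPoly.rotation_pow_eq_one k n)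
    (fun i a ha b hb => Pertinency.SkewPoly.rotation_pow_smul_inj k n i (hn ▸ ha) (hn ▸ hb)) h2
  have hℛ := (Pertinency.SkewPoly.generators k n).smul_mem_pow_span (Pertinency.SkewPoly.smul_X k n)
  have hint := Pertinency.SkewPoly.isInternal_grading k n
  exact ⟨⟨(Pertinency.SkewPoly.generators k n).pertinency_eq_GKdim (Pertinency.SkewPoly.smul_X k n) hI (Pertinency.SkewRing.zeroChar k n)
      (Pertinency.SkewRing.zeroChar_X k n), Pertinency.SkewPoly.GKdim_eq k n, hn2⟩,
    (Pertinency.SkewPoly.generators k n).nonempty_qgr_equivalence (Pertinency.SkewPoly.smul_X k n) hint hℛ hG hI,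
    (Pertinency.SkewPoly.generators k n).isGradedIsolatedSingularity (Pertinency.SkewPoly.smul_X k n) hint hℛ hG hI (pow_zero _)
      fun M _ _ => Pertinency.SkewPoly.pdLE_smash_op k n (Pertinency.SkewPoly.cyclicGroup k n) hG M⟩
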